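/- Let $d\ge 2$ and let $f,g$ be monic complex polynomials of degree $d$. For $h\in\{f,g\}$ let $X(h)=\{z\in\mathbb C: h^n(z)\to\infty\}$ be the basin of infinity, $G_h(z)=\lim_{n\to\infty}d^{-n}\log^+|h^n(z)|$ the Green function, $M(h)=\max\{G_h(c): c\in\mathbb C,\ h'(c)=0\}$, and let $\phi_h:\{G_h>M(h)\}\to\{|w|>e^{M(h)}\}$ be the Böttcher map, i.e. the conformal isomorphism with $\phi_h(h(z))=\phi_h(z)^d$ and $\phi_h(z)/z\to1$ as $z\to\infty$. Assume that some critical point of $f$ lies in $X(f)$. Let $\phi:X(f)\to X(g)$ be a quasiconformal conjugacy: a homeomorphism with $\phi\circ f=g\circ\phi$ on $X(f)$ that is absolutely continuous on lines and satisfies $|\bar\partial\phi|\le k|\partial\phi|$ almost everywhere for some constant $k<1$. Here $\partial=\frac12(\partial_x-i\partial_y)$ and $\bar\partial=\frac12(\partial_x+i\partial_y)$. Its stretching part is the function $S_\phi:(0,\infty)\to(0,\infty)$ with $S_\phi\circ G_f=G_g\circ\phi$ on $X(f)$. A turning part of $\phi$ is a continuous function $T_\phi:(0,\infty)\to\mathbb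 R$ such that $T_\phi(G_f(z))\equiv\arg\phi_g(\phi(z))-\arg\phi_f(z)\pmod{2\pi}$ whenever $G_f(z)>M(f)$, and such that, for some $m\in\mathbb Z$, $T_\phi(dt)=d\,T_\phi(t)+2\pi m$ for all $t>0$. Then the stretching part $S_\phi$ and a turning part exist. For every turning part $T_\phi$ and almost every $z\in X(f)$, the maps $\phi$ and $G_f$ are (real) differentiable at $z$, the functions $S_\phi$ and $T_\phi$ are differentiable at $G_f(z)$, the numbers $\partial\phi(z)$, $\partial G_f(z)$ and $S_\phi'(G_f(z))+iT_\phi'(G_f(z))+1$ are nonzero, and $$\frac{\bar\partial\phi(z)}{\partial\phi(z)}=\frac{S_\phi'(G_f(z))+iT_\phi'(G_f(z))-1}{S_\phi'(G_f(z))+iT_\phi'(G_f(z))+1}\cdot\frac{\bar\partial G_f(z)}{\partial G_f(z)}.$$ -/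

import Mathlib

open Set Filter Topology MeasureTheory Polynomial
open scoped ComplexConjugate

namespace PolyBasin

/-! ### Dynamics of a complex polynomial -/

/-- The basin of infinity `X(f)`: the points whose forward orbit tends to infinity. -/
def basin (f : ℂ[X]) : Set ℂ :=
  {z | Tendsto (fun n : ℕ => (fun w : ℂ => f.eval w)^[n] z) atTop (Bornology.cobounded ℂ)}

/-- The Green function `G_f(z) = lim d⁻ⁿ log⁺ |fⁿ(z)|`, where `d = deg f`. -/
noncomputable def green (f : ℂ[X]) (z : ℂ) : ℝ :=
  limUnder atTop (fun n : ℕ =>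
    ((f.natDegree : ℝ) ^ n)⁻¹ * Real.posLog ‖(fun w : ℂ => f.eval w)^[n] z‖)

/-- The critical set `C(f)` of `f` in `ℂ`. -/
def critSet (f : ℂ[X]) : Set ℂ := {c | f.derivative.eval c = 0}

/-- `M(f)`, the maximum of `G_f` on the (finite, nonempty if `deg f ≥ 2`) critical set. -/
noncomputable def maxCrit (f : ℂ[X]) : ℝ := sSup (green f '' critSet f)

/-- The neighbourhood `{G_f > M(f)}` of infinity. -/
def outer (f : ℂ[X]) : Set ℂ := {z | maxCrit f < green f z}

/-- `b` is a Böttcher map of the monic polynomial `f`: a conformal isomorphism from `{G_f > M(f)}`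
onto `{|w| > exp M(f)}`, tangent to the identity at infinity, that conjugates `f` to `w ↦ w ^ d`.
These properties determine `b` on `{G_f > M(f)}`. -/
structure IsBottcher (f : ℂ[X]) (b : ℂ → ℂ) : Prop where
  differentiableOn : DifferentiableOn ℂ b (outer f)
  bijOn : BijOn b (outer f) {w : ℂ | Real.exp (maxCrit f) < ‖w‖}
  semiconj : ∀ z ∈ outer f, b (f.eval z) = b z ^ f.natDegree
  tangent : Tendsto (fun z => b z / z) (Bornology.cobounded ℂ) (𝓝 1)

/-- The Böttcher map `φ_f` of a monic polynomial (only its values on `{G_f > M(f)}` matter). -/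
noncomputable def bottcher (f : ℂ[X]) : ℂ → ℂ := Classical.epsilon (IsBottcher f)

/-! ### Quasiconformal maps -/

/-- The Wirtinger derivative `∂φ = (φ_x - i φ_y) / 2`. -/
noncomputable def dz (φ : ℂ → ℂ) (z : ℂ) : ℂ :=
  (lineDeriv ℝ φ z 1 - Complex.I * lineDeriv ℝ φ z Complex.I) / 2

/-- The Wirtinger derivative `∂̄φ = (φ_x + i φ_y) / 2`. -/
noncomputable def dzbar (φ : ℂ → ℂ) (z : ℂ) : ℂ :=
  (lineDeriv ℝ φ z 1 + Complex.I * lineDeriv ℝ φ z Complex.I) / 2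

/-- `φ` is absolutely continuous on lines in `Ω`: on every closed rectangle contained in `Ω` it is
absolutely continuous on almost every horizontal and almost every vertical segment. -/
def IsACLOn (φ : ℂ → ℂ) (Ω : Set ℂ) : Prop :=
  ∀ x₀ x₁ y₀ y₁ : ℝ, x₀ ≤ x₁ → y₀ ≤ y₁ → Icc x₀ x₁ ×ℂ Icc y₀ y₁ ⊆ Ω →
    (∀ᵐ y : ℝ, y ∈ Icc y₀ y₁ →
      AbsolutelyContinuousOnInterval (fun x : ℝ => φ (x + y * Complex.I)) x₀ x₁) ∧
    (∀ᵐ x : ℝ, x ∈ Icc x₀ x₁ →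
      AbsolutelyContinuousOnInterval (fun y : ℝ => φ (x + y * Complex.I)) y₀ y₁)

/-- The (analytic) definition of quasiconformality for a homeomorphism `φ` between open subsets of
the plane: `φ` is absolutely continuous on lines, and `|∂̄φ| ≤ k |∂φ|` almost everywhere
for some constant `k < 1`. -/
def IsQuasiconformal (φ : OpenPartialHomeomorph ℂ ℂ) : Prop :=
  IsACLOn φ φ.source ∧
    ∃ k : ℝ, 0 ≤ k ∧ k < 1 ∧ ∀ᵐ z : ℂ, z ∈ φ.source → ‖dzbar φ z‖ ≤ k * ‖dz φ z‖

/-! ### Conjugacies between basins, stretching and turning -/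

/-- `φ` is a conjugacy between `(f, X(f))` and `(g, X(g))`. -/
structure IsConjugacy (f g : ℂ[X]) (φ : OpenPartialHomeomorph ℂ ℂ) : Prop where
  source_eq : φ.source = basin f
  target_eq : φ.target = basin g
  comm : ∀ z ∈ basin f, φ (f.eval z) = g.eval (φ z)

/-- `S : (0, ∞) → (0, ∞)` is the stretching part of `φ`: `S ∘ G_f = G_g ∘ φ` on `X(f)`. Only the
values on `(0, ∞)` matter, and they are determined since `G_f` maps `X(f)` onto `(0, ∞)`. -/
def IsStretchingPart (f g : ℂ[X]) (φ : ℂ → ℂ) (S : ℝ → ℝ) : Prop :=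
  MapsTo S (Ioi 0) (Ioi 0) ∧ ∀ z ∈ basin f, S (green f z) = green g (φ z)

/-- `T : (0, ∞) → ℝ` is a turning part of `φ`: a continuous real-valued function such that
`T (G_f z) = arg (φ_g (φ z)) - arg (φ_f z)` modulo `2π` on `{G_f > M(f)}`, extended to `(0, ∞)` by
its functional equation `T (d t) = d T (t)`. The angles being defined modulo `2π`,
a continuous `T` satisfies this equation up to one additive constant in `2πℤ`. -/
structure IsTurningPart (f g : ℂ[X]) (φ : ℂ → ℂ) (T : ℝ → ℝ) : Prop where
  continuousOn : ContinuousOn T (Ioi 0)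
  angle_eq : ∀ z ∈ outer f, (T (green f z) : Real.Angle) =
    (Complex.arg (bottcher g (φ z)) : Real.Angle) - (Complex.arg (bottcher f z) : Real.Angle)
  map_mul : ∃ m : ℤ, ∀ t : ℝ, 0 < t →
    T (f.natDegree * t) = f.natDegree * T t + 2 * Real.pi * m

end PolyBasin

open PolyBasin

/-! The Böttcher coordinate turns `f` on `{G_f > M(f)}` into `w ↦ w ^ d`, and the symmetries of that
map force the shape of `φ`. Two points that differ by a rotation of angle `2πj / dⁿ` in this
coordinate have the same image under `fⁿ`, so their images under `φ` have the same image under `gⁿ`.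
Such a rotation therefore leaves `G_g ∘ φ` unchanged and moves the angle of `φ_g ∘ φ` by an element
of `2π d⁻ⁿ ℤ`. These rotations are dense. Hence `G_g ∘ φ` is a function `S` of `G_f`
(`green_map_eq`), and in logarithmic coordinates `φ` reads `ρ + iα ↦ S(ρ) + i(τ(ρ) + sα)`
(`exists_slope`, `exists_angular`). Periodicity makes `s` an integer, and injectivity makes it `±1`.

If `s = 1`, then `φ_g ∘ φ = φ_f · exp(e ∘ G_f)` with `e(t) = S(t) - t + iT(t)`, so the regularity of
`φ` is that of a function of one real variable. Absolute continuity of `φ` on a single segment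
crossing the level curves of `G_f` transversally gives differentiability of `e` at almost every
nearby level (`ae_differentiableAt_twist`). The exceptional levels pull back to a null set of the
basin (`ae_exists_iter`). Elsewhere the chain rule gives `dφ(v) = c(αv + e' Re(αv))`, where `α` is
the logarithmic derivative of `φ_f ∘ fⁿ` (`exists_hasFDerivAt`). Thus `∂̄φ / ∂φ = e' / (e' + 2) · ᾱ
/ α`, with `e' = S' + iT' - 1` and `ᾱ / α = ∂̄G_f / ∂G_f`; monotonicity of `S` gives `S' ≥ 0`, so
`e' + 2 ≠ 0`. For `s = -1` the same computation gives `|∂φ| ≤ |∂̄φ| ≠ 0`, which quasiconformality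
excludes (`not_conj_twist`).

The Böttcher map itself has to be constructed: by a series near infinity
(`exists_bottcher_near_infinity`), then on all of `{G_f > M(f)}` by lifting through the covering
`fⁿ` (`exists_logBottcher`). -/

namespace PolyBasin

/-! ### Iterates -/

/-- The `n`-th iterate of `f`, as a map. -/
def iter (f : ℂ[X]) (n : ℕ) (z : ℂ) : ℂ := (fun w : ℂ => f.eval w)^[n] z

/-- The `n`-th iterate of `f`, as a polynomial. -/
noncomputable def iterPoly (f : ℂ[X]) (n : ℕ) : ℂ[X] := f.comp^[n] X

@[simp] lemma iter_zero (f : ℂ[X]) (z : ℂ) : iter f 0 z = z := rfl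

lemma iter_succ (f : ℂ[X]) (n : ℕ) (z : ℂ) : iter f (n + 1) z = iter f n (f.eval z) := rfl

lemma iter_succ' (f : ℂ[X]) (n : ℕ) (z : ℂ) : iter f (n + 1) z = f.eval (iter f n z) :=
  Function.iterate_succ_apply' _ _ _

@[simp] lemma iter_one (f : ℂ[X]) (z : ℂ) : iter f 1 z = f.eval z := rfl

lemma eval_iterPoly (f : ℂ[X]) (n : ℕ) (z : ℂ) : (iterPoly f n).eval z = iter f n z := by
  simp [iterPoly, iter, Polynomial.iterate_comp_eval]

lemma natDegree_iterPoly (f : ℂ[X]) (n : ℕ) : (iterPoly f n).natDegree = f.natDegree ^ n := by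
  simp [iterPoly, Polynomial.natDegree_iterate_comp]

lemma continuous_iter (f : ℂ[X]) (n : ℕ) : Continuous (iter f n) := by
  have : iter f n = fun z => (iterPoly f n).eval z := by ext; rw [eval_iterPoly]
  rw [this]; fun_prop

lemma differentiable_iter (f : ℂ[X]) (n : ℕ) : Differentiable ℂ (iter f n) := by
  have : iter f n = fun z => (iterPoly f n).eval z := by ext; rw [eval_iterPoly]
  rw [this]; fun_prop

lemma eval_comm_iter (f : ℂ[X]) (n : ℕ) (z : ℂ) : iter f n (f.eval z) = f.eval (iter f n z) := by
  rw [← iter_succ, iter_succ']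

lemma deriv_iter_succ (f : ℂ[X]) (n : ℕ) (z : ℂ) :
    deriv (iter f (n + 1)) z = f.derivative.eval (iter f n z) * deriv (iter f n) z := by
  have h : iter f (n + 1) = (fun w => f.eval w) ∘ iter f n := by ext; simp [iter_succ']
  rw [h, deriv_comp _ (by fun_prop) (differentiable_iter f n z)]
  simp

/-! ### The Green function -/

/-- The quotient is the reversed polynomial evaluated at `z⁻¹`, and its constant coefficient is the
leading coefficient `1`. -/
lemma tendsto_eval_div_pow {f : ℂ[X]} (hf : f.Monic) :
    Tendsto (fun z => f.eval z / z ^ f.natDegree) (Bornology.cobounded ℂ) (𝓝 1) := by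
  have h1 : Tendsto (fun z : ℂ => f.reverse.eval z⁻¹) (Bornology.cobounded ℂ) (𝓝 1) := by
    have : Tendsto (fun z : ℂ => f.reverse.eval z) (𝓝 0) (𝓝 1) := by
      have := f.reverse.continuous.tendsto 0
      simpa [← coeff_zero_eq_eval_zero, hf.leadingCoeff] using this
    exact this.comp tendsto_inv₀_cobounded
  refine h1.congr' ?_
  filter_upwards [Metric.hasBasis_cobounded_compl_closedBall (0 : ℂ) |>.mem_of_mem
    (i := 0) trivial] with z hz
  have hz : z ≠ 0 := by simpa using hz
  let : Invertible z := invertibleOfNonzero hz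
  have h2 := eval₂_reverse_mul_pow (RingHom.id ℂ) z f
  rw [eval₂_id, eval₂_id, invOf_eq_inv] at h2
  rw [eq_div_iff (pow_ne_zero _ hz), h2]

lemma exists_norm_gt {P : ℂ → Prop} (h : ∀ᶠ z in Bornology.cobounded ℂ, P z) :
    ∃ R : ℝ, 0 < R ∧ ∀ z : ℂ, R < ‖z‖ → P z := by
  obtain ⟨r, -, hr⟩ := (Metric.hasBasis_cobounded_compl_closedBall (0 : ℂ)).eventually_iff.1 h
  exact ⟨max r 1, by positivity, fun z hz => hr (by simpa using (le_max_left r 1).trans_lt hz)⟩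

lemma continuous_posLog_norm : Continuous fun z : ℂ => Real.posLog ‖z‖ :=
  Real.continuous_posLog.comp continuous_norm

/-- Far out the quotient `f(z) / z ^ d` has modulus between `1/2` and `2`, which bounds the
difference by `log 2`; the remaining disc is compact. -/
lemma exists_posLog_bound {f : ℂ[X]} (hf : f.Monic) (hd : 2 ≤ f.natDegree) :
    ∃ C, ∀ z : ℂ, |Real.posLog ‖f.eval z‖ - f.natDegree * Real.posLog ‖z‖| ≤ C := by
  have h := (tendsto_eval_div_pow hf).norm
  rw [norm_one] at h
  have h1 := h.eventually (Ioo_mem_nhds (show (1 / 2 : ℝ) < 1 by norm_num) one_lt_two)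
  obtain ⟨R, hR, hR'⟩ := exists_norm_gt h1
  have hcont : Continuous fun z : ℂ =>
      |Real.posLog ‖f.eval z‖ - f.natDegree * Real.posLog ‖z‖| := by
    have := continuous_posLog_norm.comp f.continuous
    have h2 := continuous_posLog_norm
    exact (this.sub (continuous_const.mul h2)).abs
  obtain ⟨C, hC⟩ := (isCompact_closedBall (0 : ℂ) (max R 2)).bddAbove_image hcont.continuousOn
  refine ⟨max C (Real.log 2), fun z => ?_⟩
  by_cases hz : ‖z‖ ≤ max R 2
  · exact le_max_of_le_left (hC ⟨z, by simpa using hz, rfl⟩)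
  push Not at hz
  have hzR := (le_max_left _ _).trans_lt hz
  have hz2 := (le_max_right _ _).trans_lt hz
  obtain ⟨ha, hb⟩ := hR' z hzR
  have hz0 : 0 < ‖z‖ := by linarith
  have hpow : 2 * ‖z‖ ≤ ‖z‖ ^ f.natDegree := by
    calc 2 * ‖z‖ ≤ ‖z‖ ^ 2 := by nlinarith
      _ ≤ _ := pow_le_pow_right₀ (by linarith) hd
  rw [norm_div, norm_pow] at ha hb
  rw [lt_div_iff₀ (by positivity)] at ha
  rw [div_lt_iff₀ (by positivity)] at hb
  have hfz : 1 ≤ ‖f.eval z‖ := by linarith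
  refine le_max_of_le_right ?_
  rw [Real.posLog_eq_log (by rwa [abs_norm]), Real.posLog_eq_log (by rw [abs_norm]; linarith),
    ← Real.log_pow, ← Real.log_div (by positivity) (by positivity), abs_le]
  constructor
  · rw [← Real.log_inv]
    refine Real.log_le_log (by positivity) ?_
    rw [le_div_iff₀ (by positivity)]; linarith
  · refine Real.log_le_log (by positivity) ?_
    rw [div_le_iff₀ (by positivity)]; linarith

variable {f : ℂ[X]}

/-- By `exists_posLog_bound` consecutive terms differ by at most `C / 2 ^ n`, so the sequence is
Cauchy. The bound does not depend on `z`, which is what continuity and the description of the basin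
need. -/
lemma exists_green_bound (hf : f.Monic) (hd : 2 ≤ f.natDegree) :
    ∃ C, ∀ z, Tendsto (fun n : ℕ => ((f.natDegree : ℝ) ^ n)⁻¹ * Real.posLog ‖iter f n z‖) atTop
      (𝓝 (green f z)) ∧ |green f z - Real.posLog ‖z‖| ≤ C := by
  obtain ⟨C, hC⟩ := exists_posLog_bound hf hd
  have hd' : (2 : ℝ) ≤ f.natDegree := by exact_mod_cast hd
  have hC0 : 0 ≤ C := (abs_nonneg _).trans (hC 0)
  refine ⟨C / (1 - 1 / 2), fun z => ?_⟩
  have hdist : ∀ n : ℕ, dist (((f.natDegree : ℝ) ^ n)⁻¹ * Real.posLog ‖iter f n z‖)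
      (((f.natDegree : ℝ) ^ (n + 1))⁻¹ * Real.posLog ‖iter f (n + 1) z‖) ≤ C * (1 / 2) ^ n := by
    intro n
    have h1 : ((f.natDegree : ℝ) ^ n)⁻¹ * Real.posLog ‖iter f n z‖ -
        ((f.natDegree : ℝ) ^ (n + 1))⁻¹ * Real.posLog ‖iter f (n + 1) z‖ =
        - (((f.natDegree : ℝ) ^ (n + 1))⁻¹ * (Real.posLog ‖f.eval (iter f n z)‖ -
          f.natDegree * Real.posLog ‖iter f n z‖)) := by
      rw [iter_succ', pow_succ]; field_simp; ring
    rw [Real.dist_eq, h1, abs_neg, abs_mul, abs_of_pos (by positivity), mul_comm C]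
    refine mul_le_mul ?_ (hC _) (abs_nonneg _) (by positivity)
    rw [one_div, inv_pow]
    refine inv_anti₀ (by positivity) ?_
    calc (2 : ℝ) ^ n ≤ 2 ^ (n + 1) := pow_le_pow_right₀ (by norm_num) (by omega)
      _ ≤ _ := pow_le_pow_left₀ (by norm_num) hd' _
  have hlim : Tendsto (fun n : ℕ => ((f.natDegree : ℝ) ^ n)⁻¹ * Real.posLog ‖iter f n z‖) atTop
      (𝓝 (green f z)) :=
    tendsto_nhds_limUnder
      (cauchySeq_tendsto_of_complete (cauchySeq_of_le_geometric (1 / 2) C (by norm_num) hdist))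
  refine ⟨hlim, ?_⟩
  have := dist_le_of_le_geometric_of_tendsto₀ (1 / 2) C (by norm_num) hdist hlim
  rw [dist_comm, Real.dist_eq] at this
  simpa using this

lemma tendsto_green (hf : f.Monic) (hd : 2 ≤ f.natDegree) (z : ℂ) :
    Tendsto (fun n : ℕ => ((f.natDegree : ℝ) ^ n)⁻¹ * Real.posLog ‖iter f n z‖) atTop
      (𝓝 (green f z)) := by
  obtain ⟨C, hC⟩ := exists_green_bound hf hd
  exact (hC z).1

lemma green_nonneg (hf : f.Monic) (hd : 2 ≤ f.natDegree) (z : ℂ) : 0 ≤ green f z :=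
  ge_of_tendsto' (tendsto_green hf hd z) fun n => mul_nonneg (by positivity) Real.posLog_nonneg

lemma green_eval (hf : f.Monic) (hd : 2 ≤ f.natDegree) (z : ℂ) :
    green f (f.eval z) = f.natDegree * green f z := by
  refine tendsto_nhds_unique (tendsto_green hf hd (f.eval z)) ?_
  have h := ((tendsto_green hf hd z).comp (tendsto_add_atTop_nat 1)).const_mul (f.natDegree : ℝ)
  refine h.congr fun n => ?_
  have : (f.natDegree : ℝ) ≠ 0 := by positivity
  simp only [Function.comp, iter_succ, pow_succ]
  field_simp

lemma green_iter (hf : f.Monic) (hd : 2 ≤ f.natDegree) (n : ℕ) (z : ℂ) :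
    green f (iter f n z) = f.natDegree ^ n * green f z := by
  induction n with
  | zero => simp
  | succ n ih => rw [iter_succ', green_eval hf hd, ih]; ring

lemma tendsto_natDegree_pow (hd : 2 ≤ f.natDegree) :
    Tendsto (fun n : ℕ => (f.natDegree : ℝ) ^ n) atTop atTop :=
  tendsto_pow_atTop_atTop_of_one_lt (by exact_mod_cast (by omega : 1 < f.natDegree))

lemma exists_lt_pow_mul (hd : 2 ≤ f.natDegree) {t : ℝ} (ht : 0 < t) (M : ℝ) :
    ∃ n : ℕ, M < (f.natDegree : ℝ) ^ n * t :=
  (((tendsto_natDegree_pow hd).atTop_mul_const ht).eventually_gt_atTop M).exists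

/-- Applying the uniform bound at `fⁿ(z)` and dividing by `dⁿ` makes the convergence uniform on the
whole plane. -/
lemma continuous_green (hf : f.Monic) (hd : 2 ≤ f.natDegree) : Continuous (green f) := by
  obtain ⟨C, hC⟩ := exists_green_bound hf hd
  have hu : TendstoUniformly
      (fun (n : ℕ) z => ((f.natDegree : ℝ) ^ n)⁻¹ * Real.posLog ‖iter f n z‖) (green f) atTop := by
    rw [Metric.tendstoUniformly_iff]
    intro ε hε
    obtain ⟨n, hn⟩ := ((tendsto_natDegree_pow hd).eventually_gt_atTop (C / ε)).exists_forall_of_atTop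
    filter_upwards [eventually_ge_atTop n] with m hm z
    have hp : 0 < (f.natDegree : ℝ) ^ m := by positivity
    have h2 := (hC (iter f m z)).2
    rw [green_iter hf hd] at h2
    have h3 := hn m hm
    rw [div_lt_iff₀ hε] at h3
    have h4 : green f z - ((f.natDegree : ℝ) ^ m)⁻¹ * Real.posLog ‖iter f m z‖ =
      ((f.natDegree : ℝ) ^ m)⁻¹ * (f.natDegree ^ m * green f z - Real.posLog ‖iter f m z‖) := by
      field_simp
    rw [Real.dist_eq, h4, abs_mul, abs_of_pos (by positivity), inv_mul_lt_iff₀ hp]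
    linarith
  refine hu.continuous (Frequently.of_forall fun n => ?_)
  exact continuous_const.mul (continuous_posLog_norm.comp (continuous_iter f n))

lemma tendsto_posLog_norm :
    Tendsto (fun z : ℂ => Real.posLog ‖z‖) (Bornology.cobounded ℂ) atTop := by
  refine tendsto_atTop_mono (fun z => ?_) (Real.tendsto_log_atTop.comp tendsto_norm_cobounded_atTop)
  exact le_max_right _ _

lemma tendsto_green_cobounded (hf : f.Monic) (hd : 2 ≤ f.natDegree) :
    Tendsto (green f) (Bornology.cobounded ℂ) atTop := by
  obtain ⟨C, hC⟩ := exists_green_bound hf hd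
  refine tendsto_atTop_mono (fun z => ?_) (tendsto_atTop_add_const_right _ (-C) tendsto_posLog_norm)
  have := abs_le.1 (hC z).2
  linarith

/-- Along an orbit `G_f` is multiplied by `d` at each step and stays within a bounded distance of
`log⁺ |z|`, so one escapes exactly when the other does. -/
lemma mem_basin_iff (hf : f.Monic) (hd : 2 ≤ f.natDegree) {z : ℂ} :
    z ∈ basin f ↔ 0 < green f z := by
  constructor
  · intro h
    have h1 : Tendsto (fun n => green f (iter f n z)) atTop atTop :=
      (tendsto_green_cobounded hf hd).comp h
    obtain ⟨n, hn⟩ := (h1.eventually_gt_atTop 0).exists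
    rw [green_iter hf hd] at hn
    exact pos_of_mul_pos_right hn (by positivity)
  · intro h
    obtain ⟨C, hC⟩ := exists_green_bound hf hd
    have h1 : Tendsto (fun n => (f.natDegree : ℝ) ^ n * green f z) atTop atTop :=
      (tendsto_natDegree_pow hd).atTop_mul_const h
    have h2 : Tendsto (fun n => Real.posLog ‖iter f n z‖) atTop atTop := by
      refine tendsto_atTop_mono (fun n => ?_) (tendsto_atTop_add_const_right _ (-C) h1)
      have := abs_le.1 (hC (iter f n z)).2
      rw [green_iter hf hd] at this
      linarith
    change Tendsto (fun n => iter f n z) atTop _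
    rw [← tendsto_norm_atTop_iff_cobounded]
    refine tendsto_atTop_mono' _ ?_ h2
    filter_upwards [h2.eventually_gt_atTop 0] with n hn
    rcases eq_or_ne ‖iter f n z‖ 0 with h0 | h0
    · simp [h0] at hn
    · have := Real.add_one_le_exp (Real.posLog ‖iter f n z‖)
      have h5 : Real.posLog ‖iter f n z‖ = Real.log ‖iter f n z‖ := by
        rw [Real.posLog] at hn ⊢
        rcases max_cases (0 : ℝ) (Real.log ‖iter f n z‖) with h | h
        · exact absurd hn (by rw [h.1]; exact lt_irrefl _)
        · exact h.1
      rw [h5] at this ⊢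
      rw [Real.exp_log (by positivity)] at this
      linarith

/-! ### Critical points and the level `maxCrit f`. -/

lemma derivative_ne_zero (hd : 2 ≤ f.natDegree) : f.derivative ≠ 0 := by
  intro h
  have := derivative_eq_zero.1 h
  omega

lemma finite_critSet (hd : 2 ≤ f.natDegree) : (critSet f).Finite := by
  refine (f.derivative.roots.toFinset.finite_toSet).subset fun c hc => ?_
  simp only [Finset.mem_coe, Multiset.mem_toFinset, mem_roots (derivative_ne_zero hd)]
  exact hc

lemma green_le_maxCrit (hd : 2 ≤ f.natDegree) {c : ℂ} (hc : c ∈ critSet f) :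
    green f c ≤ maxCrit f :=
  le_csSup ((finite_critSet hd).image _).bddAbove ⟨c, hc, rfl⟩

lemma exists_green_eq_maxCrit (hd : 2 ≤ f.natDegree) (h : (critSet f).Nonempty) :
    ∃ c ∈ critSet f, green f c = maxCrit f :=
  (h.image _).csSup_mem ((finite_critSet hd).image _)

lemma deriv_iter_eq_zero {n : ℕ} {z : ℂ} (h : deriv (iter f n) z = 0) :
    ∃ k < n, iter f k z ∈ critSet f := by
  induction n with
  | zero =>
    have : iter f 0 = id := rfl
    simp [this] at h
  | succ n ih =>
    rw [deriv_iter_succ] at h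
    rcases mul_eq_zero.1 h with h | h
    · exact ⟨n, by omega, h⟩
    · obtain ⟨k, hk, h⟩ := ih h
      exact ⟨k, by omega, h⟩

lemma green_le_green_iter (hf : f.Monic) (hd : 2 ≤ f.natDegree) (n : ℕ) (z : ℂ) :
    green f z ≤ green f (iter f n z) := by
  rw [green_iter hf hd]
  have h1 : (1 : ℝ) ≤ (f.natDegree : ℝ) ^ n :=
    one_le_pow₀ (by exact_mod_cast (by omega : 1 ≤ f.natDegree))
  nlinarith [green_nonneg hf hd z]

/-- Iteration does not decrease `G_f`, so an orbit starting above every critical level never meets a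
critical point. -/
lemma deriv_iter_ne_zero (hf : f.Monic) (hd : 2 ≤ f.natDegree) {z : ℂ} (hz : z ∈ outer f) (n : ℕ) :
    deriv (iter f n) z ≠ 0 := by
  intro h
  obtain ⟨k, -, hk⟩ := deriv_iter_eq_zero h
  have := green_le_maxCrit hd hk
  have h2 := green_le_green_iter hf hd k z
  exact absurd hz (not_lt.2 (h2.trans this))

lemma isOpen_outer (hf : f.Monic) (hd : 2 ≤ f.natDegree) : IsOpen (outer f) :=
  isOpen_lt continuous_const (continuous_green hf hd)

lemma maxCrit_nonneg (hf : f.Monic) (hd : 2 ≤ f.natDegree) : 0 ≤ maxCrit f :=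
  Real.sSup_nonneg (by rintro _ ⟨c, -, rfl⟩; exact green_nonneg hf hd c)

lemma outer_subset_basin (hf : f.Monic) (hd : 2 ≤ f.natDegree) : outer f ⊆ basin f := fun _ hz =>
  (mem_basin_iff hf hd).2 ((maxCrit_nonneg hf hd).trans_lt hz)

lemma iter_mem_outer (hf : f.Monic) (hd : 2 ≤ f.natDegree) {z : ℂ} (hz : z ∈ outer f) (n : ℕ) :
    iter f n z ∈ outer f :=
  lt_of_lt_of_le hz (green_le_green_iter hf hd n z)

lemma iter_mem_basin (hf : f.Monic) (hd : 2 ≤ f.natDegree) {z : ℂ} (n : ℕ) :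
    iter f n z ∈ basin f ↔ z ∈ basin f := by
  rw [mem_basin_iff hf hd, mem_basin_iff hf hd, green_iter hf hd]
  exact mul_pos_iff_of_pos_left (by positivity)

lemma exists_iter_mem_outer (hf : f.Monic) (hd : 2 ≤ f.natDegree) {z : ℂ} (hz : z ∈ basin f) :
    ∃ n, iter f n z ∈ outer f := by
  obtain ⟨n, hn⟩ := exists_lt_pow_mul hd ((mem_basin_iff hf hd).1 hz) (maxCrit f)
  exact ⟨n, by rw [outer, mem_ofPred_eq, green_iter hf hd]; exact hn⟩

lemma maxCrit_pos (hf : f.Monic) (hd : 2 ≤ f.natDegree) (h : (critSet f ∩ basin f).Nonempty) :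
    0 < maxCrit f := by
  obtain ⟨c, hc, hb⟩ := h
  exact ((mem_basin_iff hf hd).1 hb).trans_le (green_le_maxCrit hd hc)

end PolyBasin

namespace PolyBasin

/-! ### Local inverses -/

lemma exists_local_inverse {𝕜 : Type*} [NontriviallyNormedField 𝕜] [CompleteSpace 𝕜] {p : 𝕜 → 𝕜}
    {p' a : 𝕜} (h : HasStrictDerivAt p p' a) (h0 : p' ≠ 0) :
    ∃ l : 𝕜 → 𝕜, l (p a) = a ∧ HasStrictDerivAt l p'⁻¹ (p a) ∧ (∀ᶠ x in 𝓝 a, l (p x) = x) ∧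
      ∀ᶠ y in 𝓝 (p a), p (l y) = y := by
  have e := h.hasStrictFDerivAt_equiv h0
  have h1 := e.eventually_left_inverse
  exact ⟨h.localInverse p p' a h0, h1.self_of_nhds, h.to_localInverse h0, h1,
    e.eventually_right_inverse⟩

/-- A continuous lift through a local biholomorphism is holomorphic: near `x`, it is `k` followed by
the local inverse. -/
lemma differentiableAt_of_comp_eq {p F k : ℂ → ℂ} {p' x : ℂ} (hp : HasStrictDerivAt p p' (F x))
    (h0 : p' ≠ 0) (hF : ContinuousAt F x) (hk : DifferentiableAt ℂ k x)
    (h : ∀ᶠ y in 𝓝 x, p (F y) = k y) : DifferentiableAt ℂ F x := by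
  obtain ⟨l, -, hl, hl1, -⟩ := exists_local_inverse hp h0
  rw [h.self_of_nhds] at hl
  refine (hl.hasDerivAt.differentiableAt.comp x hk).congr_of_eventuallyEq ?_
  filter_upwards [h, hF.eventually hl1] with y h1 h2
  simp [← h1, h2]

lemma eventually_injOn {p : ℂ → ℂ} {p' a : ℂ} (h : HasStrictDerivAt p p' a) (h0 : p' ≠ 0) :
    ∃ U ∈ 𝓝 a, InjOn p U := by
  obtain ⟨l, -, -, hl, -⟩ := exists_local_inverse h h0
  exact ⟨_, hl, fun x hx y hy hxy => by
    rw [← show l (p x) = x from hx, ← show l (p y) = y from hy, hxy]⟩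

/-- An injective holomorphic function has non-vanishing derivative. -/
lemma deriv_ne_zero_of_injOn {F : ℂ → ℂ} {U : Set ℂ} {c : ℂ} (hU : U ∈ 𝓝 c)
    (hF : AnalyticAt ℂ F c) (hinj : InjOn F U) : deriv F c ≠ 0 := by
  intro h0
  obtain ⟨r, hr, hrU⟩ := Metric.mem_nhds_iff.1 (inter_mem hU hF.eventually_analyticAt)
  set B := Metric.ball c r with hB
  have hBo : IsOpen B := Metric.isOpen_ball
  have hcB : c ∈ B := Metric.mem_ball_self hr
  have hinjB : InjOn F B := hinj.mono fun x hx => (hrU hx).1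
  have han : AnalyticOnNhd ℂ F B := fun x hx => (hrU hx).2
  have hopen : ∀ s ⊆ B, IsOpen s → IsOpen (F '' s) := by
    refine (han.is_constant_or_isOpen (convex_ball c r).isPreconnected).resolve_left ?_
    rintro ⟨w, hw⟩
    have h1 : c + (r / 2 : ℝ) ∈ B := by
      simp [hB, abs_of_pos hr]; linarith
    have := hinjB hcB h1 ((hw c hcB).trans (hw _ h1).symm)
    have : (r / 2 : ℝ) = (0 : ℂ) := by simpa using this
    have : r / 2 = 0 := by exact_mod_cast this
    linarith
  have hG : ∀ x ∈ B, Function.invFunOn F B (F x) = x := fun x hx => hinjB.leftInvOn_invFunOn hx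
  set G := Function.invFunOn F B
  have hGc : ∀ x ∈ B, ContinuousAt G (F x) := by
    intro x hx
    rw [ContinuousAt, hG x hx]
    intro V hV
    obtain ⟨W, hWV, hWo, hxW⟩ := mem_nhds_iff.1 (inter_mem hV (hBo.mem_nhds hx))
    rw [Filter.mem_map]
    refine mem_of_superset ((hopen W (fun y hy => (hWV hy).2) hWo).mem_nhds ⟨x, hxW, rfl⟩) ?_
    rintro _ ⟨y, hy, rfl⟩
    rw [mem_preimage, hG y (hWV hy).2]
    exact (hWV hy).1
  -- Zeros of the derivative are isolated, since otherwise `F` would be constant near `c`.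
  have hne : ∀ᶠ z in 𝓝[≠] c, deriv F z ≠ 0 := by
    refine (hF.deriv.eventually_eq_zero_or_eventually_ne_zero).resolve_left fun h => ?_
    obtain ⟨s, hs, hsB⟩ := Metric.mem_nhds_iff.1 (inter_mem h (hBo.mem_nhds hcB))
    have hconst : F (c + (s / 2 : ℝ)) = F c := by
      have h1 : c + (s / 2 : ℝ) ∈ Metric.ball c s := by simp [abs_of_pos hs]; linarith
      have := Convex.norm_image_sub_le_of_norm_deriv_le (C := 0)
        (fun x hx => (han x (hsB hx).2).differentiableAt) (fun x hx => by
          rw [show deriv F x = 0 from (hsB hx).1, norm_zero]) (convex_ball c s)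
        (Metric.mem_ball_self hs) h1
      simpa [sub_eq_zero] using this
    have h1 : c + (s / 2 : ℝ) ∈ Metric.ball c s := by simp [abs_of_pos hs]; linarith
    have h2 := hinjB (hsB h1).2 hcB hconst
    have : (s / 2 : ℝ) = (0 : ℂ) := by simpa using h2
    have : s / 2 = 0 := by exact_mod_cast this
    linarith
  -- The inverse is holomorphic off `F c` and continuous there, so the singularity is removable.
  -- Differentiating `G ∘ F = id` at `c` then gives `0 = 1`.
  have hGan : AnalyticAt ℂ G (F c) := by
    refine Complex.analyticAt_of_differentiable_on_punctured_nhds_of_continuousAt ?_ (hGc c hcB)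
    rw [eventually_nhdsWithin_iff] at hne ⊢
    obtain ⟨W, hW, hWo, hcW⟩ := mem_nhds_iff.1 (inter_mem hne (hBo.mem_nhds hcB))
    filter_upwards [(hopen W (fun y hy => (hW hy).2) hWo).mem_nhds ⟨c, hcW, rfl⟩]
    rintro _ ⟨y, hy, rfl⟩ hyc
    have hyc' : y ≠ c := fun h => hyc (by rw [h]; rfl)
    have hyB := (hW hy).2
    have hs : HasStrictDerivAt F (deriv F y) (G (F y)) := by
      rw [hG y hyB]; exact (han y hyB).hasStrictDerivAt
    refine differentiableAt_of_comp_eq hs ((hW hy).1 hyc') (hGc y hyB) differentiableAt_id ?_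
    filter_upwards [(hopen B subset_rfl hBo).mem_nhds ⟨y, hyB, rfl⟩]
    rintro _ ⟨x, hx, rfl⟩
    rw [hG x hx]; rfl
  have h1 : HasDerivAt (G ∘ F) (deriv G (F c) * 0) c := by
    rw [← h0]
    exact hGan.differentiableAt.hasDerivAt.comp c hF.differentiableAt.hasDerivAt
  have h2 : HasDerivAt (G ∘ F) 1 c :=
    (hasDerivAt_id c).congr_of_eventuallyEq (by filter_upwards [hBo.mem_nhds hcB] with x hx
                                                exact hG x hx)
  simpa using h1.unique h2

/-- The inverse of an injective holomorphic function is holomorphic. -/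
lemma hasStrictDerivAt_invFunOn {F : ℂ → ℂ} {U : Set ℂ} (hU : IsOpen U)
    (hF : DifferentiableOn ℂ F U) (hinj : InjOn F U) {c : ℂ} (hc : c ∈ U) :
    HasStrictDerivAt (Function.invFunOn F U) (deriv F c)⁻¹ (F c) ∧ F '' U ∈ 𝓝 (F c) := by
  have han := hF.analyticAt (hU.mem_nhds hc)
  have h0 := deriv_ne_zero_of_injOn (hU.mem_nhds hc) han hinj
  obtain ⟨l, hl0, hl, hl1, hl2⟩ := exists_local_inverse han.hasStrictDerivAt h0
  have hlU : ∀ᶠ y in 𝓝 (F c), l y ∈ U := by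
    have : Tendsto l (𝓝 (F c)) (𝓝 c) := by
      have := hl.hasDerivAt.continuousAt; rwa [ContinuousAt, hl0] at this
    exact this.eventually (hU.mem_nhds hc)
  refine ⟨hl.congr_of_eventuallyEq ?_, ?_⟩
  · filter_upwards [hl2, hlU] with y h1 h2
    have := hinj.leftInvOn_invFunOn h2
    rw [h1] at this
    exact this.symm
  · filter_upwards [hl2, hlU] with y h1 h2
    exact ⟨l y, h2, h1⟩

end PolyBasin

namespace PolyBasin

/-! ### The Böttcher map near infinity -/

variable {f : ℂ[X]}

/-- The relation `log |b(fⁿ z)| = dⁿ log |b z|` is exact, so a bounded error between `log |b|` and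
`log |z|` along the orbit disappears after division by `dⁿ`. -/
lemma green_eq_log_norm (hf : f.Monic) (hd : 2 ≤ f.natDegree) {b : ℂ → ℂ} {z : ℂ} {C : ℝ}
    (hsemi : ∀ n, b (iter f n z) = b z ^ f.natDegree ^ n)
    (hbd : ∀ᶠ n in atTop, |Real.log ‖b (iter f n z)‖ - Real.log ‖iter f n z‖| ≤ C)
    (h1 : ∀ᶠ n in atTop, 1 ≤ ‖iter f n z‖) : green f z = Real.log ‖b z‖ := by
  refine tendsto_nhds_unique (tendsto_green hf hd z) ?_
  have h0 : Tendsto (fun n : ℕ => ((f.natDegree : ℝ) ^ n)⁻¹ * C) atTop (𝓝 0) := by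
    simpa using (tendsto_natDegree_pow hd).inv_tendsto_atTop.mul_const C
  rw [tendsto_iff_dist_tendsto_zero]
  refine squeeze_zero' (Eventually.of_forall fun n => dist_nonneg) ?_ h0
  filter_upwards [hbd, h1] with n h2 h3
  rw [hsemi, norm_pow, Real.log_pow, abs_sub_comm] at h2
  have hp : 0 < (f.natDegree : ℝ) ^ n := by positivity
  rw [Real.posLog_eq_log (by rwa [abs_norm]), Real.dist_eq]
  have h4 : ((f.natDegree : ℝ) ^ n)⁻¹ * Real.log ‖iter f n z‖ - Real.log ‖b z‖ =
      ((f.natDegree : ℝ) ^ n)⁻¹ *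
        (Real.log ‖iter f n z‖ - ((f.natDegree ^ n : ℕ) : ℝ) * Real.log ‖b z‖) := by
    push_cast; field_simp
  rw [h4, abs_mul, abs_of_pos (inv_pos.2 hp)]
  exact mul_le_mul_of_nonneg_left h2 (inv_pos.2 hp).le

/-- The `n`-th term in the series for the logarithm of `b z / z`. -/
noncomputable def bottcherTerm (f : ℂ[X]) (n : ℕ) (z : ℂ) : ℂ :=
  ((f.natDegree : ℂ) ^ (n + 1))⁻¹ *
    Complex.log (f.eval (iter f n z) / iter f n z ^ f.natDegree)

/-- The logarithm of `b z / z`, where `b` is the Böttcher map near infinity. -/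
noncomputable def bottcherCorr (f : ℂ[X]) (z : ℂ) : ℂ := ∑' n, bottcherTerm f n z

/-- The bound `1/2` keeps the quotient in the right half-plane, where the principal logarithm is
holomorphic; the last clause keeps orbits outside the disc. -/
lemma exists_escape_radius (hf : f.Monic) (hd : 2 ≤ f.natDegree) :
    ∃ R : ℝ, 2 ≤ R ∧ (∀ z : ℂ, R < ‖z‖ → ‖f.eval z / z ^ f.natDegree - 1‖ < 1 / 2) ∧
      ∀ z : ℂ, R < ‖z‖ → ‖z‖ ≤ ‖f.eval z‖ := by
  have h1 := (tendsto_eval_div_pow hf).eventually (Metric.ball_mem_nhds 1 one_half_pos)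
  obtain ⟨R, hR, hR'⟩ := exists_norm_gt h1
  have key : ∀ z : ℂ, max R 2 < ‖z‖ → ‖f.eval z / z ^ f.natDegree - 1‖ < 1 / 2 := fun z hz => by
    simpa [dist_eq_norm] using hR' z ((le_max_left _ _).trans_lt hz)
  refine ⟨max R 2, le_max_right _ _, key, fun z hz => ?_⟩
  have hz2 := (le_max_right _ _).trans_lt hz
  have h2 : 1 / 2 ≤ ‖f.eval z / z ^ f.natDegree‖ := by
    have := norm_sub_norm_le (1 : ℂ) (1 - f.eval z / z ^ f.natDegree)
    rw [norm_sub_rev 1, sub_sub_cancel, norm_one] at this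
    linarith [key z hz]
  rw [norm_div, norm_pow, le_div_iff₀ (by positivity)] at h2
  have hpow : 2 * ‖z‖ ≤ ‖z‖ ^ f.natDegree := by
    calc 2 * ‖z‖ ≤ ‖z‖ ^ 2 := by nlinarith
      _ ≤ _ := pow_le_pow_right₀ (by linarith) hd
  linarith

lemma norm_le_norm_iter {R : ℝ} (hR : ∀ z : ℂ, R < ‖z‖ → ‖z‖ ≤ ‖f.eval z‖) {z : ℂ} (hz : R < ‖z‖)
    (n : ℕ) : ‖z‖ ≤ ‖iter f n z‖ := by
  induction n with
  | zero => simp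
  | succ n ih => rw [iter_succ']; exact ih.trans (hR _ (hz.trans_le ih))

lemma norm_bottcherTerm_le (hd : 2 ≤ f.natDegree) {η : ℝ} (n : ℕ) {z : ℂ}
    (h : ‖Complex.log (f.eval (iter f n z) / iter f n z ^ f.natDegree)‖ ≤ η) :
    ‖bottcherTerm f n z‖ ≤ η / 2 / 2 ^ n := by
  have hη : 0 ≤ η := (norm_nonneg _).trans h
  rw [bottcherTerm, norm_mul, norm_inv, norm_pow, Complex.norm_natCast, inv_mul_eq_div,
    div_div, mul_comm (2 : ℝ), ← pow_succ]
  gcongr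
  exact_mod_cast hd

lemma exists_bottcherCorr_small (hf : f.Monic) {R₀ : ℝ} (hd : 2 ≤ f.natDegree)
    (hR₀ : ∀ z : ℂ, R₀ < ‖z‖ → ‖z‖ ≤ ‖f.eval z‖) {η : ℝ} (hη : 0 < η) :
    ∃ R : ℝ, R₀ ≤ R ∧ ∀ z : ℂ, R < ‖z‖ → ∀ n, ‖bottcherTerm f n z‖ ≤ η / 2 / 2 ^ n := by
  have h1 : Tendsto (fun z => Complex.log (f.eval z / z ^ f.natDegree)) (Bornology.cobounded ℂ)
      (𝓝 0) := by
    have := (continuousAt_clog (x := 1) (by simp)).tendsto.comp (tendsto_eval_div_pow hf)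
    simpa [Function.comp_def] using this
  obtain ⟨R, -, hR⟩ := exists_norm_gt (h1.norm.eventually (Iic_mem_nhds (by simpa using hη)))
  refine ⟨max R₀ R, le_max_left _ _, fun z hz n => norm_bottcherTerm_le hd n ?_⟩
  have := norm_le_norm_iter hR₀ ((le_max_left _ _).trans_lt hz) n
  exact hR _ (((le_max_right _ _).trans_lt hz).trans_le this)

lemma norm_bottcherCorr_le {η : ℝ} {z : ℂ} (h : ∀ n, ‖bottcherTerm f n z‖ ≤ η / 2 / 2 ^ n) :
    ‖bottcherCorr f z‖ ≤ η :=
  tsum_of_norm_bounded (hasSum_geometric_two' η) h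

lemma isOpen_norm_gt (R : ℝ) : IsOpen {z : ℂ | R < ‖z‖} :=
  isOpen_lt continuous_const continuous_norm

lemma differentiableOn_bottcherCorr {R η : ℝ} (hR2 : 2 ≤ R)
    (hR : ∀ z : ℂ, R < ‖z‖ → ‖f.eval z / z ^ f.natDegree - 1‖ < 1 / 2)
    (hR' : ∀ z : ℂ, R < ‖z‖ → ‖z‖ ≤ ‖f.eval z‖)
    (h : ∀ z : ℂ, R < ‖z‖ → ∀ n, ‖bottcherTerm f n z‖ ≤ η / 2 / 2 ^ n) :
    DifferentiableOn ℂ (bottcherCorr f) {z : ℂ | R < ‖z‖} := by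
  refine Complex.differentiableOn_tsum_of_summable_norm (hasSum_geometric_two' η).summable
    (fun n => ?_) (isOpen_norm_gt R) fun n z hz => h z hz n
  intro z hz
  have h1 : R < ‖iter f n z‖ := lt_of_lt_of_le hz (norm_le_norm_iter hR' hz n)
  have h0 : iter f n z ≠ 0 := by rw [← norm_pos_iff]; linarith
  have hs : f.eval (iter f n z) / iter f n z ^ f.natDegree ∈ Complex.slitPlane := by
    have := hR _ h1
    left
    have h2 := (Complex.abs_re_le_norm _).trans this.le
    rw [Complex.sub_re, Complex.one_re, abs_le] at h2
    linarith
  have hi := differentiable_iter f n z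
  have h2 : DifferentiableAt ℂ (fun z => f.eval (iter f n z) / iter f n z ^ f.natDegree) z :=
    ((f.differentiable _).comp z hi).div (hi.pow _) (pow_ne_zero _ h0)
  exact ((h2.clog hs).const_mul (((f.natDegree : ℂ) ^ (n + 1))⁻¹)).differentiableWithinAt

/-- Shifting the series by one index gives `d · u(z) = log(f(z) / z ^ d) + u(f(z))` for `u =
bottcherCorr f`; this is the exponential of that relation. -/
lemma exp_bottcherCorr_eval {η : ℝ} {z : ℂ} (hd : 2 ≤ f.natDegree)
    (h : ∀ n, ‖bottcherTerm f n z‖ ≤ η / 2 / 2 ^ n) (h0 : z ≠ 0) (h1 : f.eval z ≠ 0) :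
    f.eval z * Complex.exp (bottcherCorr f (f.eval z)) =
      (z * Complex.exp (bottcherCorr f z)) ^ f.natDegree := by
  have hs : Summable fun n => bottcherTerm f n z :=
    Summable.of_norm_bounded (hasSum_geometric_two' η).summable h
  have hd0 : (f.natDegree : ℂ) ≠ 0 := by exact_mod_cast (by omega : f.natDegree ≠ 0)
  have h2 : (f.natDegree : ℂ) * bottcherCorr f z =
      Complex.log (f.eval z / z ^ f.natDegree) + bottcherCorr f (f.eval z) := by
    rw [bottcherCorr, hs.tsum_eq_zero_add, mul_add, ← tsum_mul_left]
    congr 1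
    · simp [bottcherTerm, hd0]
    · refine tsum_congr fun n => ?_
      simp only [bottcherTerm, iter_succ, pow_succ]
      field_simp
  rw [mul_pow, ← Complex.exp_nat_mul, h2, Complex.exp_add, Complex.exp_log (by positivity)]
  field_simp

/-- In the coordinate `z = exp ζ` the map `b` becomes `ζ ↦ ζ + E ζ`, where `E` is small and has
Lipschitz constant `1/4`. Such a perturbation of the identity is injective, and a contraction
argument makes it surjective near infinity. -/
lemma exists_bottcher_near_infinity (hf : f.Monic) (hd : 2 ≤ f.natDegree) :
    ∃ (b : ℂ → ℂ) (R R' : ℝ), 2 ≤ R ∧ DifferentiableOn ℂ b {z | R < ‖z‖} ∧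
      (∀ z : ℂ, R < ‖z‖ → ‖z‖ ≤ ‖f.eval z‖) ∧
      (∀ z : ℂ, R < ‖z‖ → b (f.eval z) = b z ^ f.natDegree) ∧
      (∀ z : ℂ, R < ‖z‖ → |Real.log ‖b z‖ - Real.log ‖z‖| ≤ 1) ∧
      InjOn b {z | R < ‖z‖} ∧ (∀ w : ℂ, R' < ‖w‖ → ∃ z, R < ‖z‖ ∧ b z = w) ∧
      (∀ z : ℂ, R < ‖z‖ → b z ≠ 0) ∧
      Tendsto (fun z => b z / z) (Bornology.cobounded ℂ) (𝓝 1) := by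
  obtain ⟨R₀, hR2, hR, hR'⟩ := exists_escape_radius hf hd
  obtain ⟨R₁, hR₁, hT⟩ := exists_bottcherCorr_small hf hd hR' (show (0 : ℝ) < 1 / 8 by norm_num)
  have hsm : ∀ z : ℂ, R₁ < ‖z‖ → ‖bottcherCorr f z‖ ≤ 1 / 8 := fun z hz =>
    norm_bottcherCorr_le (hT z hz)
  have hdiff := differentiableOn_bottcherCorr (hR2.trans hR₁)
    (fun z hz => hR z (hR₁.trans_lt hz)) (fun z hz => hR' z (hR₁.trans_lt hz)) hT
  set E : ℂ → ℂ := fun ζ => bottcherCorr f (Complex.exp ζ) with hE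
  -- Twice `R₁`, so that the disc of radius `|z| / 2` around a point with `|z| > r` stays where
  -- `bottcherCorr f` is at most `1/8`; Cauchy's estimate on it yields the constant `1/4`.
  set r : ℝ := 2 * R₁ with hr
  have hr4 : 4 ≤ r := by linarith
  have hmem : ∀ ζ : ℂ, Real.log r < ζ.re → r < ‖Complex.exp ζ‖ := fun ζ h => by
    rw [Complex.norm_exp]; exact (Real.log_lt_iff_lt_exp (by linarith)).1 h
  have hEd : ∀ ζ : ℂ, Real.log r < ζ.re →
      HasDerivAt E (deriv (bottcherCorr f) (Complex.exp ζ) * Complex.exp ζ) ζ := fun ζ h => by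
    have h1 : R₁ < ‖Complex.exp ζ‖ := by linarith [hmem ζ h]
    have := (hdiff.differentiableAt ((isOpen_norm_gt R₁).mem_nhds h1)).hasDerivAt
    exact this.comp ζ (Complex.hasDerivAt_exp ζ)
  have hEd' : ∀ ζ : ℂ, Real.log r < ζ.re → ‖deriv E ζ‖ ≤ 1 / 4 := fun ζ h => by
    have h1 := hmem ζ h
    have hpos : 0 < ‖Complex.exp ζ‖ := by linarith
    rw [(hEd ζ h).deriv, norm_mul]
    have hsub' : Metric.closedBall (Complex.exp ζ) (‖Complex.exp ζ‖ / 2) ⊆ {z | R₁ < ‖z‖} := by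
      intro z hz
      rw [Metric.mem_closedBall, dist_eq_norm] at hz
      have := norm_sub_norm_le (Complex.exp ζ) (Complex.exp ζ - z)
      rw [sub_sub_cancel, norm_sub_rev] at this
      change R₁ < ‖z‖
      linarith
    have hc : DiffContOnCl ℂ (bottcherCorr f) (Metric.ball (Complex.exp ζ) (‖Complex.exp ζ‖ / 2)) :=
      DifferentiableOn.diffContOnCl (by
        rw [closure_ball _ (by positivity)]; exact hdiff.mono hsub')
    have := Complex.norm_deriv_le_of_forall_mem_sphere_norm_le (half_pos hpos) hc
      (fun z hz => hsm z (hsub' (Metric.sphere_subset_closedBall hz)))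
    calc _ ≤ 1 / 8 / (‖Complex.exp ζ‖ / 2) * ‖Complex.exp ζ‖ := by gcongr
      _ = 1 / 4 := by field_simp; norm_num
  have hconv : Convex ℝ {ζ : ℂ | Real.log r < ζ.re} := convex_halfSpace_re_gt _
  have hlip : ∀ ζ₁ ζ₂ : ℂ, Real.log r < ζ₁.re → Real.log r < ζ₂.re →
      ‖E ζ₂ - E ζ₁‖ ≤ 1 / 4 * ‖ζ₂ - ζ₁‖ := fun ζ₁ ζ₂ h1 h2 =>
    Convex.norm_image_sub_le_of_norm_deriv_le (fun x hx => (hEd x hx).differentiableAt)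
      hEd' hconv h1 h2
  have hb : ∀ ζ : ℂ, Complex.exp ζ * Complex.exp (bottcherCorr f (Complex.exp ζ)) =
      Complex.exp (ζ + E ζ) := fun ζ => by rw [Complex.exp_add]
  refine ⟨fun z => z * Complex.exp (bottcherCorr f z), r, r * Real.exp 1, by linarith,
    ?_, ?_, ?_, ?_, ?_, ?_, ?_, ?_⟩
  · refine (differentiableOn_id).mul (DifferentiableOn.cexp (hdiff.mono fun z hz => ?_))
    simp only [mem_ofPred_eq] at hz ⊢; linarith
  · exact fun z hz => hR' z (by linarith)
  · intro z hz
    have h1 := hR' z (by linarith)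
    exact exp_bottcherCorr_eval hd (hT z (by linarith)) (norm_pos_iff.1 (by linarith))
      (norm_pos_iff.1 (by linarith))
  · intro z hz
    have hz0 : ‖z‖ ≠ 0 := by linarith
    rw [norm_mul, Complex.norm_exp, Real.log_mul hz0 (Real.exp_ne_zero _), Real.log_exp,
      add_sub_cancel_left]
    exact (Complex.abs_re_le_norm _).trans ((hsm z (by linarith)).trans (by norm_num))
  · intro z₁ h1 z₂ h2 h12
    simp only [mem_ofPred_eq] at h1 h2
    have hz1 : z₁ ≠ 0 := norm_pos_iff.1 (by linarith)
    have hz2 : z₂ ≠ 0 := norm_pos_iff.1 (by linarith)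
    have hre : ∀ z : ℂ, r < ‖z‖ → Real.log r < (Complex.log z).re := fun z hz => by
      rw [Complex.log_re]; exact Real.log_lt_log (by linarith) hz
    dsimp only at h12
    rw [← Complex.exp_log hz1, ← Complex.exp_log hz2, hb, hb,
      Complex.exp_eq_exp_iff_exists_int] at h12
    obtain ⟨n, hn⟩ := h12
    -- Equality of exponentials determines the logarithm only modulo `2πi`. Since `E` is
    -- `2πi`-periodic, the multiple can be absorbed into the logarithm of `z₂`.
    set ζ := Complex.log z₂ + n * (2 * Real.pi * Complex.I) with hζ
    have hζe : Complex.exp ζ = z₂ := by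
      rw [hζ, Complex.exp_add, Complex.exp_int_mul_two_pi_mul_I, mul_one, Complex.exp_log hz2]
    have hEζ : E ζ = E (Complex.log z₂) := by simp only [hE, hζe, Complex.exp_log hz2]
    have hζre : Real.log r < ζ.re := by
      have := hre z₂ h2
      simpa [hζ] using this
    have h3 : Complex.log z₁ - ζ = E ζ - E (Complex.log z₁) := by
      rw [hEζ, hζ]; linear_combination hn
    have h4 := hlip _ _ (hre z₁ h1) hζre
    rw [← h3, norm_sub_rev ζ] at h4
    have h5 : ‖Complex.log z₁ - ζ‖ = 0 := by linarith [norm_nonneg (Complex.log z₁ - ζ)]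
    rw [norm_eq_zero, sub_eq_zero] at h5
    rw [← Complex.exp_log hz1, h5, hζe]
  · intro w hw
    have hw0 : w ≠ 0 := norm_pos_iff.1 (lt_trans (by positivity) hw)
    set ω := Complex.log w
    have hω : Real.log r + 1 < ω.re := by
      rw [Complex.log_re, ← Real.log_exp 1, ← Real.log_mul (by linarith) (Real.exp_ne_zero _)]
      exact Real.log_lt_log (by positivity) hw
    have hball : ∀ ζ ∈ Metric.closedBall ω (1 / 2), Real.log r < ζ.re := fun ζ hζ => by
      rw [Metric.mem_closedBall, dist_eq_norm] at hζ
      have := (abs_le.1 ((Complex.abs_re_le_norm _).trans hζ)).1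
      rw [Complex.sub_re] at this
      linarith
    -- A solution of `ζ + E ζ = ω` is a fixed point of `ζ ↦ ω - E ζ`. The factor `exp 1` in the
    -- radius leaves a margin of `1` in the real part, so the disc of radius `1/2` about `ω` lies in
    -- the half-plane.
    have hmaps : MapsTo (fun ζ => ω - E ζ) (Metric.closedBall ω (1 / 2))
        (Metric.closedBall ω (1 / 2)) := fun ζ hζ => by
      rw [Metric.mem_closedBall, dist_eq_norm, sub_sub_cancel_left, norm_neg]
      refine (hsm _ ?_).trans (by norm_num)
      linarith [hmem ζ (hball ζ hζ)]
    have hcontr : ContractingWith (1 / 4) (hmaps.restrict) := by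
      refine ⟨by rw [← NNReal.coe_lt_coe]; norm_num, LipschitzWith.of_dist_le_mul fun x y => ?_⟩
      rw [Subtype.dist_eq, Subtype.dist_eq, dist_eq_norm, dist_eq_norm]
      have := hlip _ _ (hball _ x.2) (hball _ y.2)
      simp only [MapsTo.val_restrict_apply]
      rw [sub_sub_sub_cancel_left, norm_sub_rev (x : ℂ)]
      simpa using this
    obtain ⟨ζ, hζ, hfix, -⟩ := hcontr.exists_fixedPoint' Metric.isClosed_closedBall.isComplete hmaps
      (Metric.mem_closedBall_self (by norm_num)) (edist_ne_top _ _)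
    refine ⟨Complex.exp ζ, hmem ζ (hball ζ hζ), ?_⟩
    have hfix' : ω - E ζ = ζ := hfix
    change Complex.exp ζ * Complex.exp (bottcherCorr f (Complex.exp ζ)) = w
    rw [hb, ← Complex.exp_log hw0]
    congr 1
    linear_combination -hfix'
  · intro z hz
    exact mul_ne_zero (norm_pos_iff.1 (by linarith)) (Complex.exp_ne_zero _)
  · have h1 : Tendsto (bottcherCorr f) (Bornology.cobounded ℂ) (𝓝 0) := by
      rw [Metric.tendsto_nhds]
      intro ε hε
      obtain ⟨R, -, h⟩ := exists_bottcherCorr_small hf hd hR' (half_pos hε)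
      filter_upwards [tendsto_norm_cobounded_atTop.eventually_gt_atTop R] with z hz
      rw [dist_zero_right]
      exact (norm_bottcherCorr_le (h z hz)).trans_lt (half_lt_self hε)
    have h2 : Tendsto (fun z => Complex.exp (bottcherCorr f z)) (Bornology.cobounded ℂ) (𝓝 1) := by
      simpa [Function.comp_def] using (Complex.continuous_exp.tendsto 0).comp h1
    refine h2.congr' ?_
    filter_upwards [tendsto_norm_cobounded_atTop.eventually_gt_atTop 0] with z hz
    rw [mul_div_cancel_left₀ _ (norm_pos_iff.1 hz)]

end PolyBasin

namespace PolyBasin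

/-! ### Half-planes and lifting -/

/-- The half-plane `{Re > T}`. -/
def halfPlane (T : ℝ) : Set ℂ := {ζ | T < ζ.re}

@[simp] lemma mem_halfPlane {T : ℝ} {ζ : ℂ} : ζ ∈ halfPlane T ↔ T < ζ.re := Iff.rfl

lemma halfPlane_anti {T T' : ℝ} (h : T ≤ T') : halfPlane T' ⊆ halfPlane T := fun _ hζ =>
  lt_of_le_of_lt h hζ

lemma isOpen_halfPlane (T : ℝ) : IsOpen (halfPlane T) :=
  isOpen_lt continuous_const Complex.continuous_re

lemma convex_halfPlane (T : ℝ) : Convex ℝ (halfPlane T) := convex_halfSpace_re_gt T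

lemma nonempty_halfPlane (T : ℝ) : (halfPlane T).Nonempty := ⟨((T + 1 : ℝ) : ℂ), by simp⟩

lemma isSimplyConnected_halfPlane (T : ℝ) : IsSimplyConnected (halfPlane T) := by
  have := (convex_halfPlane T).contractibleSpace (nonempty_halfPlane T)
  exact SimplyConnectedSpace.ofContractible _

lemma exists_continuousOn_lift {p k : ℂ → ℂ} {s : Set ℂ} (hp : IsCoveringMapOn p s) {T : ℝ}
    (hk : ContinuousOn k (halfPlane T)) (hks : MapsTo k (halfPlane T) s) {a e : ℂ}
    (ha : a ∈ halfPlane T) (he : p e = k a) :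
    ∃ F : ℂ → ℂ, ContinuousOn F (halfPlane T) ∧ F a = e ∧ ∀ ζ ∈ halfPlane T, p (F ζ) = k ζ := by
  classical
  have := (isSimplyConnected_halfPlane T).simplyConnectedSpace
  have := (isOpen_halfPlane T).locallyPathConnectedSpace
  obtain ⟨F, ⟨hF1, hF2⟩, -⟩ := hp.existsUnique_continuousMap_lifts
    ⟨(halfPlane T).domRestrict k, continuousOn_iff_continuous_domRestrict.1 hk⟩ (a₀ := ⟨a, ha⟩)
    (e₀ := e) he fun x => hks x.2
  obtain ⟨g, hg⟩ : ∃ g : ℂ → ℂ, ∀ z : halfPlane T, g z = F z :=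
    ⟨fun z => if hz : z ∈ halfPlane T then F ⟨z, hz⟩ else 0, by simp⟩
  refine ⟨g, ?_, (hg ⟨a, ha⟩).trans hF1, fun ζ hζ => ?_⟩
  · rw [continuousOn_iff_continuous_domRestrict]
    convert! map_continuous F
    ext z
    exact hg z
  · rw [hg ⟨ζ, hζ⟩]
    exact congrFun hF2 ⟨ζ, hζ⟩

/-- Identities on half-planes are proved below by this uniqueness: both sides lift the same map and
agree at one point. -/
lemma eqOn_lift {p k : ℂ → ℂ} {s : Set ℂ} (hp : IsCoveringMapOn p s) {T : ℝ}
    (hks : MapsTo k (halfPlane T) s) {F₁ F₂ : ℂ → ℂ}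
    (h1 : ContinuousOn F₁ (halfPlane T)) (h2 : ContinuousOn F₂ (halfPlane T))
    (hk1 : ∀ ζ ∈ halfPlane T, p (F₁ ζ) = k ζ) (hk2 : ∀ ζ ∈ halfPlane T, p (F₂ ζ) = k ζ) {a : ℂ}
    (ha : a ∈ halfPlane T) (he : F₁ a = F₂ a) : EqOn F₁ F₂ (halfPlane T) := by
  have := (isSimplyConnected_halfPlane T).simplyConnectedSpace
  have := (isOpen_halfPlane T).locallyPathConnectedSpace
  have hk : ContinuousOn k (halfPlane T) := by
    have : ContinuousOn (p ∘ F₁) (halfPlane T) :=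
      hp.continuousOn.comp h1 fun ζ hζ => by rw [mem_preimage, hk1 ζ hζ]; exact hks hζ
    exact this.congr fun ζ hζ => (hk1 ζ hζ).symm
  have := (hp.existsUnique_continuousMap_lifts
    ⟨(halfPlane T).domRestrict k, continuousOn_iff_continuous_domRestrict.1 hk⟩ (a₀ := ⟨a, ha⟩)
    (e₀ := F₁ a) (hk1 a ha) fun x => hks x.2).unique
    (y₁ := ⟨_, continuousOn_iff_continuous_domRestrict.1 h1⟩)
    (y₂ := ⟨_, continuousOn_iff_continuous_domRestrict.1 h2⟩)
    ⟨rfl, funext fun x => hk1 x x.2⟩ ⟨he.symm, funext fun x => hk2 x x.2⟩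
  intro ζ hζ
  exact congrArg (fun F : C(halfPlane T, ℂ) => F ⟨ζ, hζ⟩) this

/-! ### The inverse of the Böttcher map in the logarithmic coordinate -/

/-- `ψ` is, on the half-plane `{Re > T}`, the inverse of a Böttcher map on `{G > T}` composed with
the exponential. -/
structure LogBottcher (f : ℂ[X]) (T : ℝ) (ψ : ℂ → ℂ) : Prop where
  differentiableOn : DifferentiableOn ℂ ψ (halfPlane T)
  green_eq : ∀ ζ ∈ halfPlane T, green f (ψ ζ) = ζ.re
  eval_eq : ∀ ζ ∈ halfPlane T, f.eval (ψ ζ) = ψ (f.natDegree * ζ)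
  eq_iff : ∀ ζ₁ ∈ halfPlane T, ∀ ζ₂ ∈ halfPlane T, ψ ζ₁ = ψ ζ₂ ↔ Complex.exp ζ₁ = Complex.exp ζ₂
  surj : ∀ z, T < green f z → ∃ ζ ∈ halfPlane T, ψ ζ = z
  tangent : ∀ ε > 0, ∃ R : ℝ, ∀ ζ ∈ halfPlane T, R < ζ.re → ‖Complex.exp ζ / ψ ζ - 1‖ < ε

variable {f : ℂ[X]}

lemma natCast_mul_mem_halfPlane (hd : 2 ≤ f.natDegree) {T : ℝ} (hT : 0 ≤ T) {ζ : ℂ}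
    (hζ : ζ ∈ halfPlane T) : (f.natDegree : ℂ) * ζ ∈ halfPlane T := by
  rw [mem_halfPlane] at *
  have h1 : (2 : ℝ) ≤ f.natDegree := by exact_mod_cast hd
  have : ((f.natDegree : ℂ) * ζ).re = f.natDegree * ζ.re := by simp
  rw [this]; nlinarith

lemma exists_logBottcher_near_infinity (hf : f.Monic) (hd : 2 ≤ f.natDegree) :
    ∃ T > 0, ∃ ψ, LogBottcher f T ψ := by
  obtain ⟨b, R, R', hR2, hdiff, hesc, hsemi, hlog, hinj, hsurj, hne, htan⟩ :=
    exists_bottcher_near_infinity hf hd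
  have hiter : ∀ z : ℂ, R < ‖z‖ → ∀ n, b (iter f n z) = b z ^ f.natDegree ^ n := by
    intro z hz n
    induction n with
    | zero => simp
    | succ n ih =>
      rw [iter_succ', hsemi _ (hz.trans_le (norm_le_norm_iter hesc hz n)), ih, ← pow_mul, pow_succ]
  have hG : ∀ z : ℂ, R < ‖z‖ → green f z = Real.log ‖b z‖ := fun z hz =>
    green_eq_log_norm hf hd (C := 1) (hiter z hz)
      (Eventually.of_forall fun n => hlog _ (hz.trans_le (norm_le_norm_iter hesc hz n)))
      (Eventually.of_forall fun n => by linarith [norm_le_norm_iter hesc hz n])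
  obtain ⟨C, hC⟩ := (isCompact_closedBall (0 : ℂ) R).bddAbove_image
    (continuous_green hf hd).continuousOn
  have hout : ∀ z, C < green f z → R < ‖z‖ := fun z hz => by
    by_contra h
    exact absurd (hC ⟨z, by simpa using h, rfl⟩) (not_le.2 hz)
  -- Above level `C` a point lies outside the disc of radius `R`, and the logarithmic term puts `exp
  -- ζ` in the range where `b` is known to be surjective.
  set T := max 1 (max C (Real.log (max R' 1))) with hT
  have hTpos : 0 < T := lt_of_lt_of_le one_pos (le_max_left _ _)
  set U : Set ℂ := {z | R < ‖z‖} with hU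
  have hUo : IsOpen U := isOpen_norm_gt R
  have hex : ∀ ζ ∈ halfPlane T, ∃ z ∈ U, b z = Complex.exp ζ := fun ζ hζ => by
    refine hsurj _ ?_
    have h1 : Real.log (max R' 1) < ζ.re :=
      (le_max_right _ _).trans_lt ((le_max_right _ _).trans_lt hζ)
    rw [Complex.norm_exp]
    exact (le_max_left _ _).trans_lt ((Real.log_lt_iff_lt_exp (by positivity)).1 h1)
  set B := Function.invFunOn b U
  have hB : ∀ z ∈ U, B (b z) = z := fun z hz => hinj.leftInvOn_invFunOn hz
  have hψ : ∀ ζ ∈ halfPlane T, B (Complex.exp ζ) ∈ U ∧ b (B (Complex.exp ζ)) = Complex.exp ζ :=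
    fun ζ hζ => by
      obtain ⟨z, hz, h⟩ := hex ζ hζ
      rw [← h, hB z hz]; exact ⟨hz, rfl⟩
  have hgreen : ∀ ζ ∈ halfPlane T, green f (B (Complex.exp ζ)) = ζ.re := fun ζ hζ => by
    rw [hG _ (hψ ζ hζ).1, (hψ ζ hζ).2, Complex.norm_exp, Real.log_exp]
  refine ⟨T, hTpos, fun ζ => B (Complex.exp ζ), ?_, hgreen, ?_, ?_, ?_, ?_⟩
  · intro ζ hζ
    obtain ⟨z, hz, h⟩ := hex ζ hζ
    have := (hasStrictDerivAt_invFunOn hUo hdiff hinj hz).1.hasDerivAt.differentiableAt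
    rw [h] at this
    exact (this.comp ζ Complex.differentiableAt_exp).differentiableWithinAt
  · intro ζ hζ
    have h1 := hψ ζ hζ
    have h2 := hψ _ (natCast_mul_mem_halfPlane hd hTpos.le hζ)
    have h3 : f.eval (B (Complex.exp ζ)) ∈ U := lt_of_lt_of_le h1.1 (hesc _ h1.1)
    refine hinj h3 h2.1 ?_
    rw [hsemi _ h1.1, h1.2, h2.2, Complex.exp_nat_mul]
  · intro ζ₁ h1 ζ₂ h2
    refine ⟨fun h => ?_, fun h => by simp only [h]⟩
    rw [← (hψ _ h1).2, ← (hψ _ h2).2]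
    exact congrArg b h
  · intro z hz
    have hzU : z ∈ U := hout z (((le_max_left _ _).trans (le_max_right _ _)).trans_lt hz)
    have hbz := hne z hzU
    refine ⟨Complex.log (b z), ?_, ?_⟩
    · rw [mem_halfPlane, Complex.log_re, ← hG z hzU]; exact hz
    · rw [Complex.exp_log hbz, hB z hzU]
  · intro ε hε
    have h1 := htan.eventually (Metric.ball_mem_nhds 1 hε)
    obtain ⟨r, -, hr⟩ := exists_norm_gt h1
    obtain ⟨C', hC'⟩ := (isCompact_closedBall (0 : ℂ) r).bddAbove_image
      (continuous_green hf hd).continuousOn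
    refine ⟨C', fun ζ hζ hζ' => ?_⟩
    have h2 : r < ‖B (Complex.exp ζ)‖ := by
      by_contra h
      refine absurd (hC' ⟨B (Complex.exp ζ), by simpa using h, rfl⟩) (not_le.2 ?_)
      rw [hgreen ζ hζ]; exact hζ'
    have := hr _ h2
    rw [(hψ ζ hζ).2] at this
    simpa [dist_eq_norm] using this

/-- `ψ` identifies exactly the points that `exp` identifies, so it inherits local injectivity from
`exp`. -/
lemma LogBottcher.deriv_ne_zero {T : ℝ} {ψ : ℂ → ℂ} (h : LogBottcher f T ψ) {ζ : ℂ}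
    (hζ : ζ ∈ halfPlane T) : deriv ψ ζ ≠ 0 := by
  obtain ⟨U, hU, hinj⟩ := eventually_injOn (Complex.hasStrictDerivAt_exp ζ) (Complex.exp_ne_zero ζ)
  have hn := (isOpen_halfPlane T).mem_nhds hζ
  refine deriv_ne_zero_of_injOn (inter_mem hU hn) (h.differentiableOn.analyticAt hn) ?_
  intro x hx y hy hxy
  exact hinj hx.1 hy.1 ((h.eq_iff x hx.2 y hy.2).1 hxy)

/-- A polynomial is a covering away from its critical values, and a critical value of `fⁿ` has Green
level at most `dⁿ M(f)`. -/
lemma isCoveringMapOn_iter (hf : f.Monic) (hd : 2 ≤ f.natDegree) (n : ℕ) :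
    IsCoveringMapOn (iter f n) {w | (f.natDegree : ℝ) ^ n * maxCrit f < green f w} := by
  have h : iter f n = fun z => (iterPoly f n).eval z := by ext; rw [eval_iterPoly]
  have h1 := (iterPoly f n).isCoveringMapOn_eval
  change IsCoveringMapOn (fun z => (iterPoly f n).eval z) _ at h1
  rw [← h] at h1
  refine h1.mono ?_
  rintro w hw ⟨c, hc, rfl⟩
  have hc' : deriv (iter f n) c = 0 := by rw [h, Polynomial.deriv]; exact hc
  simp only [mem_ofPred_eq, green_iter hf hd] at hw
  have : c ∈ outer f := lt_of_mul_lt_mul_left hw (by positivity)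
  exact deriv_iter_ne_zero hf hd this n hc'

/-- Choose `n` with `dⁿ M(f) > T₀`. The map `ζ ↦ ψ₀(dⁿ ζ)` is then defined on `{Re > M(f)}` and
takes values where `fⁿ` is a covering, so it lifts through `fⁿ` on this simply connected half-plane.
The lift agrees with `ψ₀` near infinity, and the remaining properties are continued from there. -/
lemma exists_logBottcher (hf : f.Monic) (hd : 2 ≤ f.natDegree) (hM : 0 < maxCrit f) :
    ∃ ψ, LogBottcher f (maxCrit f) ψ := by
  obtain ⟨T₀, hT₀, ψ₀, h₀⟩ := exists_logBottcher_near_infinity hf hd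
  set M := maxCrit f
  obtain ⟨n, hn⟩ := exists_lt_pow_mul hd hM T₀
  set N : ℕ := f.natDegree ^ n with hN
  have hNpos : 0 < N := by positivity
  have hNR : ((N : ℕ) : ℝ) = (f.natDegree : ℝ) ^ n := by simp [hN]
  have hN0 : (N : ℂ) ≠ 0 := by exact_mod_cast hNpos.ne'
  have hcov := isCoveringMapOn_iter hf hd n
  set s : Set ℂ := {w | (f.natDegree : ℝ) ^ n * maxCrit f < green f w} with hs
  have hNre : ∀ ζ : ℂ, ((N : ℂ) * ζ).re = N * ζ.re := fun ζ => by simp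
  have hNmem : ∀ ζ ∈ halfPlane M, (N : ℂ) * ζ ∈ halfPlane T₀ := fun ζ hζ => by
    rw [mem_halfPlane, hNre]
    have : (N : ℝ) * M < N * ζ.re := by
      have : M < ζ.re := hζ
      gcongr
    rw [hNR] at this ⊢; linarith
  have hks : ∀ ζ ∈ halfPlane M, ψ₀ (N * ζ) ∈ s := fun ζ hζ => by
    rw [hs, mem_ofPred_eq, h₀.green_eq _ (hNmem ζ hζ), hNre, ← hNR]
    have : M < ζ.re := hζ
    have : (0 : ℝ) < N := by exact_mod_cast hNpos
    gcongr
  have hiter : ∀ (m : ℕ) (ζ : ℂ), ζ ∈ halfPlane T₀ →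
      iter f m (ψ₀ ζ) = ψ₀ ((f.natDegree ^ m : ℕ) * ζ) := by
    intro m
    induction m with
    | zero => intro ζ _; simp
    | succ m ih =>
      intro ζ hζ
      rw [iter_succ, h₀.eval_eq ζ hζ, ih _ (natCast_mul_mem_halfPlane hd hT₀.le hζ)]
      congr 1
      push_cast; ring
  have hkc : ∀ c : ℂ → ℂ, Continuous c → MapsTo c (halfPlane M) (halfPlane T₀) →
      ContinuousOn (fun ζ => ψ₀ (c ζ)) (halfPlane M) := fun c hc hm =>
    h₀.differentiableOn.continuousOn.comp hc.continuousOn hm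
  set a : ℂ := ((max T₀ M + 1 : ℝ) : ℂ) with ha
  have haT : a ∈ halfPlane T₀ := by
    rw [ha, mem_halfPlane, Complex.ofReal_re]; linarith [le_max_left T₀ M]
  have haM : a ∈ halfPlane M := by
    rw [ha, mem_halfPlane, Complex.ofReal_re]; linarith [le_max_right T₀ M]
  obtain ⟨ψ, hψc, hψa, hψ⟩ := exists_continuousOn_lift hcov
    (hkc (fun ζ => N * ζ) (by fun_prop) hNmem) hks haM (hiter n a haT)
  have hmax : ∀ ζ ∈ halfPlane (max T₀ M), ψ ζ = ψ₀ ζ := by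
    have hsub1 : halfPlane (max T₀ M) ⊆ halfPlane M := halfPlane_anti (le_max_right _ _)
    have hsub2 : halfPlane (max T₀ M) ⊆ halfPlane T₀ := halfPlane_anti (le_max_left _ _)
    exact eqOn_lift hcov (k := fun ζ => ψ₀ (N * ζ)) (fun ζ h => hks ζ (hsub1 h))
      (hψc.mono hsub1) (h₀.differentiableOn.continuousOn.mono hsub2)
      (fun ζ h => hψ ζ (hsub1 h)) (fun ζ h => hiter n ζ (hsub2 h)) (a := a)
      (by rw [ha, mem_halfPlane, Complex.ofReal_re]; linarith) hψa
  have hgreen : ∀ ζ ∈ halfPlane M, green f (ψ ζ) = ζ.re := fun ζ hζ => by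
    have h1 := h₀.green_eq _ (hNmem ζ hζ)
    rw [← hψ ζ hζ, green_iter hf hd, hNre, hNR] at h1
    exact mul_left_cancel₀ (by positivity) h1
  have hmem : ∀ ζ ∈ halfPlane M, ψ ζ ∈ outer f := fun ζ hζ => by
    rw [outer, mem_ofPred_eq, hgreen ζ hζ]; exact hζ
  -- When `exp(Nτ) = 1`, both `ψ(· + τ)` and `ψ` lift the same map, so agreement at one point
  -- spreads to the half-plane. Whether a translation is a period is thus decided at `a`, where `ψ =
  -- ψ₀`.
  have hshift : ∀ τ : ℂ, τ.re = 0 → Complex.exp (N * τ) = 1 → ∀ ζ ∈ halfPlane M,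
      ψ (ζ + τ) = ψ ζ → ∀ ζ ∈ halfPlane M, ψ (ζ + τ) = ψ ζ := by
    intro τ hτ hτN ζ₀ hζ₀ h
    have hm : ∀ ζ ∈ halfPlane M, ζ + τ ∈ halfPlane M := fun ζ hζ => by
      rw [mem_halfPlane, Complex.add_re, hτ, add_zero]; exact hζ
    refine eqOn_lift hcov (k := fun ζ => ψ₀ (N * ζ)) hks
      (hψc.comp (by fun_prop) hm) hψc (fun ζ hζ => ?_) hψ hζ₀ h
    rw [hψ _ (hm ζ hζ), h₀.eq_iff _ (hNmem _ (hm ζ hζ)) _ (hNmem _ hζ), mul_add, Complex.exp_add,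
      hτN, mul_one]
  have hper : ∀ τ : ℂ, τ.re = 0 → Complex.exp (N * τ) = 1 →
      (Complex.exp τ = 1 ↔ ψ (a + τ) = ψ a) := by
    intro τ hτ _
    have h1 : a + τ ∈ halfPlane (max T₀ M) := by
      rw [mem_halfPlane, Complex.add_re, hτ, ha, Complex.ofReal_re]; linarith
    have h2 : a ∈ halfPlane (max T₀ M) := by
      rw [mem_halfPlane, ha, Complex.ofReal_re]; linarith
    rw [hmax _ h1, hmax _ h2, h₀.eq_iff _ (halfPlane_anti (le_max_left _ _) h1) _
      (halfPlane_anti (le_max_left _ _) h2), Complex.exp_add, mul_eq_left₀ (Complex.exp_ne_zero a)]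
  have heq : ∀ ζ₁ ∈ halfPlane M, ∀ ζ₂ ∈ halfPlane M,
      ψ ζ₁ = ψ ζ₂ ↔ Complex.exp ζ₁ = Complex.exp ζ₂ := by
    intro ζ₁ h1 ζ₂ h2
    have key : ζ₁.re = ζ₂.re → Complex.exp (N * ζ₁) = Complex.exp (N * ζ₂) →
        (ψ ζ₁ = ψ ζ₂ ↔ Complex.exp ζ₁ = Complex.exp ζ₂) := by
      intro hre hN'
      have hτ : (ζ₁ - ζ₂).re = 0 := by rw [Complex.sub_re, hre, sub_self]
      have hτN : Complex.exp (N * (ζ₁ - ζ₂)) = 1 := by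
        rw [mul_sub, Complex.exp_sub, hN', div_self (Complex.exp_ne_zero _)]
      have h3 := hper _ hτ hτN
      have h4 : Complex.exp (ζ₁ - ζ₂) = 1 ↔ Complex.exp ζ₁ = Complex.exp ζ₂ := by
        rw [Complex.exp_sub, div_eq_one_iff_eq (Complex.exp_ne_zero _)]
      rw [← h4, h3]
      constructor
      · intro h
        exact hshift _ hτ hτN ζ₂ h2 (by rw [add_sub_cancel]; exact h) a haM
      · intro h
        have := hshift _ hτ hτN a haM h ζ₂ h2
        rwa [add_sub_cancel] at this
    constructor
    · intro h
      have hre : ζ₁.re = ζ₂.re := by rw [← hgreen _ h1, ← hgreen _ h2, h]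
      have h3 : ψ₀ (N * ζ₁) = ψ₀ (N * ζ₂) := by rw [← hψ _ h1, ← hψ _ h2, h]
      rw [h₀.eq_iff _ (hNmem _ h1) _ (hNmem _ h2)] at h3
      exact (key hre h3).1 h
    · intro h
      have hre : ζ₁.re = ζ₂.re := by
        have := congrArg norm h
        rwa [Complex.norm_exp, Complex.norm_exp, Real.exp_eq_exp] at this
      exact (key hre (by rw [Complex.exp_nat_mul, Complex.exp_nat_mul, h])).2 h
  refine ⟨ψ, ⟨?_, hgreen, ?_, heq, ?_, ?_⟩⟩
  · intro ζ hζ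
    have hn := (isOpen_halfPlane M).mem_nhds hζ
    refine DifferentiableAt.differentiableWithinAt ?_
    refine differentiableAt_of_comp_eq (p := iter f n) (k := fun ζ => ψ₀ (N * ζ))
      (((differentiable_iter f n).analyticAt _).hasStrictDerivAt)
      (deriv_iter_ne_zero hf hd (hmem ζ hζ) n) (hψc.continuousAt hn) ?_ ?_
    · have := h₀.differentiableOn.differentiableAt ((isOpen_halfPlane T₀).mem_nhds (hNmem ζ hζ))
      exact this.comp ζ (by fun_prop)
    · filter_upwards [hn] with y hy using hψ y hy
  · have hdm : MapsTo (fun ζ : ℂ => (f.natDegree : ℂ) * ζ) (halfPlane M) (halfPlane M) := fun ζ hζ =>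
      natCast_mul_mem_halfPlane hd hM.le hζ
    have hks' : ∀ ζ ∈ halfPlane M, ψ₀ (N * (f.natDegree * ζ)) ∈ s := fun ζ hζ => hks _ (hdm hζ)
    refine eqOn_lift hcov (k := fun ζ => ψ₀ (N * (f.natDegree * ζ))) hks'
      (f.continuous.comp_continuousOn hψc)
      (hψc.comp (by fun_prop) hdm) (fun ζ hζ => ?_) (fun ζ hζ => hψ _ (hdm hζ)) haM ?_
    · rw [eval_comm_iter, hψ ζ hζ, h₀.eval_eq _ (hNmem ζ hζ)]
      congr 1; ring
    · have h2 : a ∈ halfPlane (max T₀ M) := by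
        rw [mem_halfPlane, ha, Complex.ofReal_re]; linarith
      rw [hmax _ h2, h₀.eval_eq _ haT, hmax]
      exact natCast_mul_mem_halfPlane hd (hT₀.le.trans (le_max_left _ _)) h2
  · intro z hz
    have h1 : T₀ < green f (iter f n z) := by
      rw [green_iter hf hd]
      have : (f.natDegree : ℝ) ^ n * M < (f.natDegree : ℝ) ^ n * green f z := by gcongr
      linarith
    obtain ⟨ω, hω, hωz⟩ := h₀.surj _ h1
    set ζ : ℂ := ω / N with hζdef
    have hNζ : (N : ℂ) * ζ = ω := by rw [hζdef]; field_simp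
    have hζ : ζ ∈ halfPlane M := by
      have h2 := h₀.green_eq _ hω
      rw [hωz, green_iter hf hd, ← hNζ, hNre, ← hNR] at h2
      have h3 := mul_left_cancel₀ (by exact_mod_cast hNpos.ne') h2
      rw [mem_halfPlane, ← h3]; exact hz
    -- Surjectivity by counting: the `N` points `ψ(ζ + 2πij / N)` are distinct and lie in the fibre
    -- of `fⁿ` through `z`, which has at most `N = deg fⁿ` points.
    set τ : ℕ → ℂ := fun j => j * (2 * Real.pi * Complex.I / N) with hτ
    have hτre : ∀ j, (ζ + τ j).re = ζ.re := fun j => by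
      have : τ j = ((j * (2 * Real.pi / N) : ℝ) : ℂ) * Complex.I := by
        simp only [hτ]; push_cast; ring
      rw [this, Complex.add_re, Complex.re_ofReal_mul, Complex.I_re, mul_zero, add_zero]
    have hm : ∀ j, ζ + τ j ∈ halfPlane M := fun j => by rw [mem_halfPlane, hτre]; exact hζ
    have hfib : ∀ j, iter f n (ψ (ζ + τ j)) = iter f n z := fun j => by
      rw [hψ _ (hm j), ← hωz, h₀.eq_iff _ (hNmem _ (hm j)) _ hω, mul_add, hNζ]
      have : (N : ℂ) * τ j = (j : ℤ) * (2 * Real.pi * Complex.I) := by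
        simp only [hτ]; push_cast; field_simp
      rw [this, Complex.exp_add, Complex.exp_int_mul_two_pi_mul_I, mul_one]
    have hinj : InjOn (fun j => ψ (ζ + τ j)) (Finset.range N : Set ℕ) := by
      intro i hi j hj hij
      have h3 := (heq _ (hm i) _ (hm j)).1 hij
      rw [Complex.exp_add, Complex.exp_add] at h3
      have h4 := mul_left_cancel₀ (Complex.exp_ne_zero ζ) h3
      have hprim := Complex.isPrimitiveRoot_exp N hNpos.ne'
      simp only [hτ, Complex.exp_nat_mul] at h4
      exact hprim.pow_inj (Finset.mem_range.1 hi) (Finset.mem_range.1 hj) h4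
    set P : ℂ[X] := iterPoly f n - C (iter f n z) with hP
    have hPdeg : P.natDegree = N := by rw [hP, natDegree_sub_C, natDegree_iterPoly]
    have hP0 : P ≠ 0 := fun h => by rw [h, natDegree_zero] at hPdeg; omega
    have hsub : (Finset.range N).image (fun j => ψ (ζ + τ j)) ⊆ P.roots.toFinset := by
      intro w hw
      obtain ⟨j, -, rfl⟩ := Finset.mem_image.1 hw
      rw [Multiset.mem_toFinset, mem_roots hP0, IsRoot.def, hP, eval_sub, eval_C, eval_iterPoly,
        hfib, sub_self]
    have hcard : P.roots.toFinset.card ≤ ((Finset.range N).image (fun j => ψ (ζ + τ j))).card := by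
      rw [Finset.card_image_of_injOn hinj, Finset.card_range, ← hPdeg]
      exact (Multiset.toFinset_card_le _).trans (card_roots' P)
    have hz' : z ∈ P.roots.toFinset := by
      rw [Multiset.mem_toFinset, mem_roots hP0, IsRoot.def, hP, eval_sub, eval_C, eval_iterPoly,
        sub_self]
    rw [← Finset.eq_of_subset_of_card_le hsub hcard] at hz'
    obtain ⟨j, -, hj⟩ := Finset.mem_image.1 hz'
    exact ⟨_, hm j, hj⟩
  · intro ε hε
    obtain ⟨R, hR⟩ := h₀.tangent ε hε
    refine ⟨max R (max T₀ M), fun ζ _ h => ?_⟩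
    have h1 : ζ ∈ halfPlane (max T₀ M) := (le_max_right _ _).trans_lt h
    rw [hmax ζ h1]
    exact hR ζ (halfPlane_anti (le_max_left _ _) h1) ((le_max_left _ _).trans_lt h)

lemma LogBottcher.exists_isBottcher (hf : f.Monic) (hd : 2 ≤ f.natDegree) {ψ : ℂ → ℂ}
    (h : LogBottcher f (maxCrit f) ψ) : ∃ b, IsBottcher f b := by
  set M := maxCrit f
  have hM : 0 ≤ M := maxCrit_nonneg hf hd
  -- The choice `c` need not be continuous; only `exp ∘ c` is used, and by `eq_iff` it does not
  -- depend on the choice.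
  choose! c hc hψc using h.surj
  have hb : ∀ ζ ∈ halfPlane M, Complex.exp (c (ψ ζ)) = Complex.exp ζ := fun ζ hζ => by
    have h1 : M < green f (ψ ζ) := by rw [h.green_eq ζ hζ]; exact hζ
    exact (h.eq_iff _ (hc _ h1) _ hζ).1 (hψc _ h1)
  refine ⟨fun z => Complex.exp (c z), ?_, ⟨?_, ?_, ?_⟩, ?_, ?_⟩
  · intro z hz
    have hn := (isOpen_halfPlane M).mem_nhds (hc z hz)
    have hs := (h.differentiableOn.analyticAt hn).hasStrictDerivAt
    obtain ⟨l, hl0, hl, -, hl2⟩ := exists_local_inverse hs (h.deriv_ne_zero (hc z hz))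
    rw [hψc z hz] at hl0 hl hl2
    have hl3 : ∀ᶠ y in 𝓝 z, l y ∈ halfPlane M := by
      have := hl.hasDerivAt.continuousAt
      rw [ContinuousAt, hl0] at this
      exact this.eventually hn
    refine DifferentiableAt.differentiableWithinAt ?_
    refine hl.hasDerivAt.differentiableAt.cexp.congr_of_eventuallyEq ?_
    filter_upwards [hl2, hl3] with y h1 h2
    rw [← hb _ h2, h1]
  · intro z hz
    rw [mem_ofPred_eq, Complex.norm_exp, Real.exp_lt_exp]
    exact hc z hz
  · intro z₁ h1 z₂ h2 h12
    have := (h.eq_iff _ (hc _ h1) _ (hc _ h2)).2 h12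
    rwa [hψc _ h1, hψc _ h2] at this
  · intro w hw
    have hw' : Real.exp M < ‖w‖ := hw
    have hpos := (Real.exp_pos M).trans hw'
    have hlog : Complex.log w ∈ halfPlane M := by
      rw [mem_halfPlane, Complex.log_re, Real.lt_log_iff_exp_lt hpos]; exact hw'
    refine ⟨ψ (Complex.log w), ?_, ?_⟩
    · rw [outer, mem_ofPred_eq, h.green_eq _ hlog]; exact hlog
    · dsimp only; rw [hb _ hlog, Complex.exp_log (norm_pos_iff.1 hpos)]
  · intro z hz
    rw [← Complex.exp_nat_mul, ← hb _ (natCast_mul_mem_halfPlane hd hM (hc z hz)),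
      ← h.eval_eq _ (hc z hz), hψc z hz]
  · rw [Metric.tendsto_nhds]
    intro ε hε
    obtain ⟨R, hR⟩ := h.tangent ε hε
    filter_upwards [(tendsto_green_cobounded hf hd).eventually_gt_atTop (max R M)] with z hz
    have hz' : M < green f z := (le_max_right _ _).trans_lt hz
    have := hR _ (hc z hz') (by
      rw [← h.green_eq _ (hc z hz'), hψc z hz']; exact (le_max_left _ _).trans_lt hz)
    rwa [hψc z hz', ← dist_eq_norm] at this

/-- The Böttcher map exists on `{G > M}` as soon as some critical point escapes. -/
lemma isBottcher_bottcher (hf : f.Monic) (hd : 2 ≤ f.natDegree) (hM : 0 < maxCrit f) :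
    IsBottcher f (bottcher f) := by
  obtain ⟨ψ, hψ⟩ := exists_logBottcher hf hd hM
  exact Classical.epsilon_spec (hψ.exists_isBottcher hf hd)

end PolyBasin

namespace PolyBasin

/-! ### Properties of Böttcher maps -/

section Bottcher

variable {f : ℂ[X]} {b : ℂ → ℂ}

lemma IsBottcher.iter_eq (h : IsBottcher f b) (hf : f.Monic) (hd : 2 ≤ f.natDegree) {z : ℂ}
    (hz : z ∈ outer f) (n : ℕ) : b (iter f n z) = b z ^ f.natDegree ^ n := by
  induction n with
  | zero => simp
  | succ n ih => rw [iter_succ', h.semiconj _ (iter_mem_outer hf hd hz n), ih, ← pow_mul, pow_succ]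

lemma IsBottcher.ne_zero (h : IsBottcher f b) {z : ℂ} (hz : z ∈ outer f) : b z ≠ 0 :=
  norm_pos_iff.1 ((Real.exp_pos _).trans (h.bijOn.mapsTo hz))

lemma IsBottcher.green_eq (h : IsBottcher f b) (hf : f.Monic) (hd : 2 ≤ f.natDegree) {z : ℂ}
    (hz : z ∈ outer f) : green f z = Real.log ‖b z‖ := by
  have horb : Tendsto (fun n => iter f n z) atTop (Bornology.cobounded ℂ) :=
    outer_subset_basin hf hd hz
  have hone : ∀ᶠ n in atTop, 1 ≤ ‖iter f n z‖ :=
    (tendsto_norm_cobounded_atTop.comp horb).eventually_ge_atTop 1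
  refine green_eq_log_norm hf hd (C := 1) (h.iter_eq hf hd hz) ?_ hone
  have h1 : Tendsto (fun n => Real.log ‖b (iter f n z) / iter f n z‖) atTop (𝓝 0) := by
    have := ((h.tangent.comp horb).norm)
    rw [norm_one] at this
    simpa [Function.comp_def] using (Real.continuousAt_log one_ne_zero).tendsto.comp this
  filter_upwards [hone, h1.abs.eventually (Iic_mem_nhds (show |(0 : ℝ)| < 1 by simp))] with n h2 h3
  rwa [norm_div, Real.log_div (norm_ne_zero_iff.2 (h.ne_zero (iter_mem_outer hf hd hz n)))
    (by positivity)] at h3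

lemma IsBottcher.norm_eq (h : IsBottcher f b) (hf : f.Monic) (hd : 2 ≤ f.natDegree) {z : ℂ}
    (hz : z ∈ outer f) : ‖b z‖ = Real.exp (green f z) := by
  rw [h.green_eq hf hd hz, Real.exp_log (norm_pos_iff.2 (h.ne_zero hz))]

lemma IsBottcher.analyticAt (h : IsBottcher f b) (hf : f.Monic) (hd : 2 ≤ f.natDegree) {z : ℂ}
    (hz : z ∈ outer f) : AnalyticAt ℂ b z :=
  h.differentiableOn.analyticAt ((isOpen_outer hf hd).mem_nhds hz)

lemma IsBottcher.deriv_ne_zero (h : IsBottcher f b) (hf : f.Monic) (hd : 2 ≤ f.natDegree) {z : ℂ}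
    (hz : z ∈ outer f) : deriv b z ≠ 0 :=
  deriv_ne_zero_of_injOn ((isOpen_outer hf hd).mem_nhds hz) (h.analyticAt hf hd hz) h.bijOn.injOn

/-- The inverse of a Böttcher map in the logarithmic coordinate. -/
lemma IsBottcher.exists_inverse (h : IsBottcher f b) (hf : f.Monic) (hd : 2 ≤ f.natDegree) :
    ∃ ψ : ℂ → ℂ, ContinuousOn ψ (halfPlane (maxCrit f)) ∧
      (∀ ζ ∈ halfPlane (maxCrit f), ψ ζ ∈ outer f ∧ b (ψ ζ) = Complex.exp ζ ∧
        green f (ψ ζ) = ζ.re) ∧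
      ∀ z ∈ outer f, Complex.log (b z) ∈ halfPlane (maxCrit f) ∧ ψ (Complex.log (b z)) = z := by
  set B := Function.invFunOn b (outer f)
  have hB : ∀ z ∈ outer f, B (b z) = z := fun z hz => h.bijOn.injOn.leftInvOn_invFunOn hz
  have hex : ∀ ζ ∈ halfPlane (maxCrit f), ∃ z ∈ outer f, b z = Complex.exp ζ := fun ζ hζ =>
    h.bijOn.surjOn (by rw [mem_ofPred_eq, Complex.norm_exp, Real.exp_lt_exp]; exact hζ)
  refine ⟨fun ζ => B (Complex.exp ζ), ?_, fun ζ hζ => ?_, fun z hz => ?_⟩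
  · intro ζ hζ
    obtain ⟨z, hz, hzζ⟩ := hex ζ hζ
    have := (hasStrictDerivAt_invFunOn (isOpen_outer hf hd) h.differentiableOn h.bijOn.injOn
      hz).1.hasDerivAt.continuousAt
    rw [hzζ] at this
    exact (this.comp Complex.continuous_exp.continuousAt).continuousWithinAt
  · obtain ⟨z, hz, hzζ⟩ := hex ζ hζ
    have : B (Complex.exp ζ) = z := by rw [← hzζ, hB z hz]
    dsimp only
    rw [this]
    exact ⟨hz, hzζ, by rw [h.green_eq hf hd hz, hzζ, Complex.norm_exp, Real.log_exp]⟩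
  · dsimp only
    rw [Complex.exp_log (h.ne_zero hz), hB z hz, mem_halfPlane, Complex.log_re,
      ← h.green_eq hf hd hz]
    exact ⟨hz, rfl⟩

end Bottcher

/-! ### Conjugacies -/

/-- Critical points are characterized by the failure of local injectivity. -/
lemma deriv_eq_zero_of_conj (φ : OpenPartialHomeomorph ℂ ℂ) {F G : ℂ → ℂ}
    (hF : Differentiable ℂ F) (hG : Differentiable ℂ G) {z : ℂ} (hz : z ∈ φ.source)
    (h : ∀ w ∈ φ.source, φ (F w) = G (φ w)) (h0 : deriv F z = 0) : deriv G (φ z) = 0 := by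
  by_contra hne
  obtain ⟨V, hV, hinj⟩ := eventually_injOn (hG.analyticAt (φ z)).hasStrictDerivAt hne
  refine deriv_ne_zero_of_injOn (U := φ ⁻¹' V ∩ φ.source)
    (inter_mem ((φ.continuousAt hz).preimage_mem_nhds hV) (φ.open_source.mem_nhds hz))
    (hF.analyticAt z) (fun x hx y hy hxy => ?_) h0
  exact φ.injOn hx.2 hy.2 (hinj hx.1 hy.1 (by rw [← h x hx.2, ← h y hy.2, hxy]))

/-- A conjugacy between the basins of two monic polynomials that have escaping critical points. -/
structure EscapingConj (f g : ℂ[X]) (φ : OpenPartialHomeomorph ℂ ℂ) : Prop where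
  monic_left : f.Monic
  monic_right : g.Monic
  two_le : 2 ≤ f.natDegree
  natDegree_eq : g.natDegree = f.natDegree
  isConjugacy : IsConjugacy f g φ
  pos_left : 0 < maxCrit f
  pos_right : 0 < maxCrit g

section Conj

variable {f g : ℂ[X]} {φ : OpenPartialHomeomorph ℂ ℂ}

lemma IsConjugacy.mapsTo (h : IsConjugacy f g φ) {z : ℂ} (hz : z ∈ basin f) : φ z ∈ basin g := by
  rw [← h.target_eq]; exact φ.map_source (by rwa [h.source_eq])

lemma IsConjugacy.iter_eq (h : IsConjugacy f g φ) (hf : f.Monic) (hd : 2 ≤ f.natDegree) {z : ℂ}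
    (hz : z ∈ basin f) (n : ℕ) : φ (iter f n z) = iter g n (φ z) := by
  induction n with
  | zero => simp
  | succ n ih => rw [iter_succ', iter_succ', h.comm _ ((iter_mem_basin hf hd n).2 hz), ih]

lemma IsConjugacy.symm (h : IsConjugacy f g φ) (hf : f.Monic) (hd : 2 ≤ f.natDegree) :
    IsConjugacy g f φ.symm where
  source_eq := h.target_eq
  target_eq := h.source_eq
  comm z hz := by
    have hz' : z ∈ φ.target := by rwa [h.target_eq]
    have h1 : φ.symm z ∈ basin f := by rw [← h.source_eq]; exact φ.map_target hz'
    have h2 : f.eval (φ.symm z) ∈ φ.source := by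
      rw [h.source_eq, ← iter_one]; exact (iter_mem_basin hf hd 1).2 h1
    have h3 := h.comm _ h1
    rw [φ.right_inv hz'] at h3
    rw [← h3, φ.left_inv h2]

lemma IsConjugacy.map_critSet (h : IsConjugacy f g φ) {c : ℂ} (hc : c ∈ critSet f)
    (hb : c ∈ basin f) : φ c ∈ critSet g := by
  have := deriv_eq_zero_of_conj φ (F := fun w => f.eval w) (G := fun w => g.eval w) (z := c)
    (by fun_prop) (by fun_prop) (by rwa [h.source_eq])
    (fun w hw => h.comm w (by rwa [← h.source_eq])) (by simpa [critSet] using hc)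
  simpa [critSet] using this

lemma IsConjugacy.escapingConj (h : IsConjugacy f g φ) (hf : f.Monic) (hg : g.Monic)
    (hd : 2 ≤ f.natDegree) (hdeg : g.natDegree = f.natDegree)
    (hesc : (critSet f ∩ basin f).Nonempty) : EscapingConj f g φ where
  monic_left := hf
  monic_right := hg
  two_le := hd
  natDegree_eq := hdeg
  isConjugacy := h
  pos_left := maxCrit_pos hf hd hesc
  pos_right := by
    obtain ⟨c, hc, hb⟩ := hesc
    exact maxCrit_pos hg (hdeg ▸ hd) ⟨φ c, h.map_critSet hc hb, h.mapsTo hb⟩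

namespace EscapingConj

lemma two_le' (h : EscapingConj f g φ) : 2 ≤ g.natDegree := h.natDegree_eq ▸ h.two_le

lemma symm (h : EscapingConj f g φ) : EscapingConj g f φ.symm where
  monic_left := h.monic_right
  monic_right := h.monic_left
  two_le := h.two_le'
  natDegree_eq := h.natDegree_eq.symm
  isConjugacy := h.isConjugacy.symm h.monic_left h.two_le
  pos_left := h.pos_right
  pos_right := h.pos_left

lemma bottcher_left (h : EscapingConj f g φ) : IsBottcher f (bottcher f) :=
  isBottcher_bottcher h.monic_left h.two_le h.pos_left

lemma bottcher_right (h : EscapingConj f g φ) : IsBottcher g (bottcher g) :=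
  h.symm.bottcher_left

lemma continuousOn (h : EscapingConj f g φ) : ContinuousOn φ (basin f) := by
  rw [← h.isConjugacy.source_eq]; exact φ.continuousOn

lemma injOn (h : EscapingConj f g φ) : InjOn φ (basin f) := by
  rw [← h.isConjugacy.source_eq]; exact φ.injOn

lemma outer_subset (h : EscapingConj f g φ) : outer f ⊆ basin f :=
  outer_subset_basin h.monic_left h.two_le

end EscapingConj

/-- A continuous function on the line is constant if it is constant on the rational multiples of
`2π` with denominator a power of `d`. -/
lemma eq_of_forall_div_pow {X : Type*} [TopologicalSpace X] [T2Space X] {h : ℝ → X}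
    (hc : Continuous h) {d : ℕ} (hd : 2 ≤ d) {c : X}
    (heq : ∀ (n : ℕ) (j : ℤ), h (2 * Real.pi * j / (d : ℝ) ^ n) = c) (α : ℝ) : h α = c := by
  have hπ := Real.two_pi_pos
  have hlim : Tendsto (fun n : ℕ =>
      2 * Real.pi * (⌊α * (d : ℝ) ^ n / (2 * Real.pi)⌋ : ℤ) / (d : ℝ) ^ n) atTop (𝓝 α) := by
    have h0 : Tendsto (fun n : ℕ => 2 * Real.pi * ((d : ℝ) ^ n)⁻¹) atTop (𝓝 0) := by
      have := (tendsto_pow_atTop_atTop_of_one_lt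
        (show (1 : ℝ) < d by exact_mod_cast (by omega : 1 < d))).inv_tendsto_atTop
      simpa using this.const_mul (2 * Real.pi)
    rw [tendsto_iff_dist_tendsto_zero]
    refine squeeze_zero (fun _ => dist_nonneg) (fun n => ?_) h0
    have hp : (0 : ℝ) < (d : ℝ) ^ n := by positivity
    set x := α * (d : ℝ) ^ n / (2 * Real.pi) with hx
    have hα : α = 2 * Real.pi * x * ((d : ℝ) ^ n)⁻¹ := by rw [hx]; field_simp
    have : 2 * Real.pi * (⌊x⌋ : ℤ) / (d : ℝ) ^ n - α =
        - (2 * Real.pi * ((d : ℝ) ^ n)⁻¹ * (x - ⌊x⌋)) := by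
      rw [hα]; field_simp; ring
    rw [Real.dist_eq, this, abs_neg, abs_of_nonneg
      (mul_nonneg (by positivity) (sub_nonneg.2 (Int.floor_le x)))]
    have h1 : x - ⌊x⌋ ≤ 1 := by linarith [Int.lt_floor_add_one x]
    exact mul_le_of_le_one_right (by positivity) h1
  have h1 := (hc.tendsto α).comp hlim
  have h2 : Tendsto (fun _ : ℕ => c) atTop (𝓝 (h α)) := h1.congr fun n => heq n _
  exact tendsto_nhds_unique h2 tendsto_const_nhds |>.symm ▸ rfl

/-- In the Böttcher coordinate `fⁿ` is the power `dⁿ`, which kills rotations by `2πj / dⁿ`. This is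
the source of the rigidity of conjugacies. -/
lemma iter_inverse_rotate {ψ b : ℂ → ℂ} (hb : IsBottcher f b) (hf : f.Monic)
    (hd : 2 ≤ f.natDegree) (hψ : ∀ ζ ∈ halfPlane (maxCrit f), ψ ζ ∈ outer f ∧
      b (ψ ζ) = Complex.exp ζ ∧ green f (ψ ζ) = ζ.re) {ζ : ℂ} (hζ : ζ ∈ halfPlane (maxCrit f))
    (n : ℕ) (j : ℤ) :
    iter f n (ψ (ζ + (2 * Real.pi * j / (f.natDegree : ℝ) ^ n : ℝ) * Complex.I)) =
      iter f n (ψ ζ) := by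
  have hζ' : ζ + (2 * Real.pi * j / (f.natDegree : ℝ) ^ n : ℝ) * Complex.I ∈
      halfPlane (maxCrit f) := by
    rw [mem_halfPlane, Complex.add_re, Complex.re_ofReal_mul, Complex.I_re, mul_zero, add_zero]
    exact hζ
  refine hb.bijOn.injOn (iter_mem_outer hf hd (hψ _ hζ').1 n) (iter_mem_outer hf hd (hψ _ hζ).1 n) ?_
  rw [hb.iter_eq hf hd (hψ _ hζ').1, hb.iter_eq hf hd (hψ _ hζ).1, (hψ _ hζ').2.1, (hψ _ hζ).2.1,
    ← Complex.exp_nat_mul, ← Complex.exp_nat_mul, Complex.exp_eq_exp_iff_exists_int]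
  refine ⟨j, ?_⟩
  have : (f.natDegree : ℂ) ≠ 0 := by exact_mod_cast (by omega : f.natDegree ≠ 0)
  push_cast
  field_simp

lemma add_mul_I_mem_halfPlane {T : ℝ} {ζ : ℂ} (hζ : ζ ∈ halfPlane T) (α : ℝ) :
    ζ + α * Complex.I ∈ halfPlane T := by
  rw [mem_halfPlane, Complex.add_re, Complex.re_ofReal_mul, Complex.I_re, mul_zero, add_zero]
  exact hζ

lemma ofReal_mem_halfPlane {T t : ℝ} : (t : ℂ) ∈ halfPlane T ↔ T < t := by
  rw [mem_halfPlane, Complex.ofReal_re]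

/-! ### Existence of the stretching part. -/

namespace EscapingConj

/-- Rotated points with a common `fⁿ`-image have `φ`-images with a common `gⁿ`-image, hence equal
`G_g`. Density extends this to every rotation, and rotations act transitively on each level curve of
`G_f` above `M(f)`. -/
lemma green_map_eq_of_outer (h : EscapingConj f g φ) {z₁ z₂ : ℂ} (h1 : z₁ ∈ outer f)
    (h2 : z₂ ∈ outer f) (heq : green f z₁ = green f z₂) : green g (φ z₁) = green g (φ z₂) := by
  have hb := h.bottcher_left
  obtain ⟨ψ, hψc, hψ, hψs⟩ := hb.exists_inverse h.monic_left h.two_le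
  obtain ⟨hl1, hs1⟩ := hψs z₁ h1
  obtain ⟨hl2, hs2⟩ := hψs z₂ h2
  set ζ₁ := Complex.log (bottcher f z₁)
  set ζ₂ := Complex.log (bottcher f z₂)
  have hmem := fun α : ℝ => add_mul_I_mem_halfPlane hl1 α
  have hcont : Continuous fun α : ℝ => green g (φ (ψ (ζ₁ + α * Complex.I))) := by
    refine (continuous_green h.monic_right h.two_le').comp ?_
    exact h.continuousOn.comp_continuous (hψc.comp_continuous (by fun_prop) hmem)
      fun α => h.outer_subset (hψ _ (hmem α)).1
  have hconst := eq_of_forall_div_pow hcont h.two_le (c := green g (φ z₁)) (fun n j => by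
    have h3 := iter_inverse_rotate hb h.monic_left h.two_le hψ hl1 n j
    have h4 := congrArg (fun w => green g (φ w)) h3
    rw [h.isConjugacy.iter_eq h.monic_left h.two_le (h.outer_subset (hψ _ (hmem _)).1),
      h.isConjugacy.iter_eq h.monic_left h.two_le (h.outer_subset (hψ _ hl1).1), hs1,
      green_iter h.monic_right h.two_le', green_iter h.monic_right h.two_le'] at h4
    have := h.two_le'
    exact mul_left_cancel₀ (by positivity) h4) (ζ₂.im - ζ₁.im)
  have hζ : ζ₁ + ((ζ₂.im - ζ₁.im : ℝ) : ℂ) * Complex.I = ζ₂ := by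
    have hre : ζ₁.re = ζ₂.re := by
      rw [← (hψ _ hl1).2.2, ← (hψ _ hl2).2.2, hs1, hs2, heq]
    apply Complex.ext <;> simp [hre]
  rw [hζ, hs2] at hconst
  exact hconst.symm

lemma green_map_eq (h : EscapingConj f g φ) {z₁ z₂ : ℂ} (h1 : z₁ ∈ basin f)
    (h2 : z₂ ∈ basin f) (heq : green f z₁ = green f z₂) : green g (φ z₁) = green g (φ z₂) := by
  obtain ⟨n, hn⟩ := exists_iter_mem_outer h.monic_left h.two_le h1
  have hn' : iter f n z₂ ∈ outer f := by
    rw [outer, mem_ofPred_eq, green_iter h.monic_left h.two_le] at hn ⊢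
    rwa [← heq]
  have := h.green_map_eq_of_outer hn hn' (by
    rw [green_iter h.monic_left h.two_le, green_iter h.monic_left h.two_le, heq])
  rw [h.isConjugacy.iter_eq h.monic_left h.two_le h1, h.isConjugacy.iter_eq h.monic_left h.two_le h2,
      green_iter h.monic_right h.two_le', green_iter h.monic_right h.two_le'] at this
  have h2 := h.two_le'
  exact mul_left_cancel₀ (show (g.natDegree : ℝ) ^ n ≠ 0 by positivity) this

lemma exists_isStretchingPart (h : EscapingConj f g φ) : ∃ S, IsStretchingPart f g φ S := by
  classical
  -- The default `1` only keeps `S` positive; every positive level is in fact attained.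
  refine ⟨fun t => if ht : ∃ z ∈ basin f, green f z = t then green g (φ ht.choose) else 1,
    fun t _ => ?_, fun z hz => ?_⟩
  · by_cases ht : ∃ z ∈ basin f, green f z = t
    · simp only [dif_pos ht]
      exact (mem_basin_iff h.monic_right h.two_le').1 (h.isConjugacy.mapsTo ht.choose_spec.1)
    · simp only [dif_neg ht]; exact mem_Ioi.2 one_pos
  · have ht : ∃ w ∈ basin f, green f w = green f z := ⟨z, hz, rfl⟩
    simp only [dif_pos ht]
    exact h.green_map_eq ht.choose_spec.1 hz ht.choose_spec.2

/-- The level `dⁿ t` is attained in the Böttcher coordinate for large `n`, and the polynomial `fⁿ`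
is surjective. -/
lemma exists_green_eq (h : EscapingConj f g φ) {t : ℝ} (ht : 0 < t) :
    ∃ z ∈ basin f, green f z = t := by
  obtain ⟨ψ, -, hψ, -⟩ := h.bottcher_left.exists_inverse h.monic_left h.two_le
  obtain ⟨n, hn⟩ := exists_lt_pow_mul h.two_le ht (maxCrit f)
  obtain ⟨z, hz⟩ := ((iterPoly f n).isOpenQuotientMap_eval (by
    rw [natDegree_iterPoly]; have := h.two_le; positivity)).surjective
    (ψ (((f.natDegree : ℝ) ^ n * t : ℝ) : ℂ))
  dsimp only at hz
  rw [eval_iterPoly] at hz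
  have hG := (hψ _ (ofReal_mem_halfPlane.2 hn)).2.2
  rw [← hz, green_iter h.monic_left h.two_le, Complex.ofReal_re] at hG
  have hzt : green f z = t := by
    have := h.two_le
    exact mul_left_cancel₀ (by positivity) hG
  exact ⟨z, (mem_basin_iff h.monic_left h.two_le).2 (hzt ▸ ht), hzt⟩

/-! ### Scaling, continuity and monotonicity of the stretching part. -/

variable {S : ℝ → ℝ}

lemma stretch_pow_mul (h : EscapingConj f g φ) (hS : IsStretchingPart f g φ S) (n : ℕ) {t : ℝ}
    (ht : 0 < t) : S ((f.natDegree : ℝ) ^ n * t) = (f.natDegree : ℝ) ^ n * S t := by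
  obtain ⟨z, hz, rfl⟩ := h.exists_green_eq ht
  rw [hS.2 z hz, ← green_iter h.monic_left h.two_le,
    hS.2 _ ((iter_mem_basin h.monic_left h.two_le n).2 hz),
    h.isConjugacy.iter_eq h.monic_left h.two_le hz, green_iter h.monic_right h.two_le', h.natDegree_eq]

/-- Above `M(f)`, `S` is `G_g ∘ φ` along the ray of angle zero; the scaling relation carries
continuity down to all of `(0, ∞)`. -/
lemma continuousOn_stretch (h : EscapingConj f g φ) (hS : IsStretchingPart f g φ S) :
    ContinuousOn S (Ioi 0) := by
  obtain ⟨ψ, hψc, hψ, -⟩ := h.bottcher_left.exists_inverse h.monic_left h.two_le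
  have h1 : ContinuousOn S (Ioi (maxCrit f)) := by
    have h2 : ContinuousOn (fun t : ℝ => green g (φ (ψ t))) (Ioi (maxCrit f)) := by
      refine (continuous_green h.monic_right h.two_le').comp_continuousOn ?_
      refine h.continuousOn.comp (hψc.comp Complex.continuous_ofReal.continuousOn ?_) ?_
      · exact fun t ht => ofReal_mem_halfPlane.2 ht
      · exact fun t ht => h.outer_subset (hψ _ (ofReal_mem_halfPlane.2 ht)).1
    refine h2.congr fun t ht => ?_
    have h3 := hψ _ (ofReal_mem_halfPlane.2 ht)
    have h4 := hS.2 _ (h.outer_subset h3.1)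
    rwa [h3.2.2, Complex.ofReal_re] at h4
  intro t ht
  obtain ⟨n, hn⟩ := exists_lt_pow_mul h.two_le ht (maxCrit f)
  have hp : (0 : ℝ) < (f.natDegree : ℝ) ^ n := by have := h.two_le; positivity
  have h2 : ContinuousAt (fun s : ℝ => ((f.natDegree : ℝ) ^ n)⁻¹ * S ((f.natDegree : ℝ) ^ n * s))
      t := by
    refine continuousAt_const.mul ?_
    exact ContinuousAt.comp (f := fun s : ℝ => (f.natDegree : ℝ) ^ n * s)
      (h1.continuousAt (Ioi_mem_nhds hn)) (by fun_prop)
  refine (h2.congr ?_).continuousWithinAt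
  filter_upwards [Ioi_mem_nhds (show 0 < t from ht)] with s hs
  rw [h.stretch_pow_mul hS n hs, inv_mul_cancel_left₀ hp.ne']

lemma stretch_symm_stretch (h : EscapingConj f g φ) (hS : IsStretchingPart f g φ S) {S' : ℝ → ℝ}
    (hS' : IsStretchingPart g f φ.symm S') {t : ℝ} (ht : 0 < t) : S' (S t) = t := by
  obtain ⟨z, hz, rfl⟩ := h.exists_green_eq ht
  rw [hS.2 z hz, hS'.2 _ (h.isConjugacy.mapsTo hz), φ.left_inv (by rwa [h.isConjugacy.source_eq])]

/-- The stretching part of the inverse conjugacy makes `S` injective, hence strictly monotone on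
intervals by continuity. The identity `S(dⁿ a) = dⁿ S(a)` with positive values rules out a
decreasing `S`. -/
lemma strictMonoOn_stretch (h : EscapingConj f g φ) (hS : IsStretchingPart f g φ S) :
    StrictMonoOn S (Ioi 0) := by
  obtain ⟨S', hS'⟩ := h.symm.exists_isStretchingPart
  have hinj : InjOn S (Ioi 0) := fun a ha b hb hab => by
    rw [← h.stretch_symm_stretch hS hS' ha, ← h.stretch_symm_stretch hS hS' hb, hab]
  intro a ha b hb hab
  have ha' : 0 < a := ha
  obtain ⟨n, hn⟩ := exists_lt_pow_mul h.two_le ha' b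
  set c := (f.natDegree : ℝ) ^ n * a with hc
  have hsub : Icc a c ⊆ Ioi 0 := fun x hx => lt_of_lt_of_le ha' hx.1
  have hac : a < c := hab.trans hn
  rcases ((h.continuousOn_stretch hS).mono hsub).strictMonoOn_of_injOn_Icc' hac.le
    (hinj.mono hsub) with hm | hm
  · exact hm ⟨le_rfl, hac.le⟩ ⟨hab.le, hn.le⟩ hab
  · have h1 := hm ⟨le_rfl, hac.le⟩ ⟨hac.le, le_rfl⟩ hac
    rw [hc, h.stretch_pow_mul hS n ha'] at h1
    have h2 : 0 < S a := hS.1 ha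
    have h3 : (1 : ℝ) < (f.natDegree : ℝ) ^ n := by
      by_contra h4
      push Not at h4
      nlinarith
    nlinarith

lemma stretch_maxCrit_le (h : EscapingConj f g φ) (hS : IsStretchingPart f g φ S) :
    S (maxCrit f) ≤ maxCrit g := by
  -- The supremum of the empty set is `0`, which positivity of `maxCrit f` excludes.
  have hne : (critSet f).Nonempty := by
    by_contra hne
    rw [not_nonempty_iff_eq_empty] at hne
    have := h.pos_left
    simp [maxCrit, hne] at this
  obtain ⟨c, hc, hcM⟩ := exists_green_eq_maxCrit h.two_le hne
  have hcb : c ∈ basin f := (mem_basin_iff h.monic_left h.two_le).2 (hcM ▸ h.pos_left)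
  rw [← hcM, hS.2 c hcb]
  exact green_le_maxCrit h.two_le' (h.isConjugacy.map_critSet hc hcb)

/-- Conjugacies send escaping critical points to critical points, in both directions. Therefore `φ`
maps `{G_f > M(f)}` into `{G_g > M(g)}`, where `bottcher g` is under control. -/
lemma stretch_maxCrit (h : EscapingConj f g φ) (hS : IsStretchingPart f g φ S) :
    S (maxCrit f) = maxCrit g := by
  refine le_antisymm (h.stretch_maxCrit_le hS) ?_
  obtain ⟨S', hS'⟩ := h.symm.exists_isStretchingPart
  have h1 := h.symm.stretch_maxCrit_le hS'
  have hS'' : IsStretchingPart f g φ.symm.symm S := by rwa [φ.symm_symm]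
  rw [← h.symm.stretch_symm_stretch hS' hS'' h.pos_right]
  exact (h.strictMonoOn_stretch hS).monotoneOn (hS'.1 h.pos_right) h.pos_left h1

lemma map_mem_outer (h : EscapingConj f g φ) {z : ℂ} (hz : z ∈ outer f) : φ z ∈ outer g := by
  obtain ⟨S, hS⟩ := h.exists_isStretchingPart
  have hb := h.outer_subset hz
  rw [outer, mem_ofPred_eq, ← h.stretch_maxCrit hS, ← hS.2 z hb]
  exact h.strictMonoOn_stretch hS h.pos_left ((mem_basin_iff h.monic_left h.two_le).1 hb) hz

end EscapingConj

end Conj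

end PolyBasin

namespace PolyBasin

/-! ### The conjugacy in Böttcher coordinates -/

/-- `F` and a constant function are lifts of the constant `1` through `exp`. -/
lemma eq_of_exp_eq_one {F : ℂ → ℂ} {T : ℝ} (hF : ContinuousOn F (halfPlane T))
    (h : ∀ ζ ∈ halfPlane T, Complex.exp (F ζ) = 1) {ζ₁ ζ₂ : ℂ} (h1 : ζ₁ ∈ halfPlane T)
    (h2 : ζ₂ ∈ halfPlane T) : F ζ₁ = F ζ₂ :=
  eqOn_lift Complex.isCoveringMapOn_exp (k := fun _ => 1) (F₂ := fun _ => F ζ₂)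
    (fun _ _ => by simp) hF continuousOn_const h (fun _ _ => h _ h2) h2 rfl h1

/-- A continuous function on a half-plane whose increments along the vertical rotations by rational
angles with denominators powers of `d` are locally constant is affine in the imaginary part. -/
lemma exists_slope {θ : ℂ → ℂ} {T : ℝ} {d : ℕ} (hd : 2 ≤ d) (hθ : ContinuousOn θ (halfPlane T))
    (h : ∀ (n : ℕ) (j : ℤ), ∀ ζ ∈ halfPlane T,
      Complex.exp ((d : ℂ) ^ n *
        (θ (ζ + (2 * Real.pi * j / (d : ℝ) ^ n : ℝ) * Complex.I) - θ ζ)) = 1) :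
    ∃ c : ℂ, ∀ ζ ∈ halfPlane T, ∀ α : ℝ, θ (ζ + α * Complex.I) - θ ζ = α * c := by
  have hshift : ∀ α : ℝ, ContinuousOn (fun ζ : ℂ => θ (ζ + α * Complex.I) - θ ζ) (halfPlane T) :=
    fun α => (hθ.comp (by fun_prop) fun ζ hζ => add_mul_I_mem_halfPlane hζ α).sub hθ
  have hvert : ∀ ζ ∈ halfPlane T, Continuous fun α : ℝ => θ (ζ + α * Complex.I) - θ ζ :=
    fun ζ hζ => (hθ.comp_continuous (by fun_prop) (add_mul_I_mem_halfPlane hζ)).sub continuous_const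
  -- For rational angles with denominator `dⁿ` the increment takes values in a discrete set, so it
  -- is independent of the base point; density extends this to all angles.
  have hconst : ∀ ζ₁ ∈ halfPlane T, ∀ ζ₂ ∈ halfPlane T, ∀ α : ℝ,
      θ (ζ₁ + α * Complex.I) - θ ζ₁ = θ (ζ₂ + α * Complex.I) - θ ζ₂ := by
    intro ζ₁ h1 ζ₂ h2 α
    refine sub_eq_zero.1 (eq_of_forall_div_pow ((hvert ζ₁ h1).sub (hvert ζ₂ h2)) hd (c := 0)
      (fun n j => ?_) α)
    have h3 := eq_of_exp_eq_one (continuousOn_const.mul (hshift _)) (h n j) h1 h2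
    have hd0 : (d : ℂ) ^ n ≠ 0 := pow_ne_zero _ (by exact_mod_cast (by omega : d ≠ 0))
    exact sub_eq_zero.2 (mul_left_cancel₀ hd0 h3)
  obtain ⟨a, ha⟩ := nonempty_halfPlane T
  -- Independence of the base point makes the increment additive in the angle, and a continuous
  -- additive map on the line is linear.
  let c : ℝ →+ ℂ := AddMonoidHom.mk' (fun α => θ (a + α * Complex.I) - θ a) fun α β => by
    have := hconst _ (add_mul_I_mem_halfPlane ha α) a ha β
    rw [← this]
    have h2 : a + ((α + β : ℝ) : ℂ) * Complex.I = a + α * Complex.I + β * Complex.I := by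
      push_cast; ring
    rw [h2]; ring
  refine ⟨c 1, fun ζ hζ α => ?_⟩
  rw [hconst ζ hζ a ha α]
  have := map_real_smul c (hvert a ha) α 1
  rw [smul_eq_mul, mul_one] at this
  change c α = _
  rw [this, Complex.real_smul]

variable {f g : ℂ[X]} {φ : OpenPartialHomeomorph ℂ ℂ}

namespace EscapingConj

/-- In Böttcher coordinates a conjugacy is a radial map followed by rotations depending only on the
radius, up to a reflection. -/
lemma exists_angular (h : EscapingConj f g φ) {S : ℝ → ℝ} (hS : IsStretchingPart f g φ S) :
    ∃ (τ : ℝ → ℝ) (m : ℤ) (s : ℝ), (s = 1 ∨ s = -1) ∧ ContinuousOn τ (Ioi (maxCrit f)) ∧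
      (∀ t, maxCrit f < t → τ (f.natDegree * t) = f.natDegree * τ t + 2 * Real.pi * m) ∧
      ∀ z ∈ outer f, bottcher g (φ z) = Complex.exp ((S (green f z) : ℂ) +
        (τ (green f z) + s * Complex.arg (bottcher f z) : ℝ) * Complex.I) := by
  have hf := h.monic_left
  have hd := h.two_le
  have hbf := h.bottcher_left
  have hbg := h.bottcher_right
  obtain ⟨ψ, hψc, hψ, hψs⟩ := hbf.exists_inverse hf hd
  set M := maxCrit f with hM
  set k : ℂ → ℂ := fun ζ => bottcher g (φ (ψ ζ)) with hk
  have hout : ∀ ζ ∈ halfPlane M, φ (ψ ζ) ∈ outer g := fun ζ hζ => h.map_mem_outer (hψ ζ hζ).1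
  have hkc : ContinuousOn k (halfPlane M) :=
    hbg.differentiableOn.continuousOn.comp
      (h.continuousOn.comp hψc fun ζ hζ => h.outer_subset (hψ ζ hζ).1) hout
  obtain ⟨θ, hθc, hθ⟩ := Complex.exists_continuousOn_eqOn_exp_comp (isSimplyConnected_halfPlane M)
    (isOpen_halfPlane M) hkc (by rintro ⟨ζ, hζ, h0⟩; exact hbg.ne_zero (hout ζ hζ) h0)
  have hθ' : ∀ ζ ∈ halfPlane M, Complex.exp (θ ζ) = k ζ := fun ζ hζ => hθ hζ
  have hkpow : ∀ (n : ℕ), ∀ ζ ∈ halfPlane M,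
      k ζ ^ f.natDegree ^ n = bottcher g (φ (iter f n (ψ ζ))) := fun n ζ hζ => by
    rw [h.isConjugacy.iter_eq hf hd (h.outer_subset (hψ ζ hζ).1),
      hbg.iter_eq h.monic_right h.two_le' (hout ζ hζ), h.natDegree_eq]
  have hinj : ∀ ζ₁ ∈ halfPlane M, ∀ ζ₂ ∈ halfPlane M, k ζ₁ = k ζ₂ →
      Complex.exp ζ₁ = Complex.exp ζ₂ := fun ζ₁ h1 ζ₂ h2 h12 => by
    have h3 := hbg.bijOn.injOn (hout _ h1) (hout _ h2) h12
    have h4 := h.injOn (h.outer_subset (hψ _ h1).1) (h.outer_subset (hψ _ h2).1) h3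
    rw [← (hψ _ h1).2.1, ← (hψ _ h2).2.1, h4]
  obtain ⟨c, hc⟩ := exists_slope hd hθc (fun n j ζ hζ => by
    rw [mul_sub, Complex.exp_sub, div_eq_one_iff_eq (Complex.exp_ne_zero _)]
    have hcast : (f.natDegree : ℂ) ^ n = ((f.natDegree ^ n : ℕ) : ℂ) := by push_cast; rfl
    rw [hcast, Complex.exp_nat_mul, Complex.exp_nat_mul, hθ' _ (add_mul_I_mem_halfPlane hζ _),
      hθ' _ hζ, hkpow n _ (add_mul_I_mem_halfPlane hζ _), hkpow n _ hζ,
      iter_inverse_rotate hbf hf hd hψ hζ n j])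
  have hper : ∀ ζ₁ ∈ halfPlane M, ∀ ζ₂ ∈ halfPlane M, Complex.exp ζ₁ = Complex.exp ζ₂ →
      k ζ₁ = k ζ₂ := fun ζ₁ h1 ζ₂ h2 h12 => by
    have : ψ ζ₁ = ψ ζ₂ := hbf.bijOn.injOn (hψ _ h1).1 (hψ _ h2).1 (by
      rw [(hψ _ h1).2.1, (hψ _ h2).2.1, h12])
    simp only [hk, this]
  obtain ⟨a, ha⟩ := nonempty_halfPlane M
  -- A full turn is invisible to `k`, so it changes `θ` by a multiple of `2πi`.
  obtain ⟨j, hj⟩ : ∃ j : ℤ, c = j * Complex.I := by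
    have h1 := hc a ha (2 * Real.pi)
    have h2 : Complex.exp (θ (a + (2 * Real.pi : ℝ) * Complex.I)) = Complex.exp (θ a) := by
      rw [hθ' _ (add_mul_I_mem_halfPlane ha _), hθ' _ ha]
      refine hper _ (add_mul_I_mem_halfPlane ha _) _ ha ?_
      push_cast
      rw [Complex.exp_add, Complex.exp_two_pi_mul_I, mul_one]
    rw [Complex.exp_eq_exp_iff_exists_int] at h2
    obtain ⟨j, hj⟩ := h2
    refine ⟨j, ?_⟩
    rw [hj, add_sub_cancel_left] at h1
    have hπ : (2 * Real.pi : ℂ) ≠ 0 := by exact_mod_cast Real.two_pi_pos.ne'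
    push_cast at h1
    refine mul_left_cancel₀ hπ ?_
    rw [← h1]; ring
  -- By injectivity, a rotation by `β` with `jβ ∈ 2πℤ` is trivial. Taking `β = π` excludes `j = 0`,
  -- and `β = 2π / j` makes `1 / j` an integer.
  have hrot : ∀ β : ℝ, Complex.exp (β * (j * Complex.I)) = 1 → Complex.exp (β * Complex.I) = 1 := by
    intro β hβ
    have h1 := hc a ha β
    have h2 : k (a + β * Complex.I) = k a := by
      rw [← hθ' _ (add_mul_I_mem_halfPlane ha _), ← hθ' _ ha, sub_eq_iff_eq_add.1 h1, hj,
        Complex.exp_add, hβ, one_mul]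
    have h3 := hinj _ (add_mul_I_mem_halfPlane ha _) _ ha h2
    rwa [Complex.exp_add, mul_eq_left₀ (Complex.exp_ne_zero a)] at h3
  have hj1 : (j : ℝ) = 1 ∨ (j : ℝ) = -1 := by
    have hj0 : j ≠ 0 := by
      rintro rfl
      have := hrot Real.pi (by simp)
      rw [Complex.exp_pi_mul_I] at this
      norm_num at this
    have hjC : (j : ℂ) ≠ 0 := by exact_mod_cast hj0
    have h1 := hrot (2 * Real.pi / j) (by
      have : ((2 * Real.pi / j : ℝ) : ℂ) * (j * Complex.I) = 2 * Real.pi * Complex.I := by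
        push_cast; field_simp
      rw [this, Complex.exp_two_pi_mul_I])
    rw [Complex.exp_eq_one_iff] at h1
    obtain ⟨n, hn⟩ := h1
    push_cast at hn
    have hπ : (2 * Real.pi * Complex.I : ℂ) ≠ 0 :=
      mul_ne_zero (by exact_mod_cast Real.two_pi_pos.ne') Complex.I_ne_zero
    have h2 : (1 : ℂ) = n * j := by
      refine mul_left_cancel₀ hπ ?_
      field_simp at hn
      linear_combination (2 * Real.pi * Complex.I) * hn
    have h3 : n * j = 1 := by exact_mod_cast h2.symm
    rcases Int.isUnit_iff.1 (IsUnit.of_mul_eq_one_right n h3) with h4 | h4 <;> simp [h4]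
  have hdmem : MapsTo (fun ζ : ℂ => (f.natDegree : ℂ) * ζ) (halfPlane M) (halfPlane M) :=
    fun ζ hζ => natCast_mul_mem_halfPlane hd h.pos_left.le hζ
  have hfun : ∀ ζ ∈ halfPlane M, Complex.exp (θ (f.natDegree * ζ) - f.natDegree * θ ζ) = 1 := by
    intro ζ hζ
    rw [Complex.exp_sub, div_eq_one_iff_eq (Complex.exp_ne_zero _), Complex.exp_nat_mul, hθ' _ hζ,
      hθ' _ (hdmem hζ)]
    have h1 := hkpow 1 ζ hζ
    rw [pow_one, iter_one] at h1
    rw [h1]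
    simp only [hk]
    congr 2
    refine hbf.bijOn.injOn (hψ _ (hdmem hζ)).1 (iter_mem_outer hf hd (hψ ζ hζ).1 1) ?_
    rw [hbf.semiconj _ (hψ ζ hζ).1, (hψ _ hζ).2.1, (hψ _ (hdmem hζ)).2.1,
      Complex.exp_nat_mul]
  -- The defect in the functional equation is continuous with values in `2πiℤ`, hence constant.
  obtain ⟨m, hm⟩ : ∃ m : ℤ, ∀ ζ ∈ halfPlane M,
      θ (f.natDegree * ζ) - f.natDegree * θ ζ = m * (2 * Real.pi * Complex.I) := by
    obtain ⟨m, hm⟩ := Complex.exp_eq_one_iff.1 (hfun a ha)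
    refine ⟨m, fun ζ hζ => ?_⟩
    rw [← hm]
    exact eq_of_exp_eq_one (F := fun ζ => θ (f.natDegree * ζ) - f.natDegree * θ ζ)
      ((hθc.comp (by fun_prop) hdmem).sub (continuousOn_const.mul hθc)) hfun hζ ha
  refine ⟨fun t => (θ t).im, m, j, hj1, ?_, ?_, ?_⟩
  · exact Complex.continuous_im.comp_continuousOn
      (hθc.comp Complex.continuous_ofReal.continuousOn fun t ht => ofReal_mem_halfPlane.2 ht)
  · intro t ht
    have h1 := congrArg Complex.im (hm t (ofReal_mem_halfPlane.2 ht))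
    have h2 : ((m : ℂ) * (2 * Real.pi * Complex.I)).im = 2 * Real.pi * m := by
      have : ((m : ℂ) * (2 * Real.pi * Complex.I)) = ((2 * Real.pi * m : ℝ) : ℂ) * Complex.I := by
        push_cast; ring
      rw [this, Complex.im_ofReal_mul, Complex.I_im, mul_one]
    rw [h2, Complex.sub_im] at h1
    have h3 : ((f.natDegree : ℂ) * θ t).im = f.natDegree * (θ t).im := by simp
    rw [h3] at h1
    push_cast
    linarith
  · intro z hz
    obtain ⟨hl, hs⟩ := hψs z hz
    set ζ := Complex.log (bottcher f z) with hζ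
    have hζG : ζ.re = green f z := by rw [← (hψ ζ hl).2.2, hs]
    have ht : ((ζ.re : ℝ) : ℂ) ∈ halfPlane M := ofReal_mem_halfPlane.2 hl
    have h1 := hc _ ht ζ.im
    rw [Complex.re_add_im, hj] at h1
    have hSre : (θ ζ.re).re = S ζ.re := by
      have h2 : ‖k ζ.re‖ = Real.exp (S ζ.re) := by
        have h3 := hbg.norm_eq h.monic_right h.two_le' (hout _ ht)
        rw [← hS.2 _ (h.outer_subset (hψ _ ht).1), (hψ _ ht).2.2, Complex.ofReal_re] at h3
        exact h3
      rwa [← hθ' _ ht, Complex.norm_exp, Real.exp_eq_exp] at h2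
    have h4 : bottcher g (φ z) = Complex.exp (θ ζ) := by rw [hθ' _ hl]; simp only [hk, hs]
    rw [h4, sub_eq_iff_eq_add.1 h1, ← hζG, ← hSre]
    congr 1
    have h5 : Complex.arg (bottcher f z) = ζ.im := by rw [hζ, Complex.log_im]
    rw [h5]
    conv_lhs => rw [← Complex.re_add_im (θ ζ.re)]
    push_cast
    ring

/-- The conjugacy relation in Böttcher coordinates, in multiplicative form. -/
lemma twist_of_angular (h : EscapingConj f g φ) {S τ : ℝ → ℝ} {z : ℂ} (hz : z ∈ outer f)
    (ha : bottcher g (φ z) = Complex.exp ((S (green f z) : ℂ) +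
      (τ (green f z) + Complex.arg (bottcher f z) : ℝ) * Complex.I)) :
    bottcher g (φ z) = bottcher f z *
      Complex.exp (((S (green f z) - green f z : ℝ) : ℂ) + τ (green f z) * Complex.I) := by
  have hb := h.bottcher_left
  rw [ha]
  conv_rhs => rw [← Complex.norm_mul_exp_arg_mul_I (bottcher f z),
    hb.norm_eq h.monic_left h.two_le hz, Complex.ofReal_exp, ← Complex.exp_add, ← Complex.exp_add]
  congr 1
  push_cast; ring

lemma conj_twist_of_angular (h : EscapingConj f g φ) {S τ : ℝ → ℝ} {z : ℂ} (hz : z ∈ outer f)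
    (ha : bottcher g (φ z) = Complex.exp ((S (green f z) : ℂ) +
      (τ (green f z) + (-1) * Complex.arg (bottcher f z) : ℝ) * Complex.I)) :
    bottcher g (φ z) = conj (bottcher f z) *
      Complex.exp (((S (green f z) - green f z : ℝ) : ℂ) + τ (green f z) * Complex.I) := by
  have hb := h.bottcher_left
  rw [ha]
  conv_rhs => rw [← Complex.norm_mul_exp_arg_mul_I (bottcher f z),
    hb.norm_eq h.monic_left h.two_le hz, Complex.ofReal_exp, ← Complex.exp_add, ← Complex.exp_conj,
    ← Complex.exp_add]
  congr 1
  simp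
  ring

/-- The stretching part gives the modulus and the turning part gives the angle modulo `2π`. The
twist formula thus holds for an arbitrary turning part, not only for the one constructed. -/
lemma angular_of_isTurningPart (h : EscapingConj f g φ) {S T : ℝ → ℝ}
    (hS : IsStretchingPart f g φ S) (hT : IsTurningPart f g φ T) {z : ℂ} (hz : z ∈ outer f) :
    bottcher g (φ z) = Complex.exp ((S (green f z) : ℂ) +
      (T (green f z) + Complex.arg (bottcher f z) : ℝ) * Complex.I) := by
  have h1 := hT.angle_eq z hz
  rw [eq_sub_iff_add_eq, ← Real.Angle.coe_add, Real.Angle.angle_eq_iff_two_pi_dvd_sub] at h1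
  obtain ⟨n, hn⟩ := h1
  have h2 := h.bottcher_right.norm_eq h.monic_right h.two_le' (h.map_mem_outer hz)
  rw [← hS.2 z (h.outer_subset hz)] at h2
  conv_lhs => rw [← Complex.norm_mul_exp_arg_mul_I (bottcher g (φ z)), h2, Complex.ofReal_exp,
    ← Complex.exp_add]
  rw [Complex.exp_eq_exp_iff_exists_int]
  refine ⟨-n, ?_⟩
  rw [sub_eq_iff_eq_add.1 hn]
  push_cast; ring

/-- Extension of the angular function to `(0, ∞)` by its functional equation. -/
lemma exists_isTurningPart (h : EscapingConj f g φ) {S τ : ℝ → ℝ} {m : ℤ}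
    (hτ : ContinuousOn τ (Ioi (maxCrit f)))
    (hm : ∀ t, maxCrit f < t → τ (f.natDegree * t) = f.natDegree * τ t + 2 * Real.pi * m)
    (ha : ∀ z ∈ outer f, bottcher g (φ z) = Complex.exp ((S (green f z) : ℂ) +
      (τ (green f z) + Complex.arg (bottcher f z) : ℝ) * Complex.I)) :
    ∃ T, IsTurningPart f g φ T := by
  have hd := h.two_le
  have hd2 : (2 : ℝ) ≤ f.natDegree := by exact_mod_cast hd
  set d : ℝ := (f.natDegree : ℝ) with hdd
  set M := maxCrit f with hM
  have hMpos : 0 < M := h.pos_left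
  -- This constant solves `dA - A = 2πm`, so `τ + A` is exactly homogeneous under `t ↦ d t`.
  set A : ℝ := 2 * Real.pi * m / (d - 1) with hA
  have hd1 : d - 1 ≠ 0 := by linarith
  have hκ : ∀ t, M < t → τ (d * t) + A = d * (τ t + A) := fun t ht => by
    rw [hm t ht, hA]; field_simp; ring
  have hpowpos : ∀ n : ℕ, 0 < d ^ n := fun n => by positivity
  have hκ' : ∀ (n : ℕ) (t : ℝ), M < t → τ (d ^ n * t) + A = d ^ n * (τ t + A) := by
    intro n
    induction n with
    | zero => intro t _; simp
    | succ n ih =>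
      intro t ht
      have h1 : M < d * t := by nlinarith
      have : d ^ (n + 1) * t = d ^ n * (d * t) := by ring
      rw [this, ih _ h1, hκ t ht]; ring
  have hex : ∀ t : ℝ, 0 < t → ∃ n : ℕ, M < d ^ n * t := fun t ht => exists_lt_pow_mul hd ht M
  choose! N hN using hex
  -- By homogeneity the value is the same for every exponent that brings `t` above `M`; locally one
  -- exponent can be fixed, which gives continuity.
  set T : ℝ → ℝ := fun t => (d ^ N t)⁻¹ * (τ (d ^ N t * t) + A) - A with hT
  have hTn : ∀ (t : ℝ), 0 < t → ∀ n : ℕ, M < d ^ n * t →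
      T t = (d ^ n)⁻¹ * (τ (d ^ n * t) + A) - A := by
    intro t ht n hn
    have key : ∀ a b : ℕ, a ≤ b → M < d ^ a * t →
        (d ^ a)⁻¹ * (τ (d ^ a * t) + A) = (d ^ b)⁻¹ * (τ (d ^ b * t) + A) := by
      intro a b hab hMa
      obtain ⟨e, rfl⟩ := Nat.exists_eq_add_of_le hab
      have : d ^ (a + e) * t = d ^ e * (d ^ a * t) := by rw [pow_add]; ring
      rw [this, hκ' e _ hMa, pow_add]
      have := hpowpos e
      have := hpowpos a
      field_simp
    simp only [hT]
    rcases le_total n (N t) with h1 | h1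
    · rw [key _ _ h1 hn]
    · rw [key _ _ h1 (hN t ht)]
  refine ⟨T, ⟨?_, ?_, ⟨m, ?_⟩⟩⟩
  · intro t ht
    have hNt := hN t ht
    have h1 : ContinuousAt (fun s : ℝ => (d ^ N t)⁻¹ * (τ (d ^ N t * s) + A) - A) t := by
      refine (continuousAt_const.mul (ContinuousAt.add ?_ continuousAt_const)).sub continuousAt_const
      exact ContinuousAt.comp (f := fun s : ℝ => d ^ N t * s)
        (hτ.continuousAt (Ioi_mem_nhds hNt)) (by fun_prop)
    refine (h1.congr ?_).continuousWithinAt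
    have h2 : ContinuousAt (fun s : ℝ => d ^ N t * s) t := by fun_prop
    filter_upwards [Ioi_mem_nhds (show 0 < t from ht), h2.eventually (Ioi_mem_nhds hNt)] with s h3 h4
    exact (hTn s h3 _ h4).symm
  · intro z hz
    have hG : M < green f z := hz
    have h1 : T (green f z) = τ (green f z) := by
      rw [hTn _ (hMpos.trans hG) 0 (by simpa using hG)]; simp
    rw [h1, eq_sub_iff_add_eq, ← Real.Angle.coe_add, ha z hz, Complex.exp_add,
      ← Complex.ofReal_exp, Complex.arg_real_mul _ (Real.exp_pos _), Complex.arg_exp_mul_I]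
    exact (Real.Angle.coe_toIocMod _ _).symm
  · intro t ht
    have hdt : 0 < d * t := by positivity
    have h1 := hN _ hdt
    have h2 : d ^ N (d * t) * (d * t) = d ^ (N (d * t) + 1) * t := by ring
    have h3 := hTn t ht (N (d * t) + 1) (by rw [← h2]; exact h1)
    have := hpowpos (N (d * t))
    rw [h3, hTn _ hdt _ h1, h2, pow_succ, hA]
    field_simp
    ring

end EscapingConj

end PolyBasin

namespace PolyBasin

/-! ### Almost everywhere differentiability of the angular function -/

variable {f g : ℂ[X]} {φ : OpenPartialHomeomorph ℂ ℂ}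

/-- The Green function is locally the real part of a holomorphic function. -/
lemma IsBottcher.exists_local_log {b : ℂ → ℂ} (h : IsBottcher f b) (hf : f.Monic)
    (hd : 2 ≤ f.natDegree) {z : ℂ} (hz : z ∈ outer f) :
    ∃ u : ℂ → ℂ, HasStrictDerivAt u (deriv b z / b z) z ∧
      ∀ᶠ w in 𝓝 z, green f w = (u w).re := by
  have h0 := h.ne_zero hz
  -- Dividing by `b z` places the argument of the logarithm near `1`, away from the branch cut.
  refine ⟨fun w => Complex.log (b w / b z) + Complex.log (b z), ?_, ?_⟩
  · have h1 := (h.analyticAt hf hd hz).hasStrictDerivAt.div_const (b z)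
    have h2 := (h1.clog (by rw [div_self h0]; exact Complex.one_mem_slitPlane)).add_const
      (Complex.log (b z))
    rwa [div_self h0, div_one] at h2
  · filter_upwards [(isOpen_outer hf hd).mem_nhds hz] with w hw
    rw [Complex.add_re, Complex.log_re, Complex.log_re, norm_div,
      Real.log_div (norm_ne_zero_iff.2 (h.ne_zero hw)) (norm_ne_zero_iff.2 h0),
      h.green_eq hf hd hw]
    ring

lemma IsBottcher.hasStrictDerivAt_green_comp {b : ℂ → ℂ} (h : IsBottcher f b) (hf : f.Monic)
    (hd : 2 ≤ f.natDegree) {γ : ℝ → ℂ} {v : ℂ} {x : ℝ} (hγ : HasStrictDerivAt γ v x)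
    (hx : γ x ∈ outer f) :
    HasStrictDerivAt (fun s => green f (γ s)) (v * (deriv b (γ x) / b (γ x))).re x := by
  obtain ⟨u, hu, hu'⟩ := h.exists_local_log hf hd hx
  have h1 := (hu.hasStrictFDerivAt.restrictScalars ℝ).comp_hasStrictDerivAt x hγ
  have h2 := Complex.reCLM.hasStrictFDerivAt.comp_hasStrictDerivAt x h1
  have h3 : HasStrictDerivAt (fun s => (u (γ s)).re) (v * (deriv b (γ x) / b (γ x))).re x := by
    have h4 : Complex.reCLM ((ContinuousLinearMap.restrictScalars ℝ (ContinuousLinearMap.toSpanSingleton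
        ℂ (deriv b (γ x) / b (γ x)))) v) = (v * (deriv b (γ x) / b (γ x))).re := by simp
    rwa [h4] at h2
  refine h3.congr_of_eventuallyEq ?_
  filter_upwards [hγ.hasDerivAt.continuousAt.eventually hu'] with s hs using hs.symm

/-- Continuous logarithms of differentiable functions are differentiable. -/
lemma differentiableAt_of_exp {F W : ℝ → ℂ} {x : ℝ} (hF : ContinuousAt F x)
    (hW : DifferentiableAt ℝ W x) (h : ∀ᶠ y in 𝓝 x, Complex.exp (F y) = W y) :
    DifferentiableAt ℝ F x := by
  obtain ⟨l, -, hl, hl1, -⟩ :=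
    exists_local_inverse (Complex.hasStrictDerivAt_exp (F x)) (Complex.exp_ne_zero _)
  rw [h.self_of_nhds] at hl
  refine ((hl.hasDerivAt.hasFDerivAt.restrictScalars ℝ).differentiableAt.comp x
    hW).congr_of_eventuallyEq ?_
  filter_upwards [h, hF.eventually hl1] with y h1 h2
  simp [← h1, h2]

/-- Differentiability descends along a reparametrization with nonzero derivative. -/
lemma differentiableAt_of_comp {e : ℝ → ℂ} {p : ℝ → ℝ} {p' x : ℝ} (hp : HasStrictDerivAt p p' x)
    (h0 : p' ≠ 0) (h : DifferentiableAt ℝ (fun s => e (p s)) x) : DifferentiableAt ℝ e (p x) := by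
  obtain ⟨q, hq0, hq, -, hq2⟩ := exists_local_inverse hp h0
  have h1 : DifferentiableAt ℝ ((fun s => e (p s)) ∘ q) (p x) :=
    DifferentiableAt.comp (p x) (by rwa [hq0]) hq.hasDerivAt.differentiableAt
  refine h1.congr_of_eventuallyEq ?_
  filter_upwards [hq2] with t ht
  simp [ht]

namespace EscapingConj

section Twist

variable {σ : ℂ →L[ℝ] ℂ} {e : ℝ → ℂ}

/-- Along `γ` the function `exp(e ∘ G_f)` is a quotient of differentiable functions, and its
continuous logarithm `e ∘ G_f` is then differentiable. Transversality allows `G_f` to be used as the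
parameter. -/
lemma differentiableAt_of_line (h : EscapingConj f g φ) (hσ : ∀ z, z ≠ 0 → σ z ≠ 0)
    (he : ContinuousOn e (Ioi (maxCrit f)))
    (ht : ∀ z ∈ outer f, bottcher g (φ z) = σ (bottcher f z) * Complex.exp (e (green f z)))
    {γ : ℝ → ℂ} {v : ℂ} {x : ℝ} (hγ : HasStrictDerivAt γ v x) (hx : γ x ∈ outer f)
    (hreg : (v * (deriv (bottcher f) (γ x) / bottcher f (γ x))).re ≠ 0)
    (hφ : DifferentiableAt ℝ (fun s => φ (γ s)) x) : DifferentiableAt ℝ e (green f (γ x)) := by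
  have hbf := h.bottcher_left
  have hp := hbf.hasStrictDerivAt_green_comp h.monic_left h.two_le hγ hx
  refine differentiableAt_of_comp hp hreg ?_
  have hγc := hγ.hasDerivAt.continuousAt
  have hσb := hσ _ (hbf.ne_zero hx)
  have hnum : DifferentiableAt ℝ (fun s => bottcher g (φ (γ s))) x :=
    ((h.bottcher_right.analyticAt h.monic_right h.two_le'
      (h.map_mem_outer hx)).differentiableAt.restrictScalars ℝ).comp x hφ
  have hden : DifferentiableAt ℝ (fun s => σ (bottcher f (γ s))) x :=
    σ.differentiableAt.comp x (((hbf.analyticAt h.monic_left h.two_le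
      hx).differentiableAt.restrictScalars ℝ).comp x hγ.hasDerivAt.differentiableAt)
  refine differentiableAt_of_exp ?_ (hnum.div hden hσb) ?_
  · exact ContinuousAt.comp (f := fun s => green f (γ s)) (he.continuousAt (Ioi_mem_nhds hx))
      hp.hasDerivAt.continuousAt
  · filter_upwards [hγc.preimage_mem_nhds ((isOpen_outer h.monic_left h.two_le).mem_nhds hx)]
      with s hs
    rw [Pi.div_apply, ht _ hs, mul_div_cancel_left₀ _ (hσ _ (hbf.ne_zero hs))]

/-- Exceptional levels are images of exceptional parameters, and `G_f ∘ γ` maps null sets to null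
sets. The sign condition says that the segment crosses the level `t₀`, so its levels fill a
neighbourhood of `t₀`. -/
lemma ae_differentiableAt_of_line (h : EscapingConj f g φ) (hσ : ∀ z, z ≠ 0 → σ z ≠ 0)
    (he : ContinuousOn e (Ioi (maxCrit f)))
    (ht : ∀ z ∈ outer f, bottcher g (φ z) = σ (bottcher f z) * Complex.exp (e (green f z)))
    {γ : ℝ → ℂ} {v : ℂ} (hγ : ∀ x, HasStrictDerivAt γ v x) {x₀ x₁ t₀ : ℝ} (hx : x₀ ≤ x₁)
    (hout : ∀ x ∈ Icc x₀ x₁, γ x ∈ outer f)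
    (hreg : ∀ x ∈ Icc x₀ x₁, (v * (deriv (bottcher f) (γ x) / bottcher f (γ x))).re ≠ 0)
    (hφ : ∀ᵐ x : ℝ, x ∈ Icc x₀ x₁ → DifferentiableAt ℝ (fun s => φ (γ s)) x)
    (hsign : (green f (γ x₀) - t₀) * (green f (γ x₁) - t₀) < 0) :
    ∃ V ∈ 𝓝 t₀, ∀ᵐ t, t ∈ V → DifferentiableAt ℝ e t := by
  set p : ℝ → ℝ := fun s => green f (γ s)
  have hp : ∀ x ∈ Icc x₀ x₁, HasStrictDerivAt p
      (v * (deriv (bottcher f) (γ x) / bottcher f (γ x))).re x := fun x hx =>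
    h.bottcher_left.hasStrictDerivAt_green_comp h.monic_left h.two_le (hγ x) (hout x hx)
  have hpc : ContinuousOn p (Icc x₀ x₁) := fun x hx =>
    (hp x hx).hasDerivAt.continuousAt.continuousWithinAt
  obtain ⟨x, hxI, hxt⟩ : t₀ ∈ p '' Ioo x₀ x₁ := by
    rcases mul_neg_iff.1 hsign with ⟨h1, h2⟩ | ⟨h1, h2⟩
    · exact intermediate_value_Ioo' hx hpc ⟨by linarith, by linarith⟩
    · exact intermediate_value_Ioo hx hpc ⟨by linarith, by linarith⟩
  refine ⟨p '' Ioo x₀ x₁, ?_, ?_⟩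
  · have hxI' := Ioo_subset_Icc_self hxI
    rw [← hxt, ← (hp x hxI').map_nhds_eq (hreg x hxI')]
    exact image_mem_map (Ioo_mem_nhds hxI.1 hxI.2)
  · set N : Set ℝ := {x | ¬ (x ∈ Icc x₀ x₁ → DifferentiableAt ℝ (fun s => φ (γ s)) x)} with hN
    have hN0 : volume N = 0 := hφ
    have hpN : volume (p '' N) = 0 := by
      refine addHaar_image_eq_zero_of_differentiableOn_of_addHaar_eq_zero volume (fun x hx => ?_) hN0
      have hx' : x ∈ Icc x₀ x₁ := by
        by_contra hcon
        exact hx fun h => absurd h hcon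
      exact (hp x hx').hasDerivAt.differentiableAt.differentiableWithinAt
    refine measure_mono_null (fun t htt => ?_) hpN
    rw [mem_compl_iff, mem_ofPred_eq, Classical.not_imp] at htt
    obtain ⟨⟨y, hy, rfl⟩, hnd⟩ := htt
    refine ⟨y, fun hcon => hnd ?_, rfl⟩
    have hy' := Ioo_subset_Icc_self hy
    exact h.differentiableAt_of_line hσ he ht (hγ y) (hout y hy') (hreg y hy') (hcon hy')

/-- Absolute continuity holds only on almost every line and may fail on the one through the given
point. Crossing the level `t₀` transversally is an open condition, so a nearby good line serves. -/
lemma ae_differentiableAt_of_family (h : EscapingConj f g φ) (hσ : ∀ z, z ≠ 0 → σ z ≠ 0)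
    (he : ContinuousOn e (Ioi (maxCrit f)))
    (ht : ∀ z ∈ outer f, bottcher g (φ z) = σ (bottcher f z) * Complex.exp (e (green f z)))
    {Γ : ℝ → ℝ → ℂ} {v : ℂ} (hΓ : ∀ s x, HasStrictDerivAt (Γ s) v x)
    (hΓc : Continuous fun q : ℝ × ℝ => Γ q.1 q.2) {s₀ r₀ : ℝ} (hz : Γ s₀ r₀ ∈ outer f)
    (hreg : (v * (deriv (bottcher f) (Γ s₀ r₀) / bottcher f (Γ s₀ r₀))).re ≠ 0)
    (hac : ∀ δ : ℝ, 0 < δ →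
      (∀ s ∈ Icc (s₀ - δ) (s₀ + δ), ∀ r ∈ Icc (r₀ - δ) (r₀ + δ), Γ s r ∈ outer f) →
      ∀ᵐ s, s ∈ Icc (s₀ - δ) (s₀ + δ) →
        AbsolutelyContinuousOnInterval (fun r => φ (Γ s r)) (r₀ - δ) (r₀ + δ)) :
    ∃ V ∈ 𝓝 (green f (Γ s₀ r₀)), ∀ᵐ t, t ∈ V → DifferentiableAt ℝ e t := by
  have hbf := h.bottcher_left
  have hopen := isOpen_outer h.monic_left h.two_le
  set t₀ := green f (Γ s₀ r₀) with ht₀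
  have hac' : ContinuousOn (fun z => (v * (deriv (bottcher f) z / bottcher f z)).re) (outer f) := by
    refine Complex.continuous_re.comp_continuousOn (continuousOn_const.mul ?_)
    exact ((hbf.differentiableOn.deriv hopen).continuousOn).div hbf.differentiableOn.continuousOn
      fun z hz => hbf.ne_zero hz
  obtain ⟨P, hP⟩ : ∃ P : ℂ → Prop, ∀ z, P z ↔ z ∈ outer f ∧
      (v * (deriv (bottcher f) z / bottcher f z)).re ≠ 0 := ⟨_, fun _ => Iff.rfl⟩
  have hO : {q : ℝ × ℝ | P (Γ q.1 q.2)} ∈ 𝓝 (s₀, r₀) := by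
    have h1 : ∀ᶠ z in 𝓝 (Γ s₀ r₀), P z := by
      filter_upwards [hopen.mem_nhds hz,
        (hac'.continuousAt (hopen.mem_nhds hz)).eventually_ne hreg] with z h1 h2
      exact (hP z).2 ⟨h1, h2⟩
    exact (hΓc.continuousAt (x := (s₀, r₀))).eventually h1
  obtain ⟨ρ, hρ, hρO⟩ := Metric.mem_nhds_iff.1 hO
  have hp := (hbf.hasStrictDerivAt_green_comp h.monic_left h.two_le (hΓ s₀ r₀) hz).hasDerivAt
  set p' := (v * (deriv (bottcher f) (Γ s₀ r₀) / bottcher f (Γ s₀ r₀))).re with hp'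
  -- The difference quotients have the sign of the nonzero derivative, so `G_f - t₀` has opposite
  -- signs at `r₀ - δ` and `r₀ + δ`.
  have hslope : ∀ᶠ x in 𝓝[≠] r₀, 0 < slope (fun s => green f (Γ s₀ s)) r₀ x * p' := by
    have := (hasDerivAt_iff_tendsto_slope.1 hp).mul_const p'
    exact this.eventually (Ioi_mem_nhds (mul_self_pos.2 hreg))
  rw [eventually_nhdsWithin_iff] at hslope
  obtain ⟨ρ', hρ', hρ'O⟩ := Metric.mem_nhds_iff.1 hslope
  set δ := min ρ ρ' / 2 with hδ
  have hδ0 : 0 < δ := half_pos (lt_min hρ hρ')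
  have hδρ : δ < ρ := (half_lt_self (lt_min hρ hρ')).trans_le (min_le_left _ _)
  have hδρ' : δ < ρ' := (half_lt_self (lt_min hρ hρ')).trans_le (min_le_right _ _)
  have hsq : ∀ s ∈ Icc (s₀ - δ) (s₀ + δ), ∀ r ∈ Icc (r₀ - δ) (r₀ + δ), Γ s r ∈ outer f ∧
      (v * (deriv (bottcher f) (Γ s r) / bottcher f (Γ s r))).re ≠ 0 := by
    intro s hs r hr
    have : (s, r) ∈ Metric.ball (s₀, r₀) ρ := by
      rw [Metric.mem_ball, Prod.dist_eq, max_lt_iff, Real.dist_eq, Real.dist_eq, abs_lt, abs_lt]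
      exact ⟨⟨by linarith [hs.1], by linarith [hs.2]⟩, ⟨by linarith [hr.1], by linarith [hr.2]⟩⟩
    exact (hP _).1 (hρO this)
  have hsign : (green f (Γ s₀ (r₀ - δ)) - t₀) * (green f (Γ s₀ (r₀ + δ)) - t₀) < 0 := by
    have hp1 : r₀ + δ ∈ Metric.ball r₀ ρ' := by
      rw [Metric.mem_ball, Real.dist_eq, add_sub_cancel_left, abs_of_pos hδ0]; exact hδρ'
    have hm1 : r₀ - δ ∈ Metric.ball r₀ ρ' := by
      rw [Metric.mem_ball, Real.dist_eq, sub_sub_cancel_left, abs_neg, abs_of_pos hδ0]; exact hδρ'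
    have h1 := hρ'O hp1 (by simp [hδ0.ne'])
    have h2 := hρ'O hm1 (by simp [hδ0.ne'])
    rw [slope_def_field, ← ht₀] at h1 h2
    rw [add_sub_cancel_left] at h1
    rw [sub_sub_cancel_left] at h2
    set X := green f (Γ s₀ (r₀ + δ)) - t₀
    set Y := green f (Γ s₀ (r₀ - δ)) - t₀
    have h3 := mul_pos h1 h2
    have h4 : X / δ * p' * (Y / -δ * p') = -(Y * X) * (p' / δ) ^ 2 := by field_simp
    rw [h4] at h3
    have := pos_of_mul_pos_left h3 (sq_nonneg _)
    linarith
  have hcont : Continuous fun s => (green f (Γ s (r₀ - δ)) - t₀) * (green f (Γ s (r₀ + δ)) - t₀) := by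
    have hG := continuous_green h.monic_left h.two_le
    have h1 : ∀ r, Continuous fun s => green f (Γ s r) := fun r =>
      hG.comp (hΓc.comp (by fun_prop : Continuous fun s : ℝ => (s, r)))
    exact ((h1 _).sub continuous_const).mul ((h1 _).sub continuous_const)
  have hsnear : ∀ᶠ s in 𝓝 s₀, s ∈ Icc (s₀ - δ) (s₀ + δ) ∧
      (green f (Γ s (r₀ - δ)) - t₀) * (green f (Γ s (r₀ + δ)) - t₀) < 0 := by
    filter_upwards [Icc_mem_nhds (show s₀ - δ < s₀ by linarith) (show s₀ < s₀ + δ by linarith),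
      hcont.continuousAt.eventually (Iio_mem_nhds hsign)] with s h1 h2 using ⟨h1, h2⟩
  obtain ⟨O, hO1, hO2, hO3⟩ := mem_nhds_iff.1 hsnear
  obtain ⟨s, hsO, hs⟩ := (Measure.dense_of_ae
    (hac δ hδ0 fun s hs r hr => (hsq s hs r hr).1)).exists_mem_open hO2 ⟨s₀, hO3⟩
  obtain ⟨hsI, hssign⟩ := hO1 hs
  refine h.ae_differentiableAt_of_line hσ he ht (hΓ s) (x₀ := r₀ - δ) (x₁ := r₀ + δ) (by linarith)
    (fun r hr => (hsq s hsI r hr).1) (fun r hr => (hsq s hsI r hr).2) ?_ hssign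
  have := (hsO hsI).boundedVariationOn.ae_differentiableAt_of_mem_uIcc
  rwa [uIcc_of_le (by linarith)] at this

lemma ae_differentiableAt_twist (h : EscapingConj f g φ) (hacl : IsACLOn φ φ.source)
    (hσ : ∀ z, z ≠ 0 → σ z ≠ 0) (he : ContinuousOn e (Ioi (maxCrit f)))
    (ht : ∀ z ∈ outer f, bottcher g (φ z) = σ (bottcher f z) * Complex.exp (e (green f z))) :
    ∀ᵐ t, maxCrit f < t → DifferentiableAt ℝ e t := by
  have hloc : ∀ t₀, maxCrit f < t₀ → ∃ V ∈ 𝓝 t₀, ∀ᵐ t, t ∈ V → DifferentiableAt ℝ e t := by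
    intro t₀ ht₀
    obtain ⟨z, -, rfl⟩ := h.exists_green_eq (h.pos_left.trans ht₀)
    have hz : z ∈ outer f := ht₀
    have hzeq : ((z.re : ℝ) : ℂ) + (z.im : ℝ) * Complex.I = z := Complex.re_add_im z
    set A := deriv (bottcher f) z / bottcher f z with hA
    have hA0 : A ≠ 0 := div_ne_zero (h.bottcher_left.deriv_ne_zero h.monic_left h.two_le hz)
      (h.bottcher_left.ne_zero hz)
    have hsrc : ∀ {a b c d : ℝ}, (∀ x ∈ Icc a b, ∀ y ∈ Icc c d, (x : ℂ) + y * Complex.I ∈ outer f) →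
        Icc a b ×ℂ Icc c d ⊆ φ.source := by
      intro a b c d hsub w hw
      rw [Complex.mem_reProdIm] at hw
      rw [h.isConjugacy.source_eq, ← Complex.re_add_im w]
      exact h.outer_subset (hsub _ hw.1 _ hw.2)
    -- The derivative of `G_f` is `Re A` in the horizontal direction and `-Im A` in the vertical
    -- one. As `A ≠ 0`, one of the two families is transverse to the level curve.
    by_cases hre : A.re = 0
    · have him : A.im ≠ 0 := fun him => hA0 (Complex.ext hre him)
      have := h.ae_differentiableAt_of_family hσ he ht
        (Γ := fun s r => (s : ℂ) + r * Complex.I) (v := Complex.I) (s₀ := z.re) (r₀ := z.im)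
        (fun s x => by
          simpa using ((Complex.ofRealCLM.hasStrictDerivAt (x := x)).mul_const Complex.I).const_add (s : ℂ))
        (by fun_prop) (by rwa [hzeq]) (by rw [hzeq, ← hA]; simpa using him)
        (fun δ hδ hsub => (hacl _ _ _ _ (by linarith) (by linarith) (hsrc hsub)).2)
      rwa [hzeq] at this
    · have := h.ae_differentiableAt_of_family hσ he ht
        (Γ := fun s r => (r : ℂ) + s * Complex.I) (v := 1) (s₀ := z.im) (r₀ := z.re)
        (fun s x => by
          simpa using (Complex.ofRealCLM.hasStrictDerivAt (x := x)).add_const ((s : ℂ) * Complex.I))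
        (by fun_prop) (by rwa [hzeq]) (by rw [hzeq, ← hA]; simpa using hre)
        (fun δ hδ hsub => (hacl _ _ _ _ (by linarith) (by linarith)
          (hsrc fun x hx y hy => hsub y hy x hx)).1)
      rwa [hzeq] at this
  refine measure_null_of_locally_null _ fun t htt => ?_
  rw [mem_compl_iff, mem_ofPred_eq, Classical.not_imp] at htt
  obtain ⟨V, hV, hVd⟩ := hloc t htt.1
  refine ⟨{t | ¬ (maxCrit f < t → DifferentiableAt ℝ e t)} ∩ V,
    inter_mem self_mem_nhdsWithin (mem_nhdsWithin_of_mem_nhds hV), ?_⟩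
  refine measure_mono_null (fun s hs => ?_) hVd
  exact fun hcon => hs.1 fun _ => hcon hs.2

end Twist

end EscapingConj

end PolyBasin

namespace PolyBasin

/-! ### Null sets -/

/-- Locally the preimage is the image of a null set under a holomorphic inverse branch. -/
lemma volume_inter_preimage_eq_zero {F : ℂ → ℂ} {Ω N : Set ℂ} (hF : ∀ z ∈ Ω, AnalyticAt ℂ F z)
    (h0 : ∀ z ∈ Ω, deriv F z ≠ 0) (hN : volume N = 0) : volume (Ω ∩ F ⁻¹' N) = 0 := by
  refine measure_null_of_locally_null _ fun z hz => ?_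
  obtain ⟨U, hU, hinj⟩ := eventually_injOn (hF z hz.1).hasStrictDerivAt (h0 z hz.1)
  obtain ⟨V, hV, hVo, hzV⟩ := mem_nhds_iff.1 (inter_mem hU (hF z hz.1).eventually_analyticAt)
  refine ⟨V ∩ F ⁻¹' N, ?_, ?_⟩
  · rw [← nhdsWithin_inter_of_mem' (t := V) (mem_nhdsWithin_of_mem_nhds (hVo.mem_nhds hzV))]
    exact mem_of_superset self_mem_nhdsWithin fun w hw => ⟨hw.2, hw.1.2⟩
  · have hinjV : InjOn F V := hinj.mono fun x hx => (hV hx).1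
    have hdV : DifferentiableOn ℂ F V := fun x hx =>
      (show AnalyticAt ℂ F x from (hV hx).2).differentiableAt.differentiableWithinAt
    have hsub : V ∩ F ⁻¹' N ⊆ Function.invFunOn F V '' (N ∩ F '' V) := fun x hx =>
      ⟨F x, ⟨hx.2, x, hx.1, rfl⟩, hinjV.leftInvOn_invFunOn hx.1⟩
    refine measure_mono_null hsub ?_
    refine addHaar_image_eq_zero_of_differentiableOn_of_addHaar_eq_zero volume ?_
      (measure_mono_null inter_subset_left hN)
    rintro _ ⟨-, x, hx, rfl⟩
    exact ((hasStrictDerivAt_invFunOn hVo hdV hinjV hx).1.hasDerivAt.differentiableAt.restrictScalars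
      ℝ).differentiableWithinAt

/-- The set lies in the `exp`-image of the vertical lines over `N`, a null set by the product
structure. -/
lemma volume_log_norm_preimage_eq_zero {N : Set ℝ} (hN : volume N = 0) :
    volume {w : ℂ | w ≠ 0 ∧ Real.log ‖w‖ ∈ N} = 0 := by
  have h1 : volume {ζ : ℂ | ζ.re ∈ N} = 0 := by
    have h2 := (Measure.quasiMeasurePreserving_fst (μ := (volume : Measure ℝ))
      (ν := (volume : Measure ℝ))).comp
      Complex.volume_preserving_equiv_real_prod.quasiMeasurePreserving
    exact h2.preimage_null hN
  refine measure_mono_null (t := Complex.exp '' {ζ : ℂ | ζ.re ∈ N}) ?_ ?_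
  · rintro w ⟨hw, hwN⟩
    exact ⟨Complex.log w, by rwa [mem_ofPred_eq, Complex.log_re], Complex.exp_log hw⟩
  · exact addHaar_image_eq_zero_of_differentiableOn_of_addHaar_eq_zero volume
      (fun x _ => ((Complex.hasDerivAt_exp x).differentiableAt.restrictScalars
        ℝ).differentiableWithinAt) h1

variable {f g : ℂ[X]} {φ : OpenPartialHomeomorph ℂ ℂ}

lemma finite_deriv_iter_eq_zero (hd : 2 ≤ f.natDegree) (n : ℕ) :
    {z | deriv (iter f n) z = 0}.Finite := by
  have h : iter f n = fun z => (iterPoly f n).eval z := by ext; rw [eval_iterPoly]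
  have h0 : (iterPoly f n).derivative ≠ 0 := by
    intro h0
    have := derivative_eq_zero.1 h0
    rw [natDegree_iterPoly] at this
    have : 0 < f.natDegree ^ n := by positivity
    omega
  refine ((iterPoly f n).derivative.roots.toFinset.finite_toSet).subset fun z hz => ?_
  simp only [Finset.mem_coe, Multiset.mem_toFinset, mem_roots h0]
  rw [mem_ofPred_eq, h, Polynomial.deriv] at hz
  exact hz

/-- The exceptional points are countably many critical points of iterates, together with countably
many preimages of a null set under the maps `b ∘ fⁿ` where these are locally biholomorphic. -/
lemma IsBottcher.ae_exists_iter {b : ℂ → ℂ} (hb : IsBottcher f b) (hf : f.Monic)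
    (hd : 2 ≤ f.natDegree) {N : Set ℝ} (hN : volume N = 0) :
    ∀ᵐ z : ℂ, z ∈ basin f → ∃ n, iter f n z ∈ outer f ∧ deriv (iter f n) z ≠ 0 ∧
      green f (iter f n z) ∉ N := by
  set A : Set ℂ := ⋃ n : ℕ, {z | deriv (iter f n) z = 0}
  set Ω : ℕ → Set ℂ := fun n => {z | iter f n z ∈ outer f ∧ deriv (iter f n) z ≠ 0} with hΩ
  set B : Set ℂ := ⋃ n : ℕ, Ω n ∩ (b ∘ iter f n) ⁻¹' {w : ℂ | w ≠ 0 ∧ Real.log ‖w‖ ∈ N}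
  have hA : volume A = 0 :=
    measure_iUnion_null fun n => (finite_deriv_iter_eq_zero hd n).measure_zero _
  have hB : volume B = 0 := by
    refine measure_iUnion_null fun n => ?_
    refine volume_inter_preimage_eq_zero (fun z hz => ?_) (fun z hz => ?_)
      (volume_log_norm_preimage_eq_zero hN)
    · exact (hb.analyticAt hf hd hz.1).comp ((differentiable_iter f n).analyticAt z)
    · rw [deriv_comp _ (hb.analyticAt hf hd hz.1).differentiableAt (differentiable_iter f n z)]
      exact mul_ne_zero (hb.deriv_ne_zero hf hd hz.1) hz.2
  refine measure_mono_null (fun z hz => ?_) (measure_union_null hA hB)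
  rw [mem_compl_iff, mem_ofPred_eq, Classical.not_imp] at hz
  by_contra hcon
  rw [mem_union, not_or] at hcon
  obtain ⟨n, hn⟩ := exists_iter_mem_outer hf hd hz.1
  have h1 : deriv (iter f n) z ≠ 0 := fun h => hcon.1 (mem_iUnion.2 ⟨n, h⟩)
  refine hz.2 ⟨n, hn, h1, fun h2 => hcon.2 (mem_iUnion.2 ⟨n, ⟨hn, h1⟩, ?_⟩)⟩
  exact ⟨hb.ne_zero hn, by rw [Function.comp, ← hb.green_eq hf hd hn]; exact h2⟩

/-! ### Wirtinger derivatives -/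

lemma dz_eq_of_hasFDerivAt {F : ℂ → ℂ} {L : ℂ →L[ℝ] ℂ} {z : ℂ} (h : HasFDerivAt F L z) :
    dz F z = (L 1 - Complex.I * L Complex.I) / 2 := by
  rw [dz, (h.hasLineDerivAt 1).lineDeriv, (h.hasLineDerivAt Complex.I).lineDeriv]

lemma dzbar_eq_of_hasFDerivAt {F : ℂ → ℂ} {L : ℂ →L[ℝ] ℂ} {z : ℂ} (h : HasFDerivAt F L z) :
    dzbar F z = (L 1 + Complex.I * L Complex.I) / 2 := by
  rw [dzbar, (h.hasLineDerivAt 1).lineDeriv, (h.hasLineDerivAt Complex.I).lineDeriv]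

lemma IsBottcher.hasFDerivAt_green_iter {b : ℂ → ℂ} (hb : IsBottcher f b) (hf : f.Monic)
    (hd : 2 ≤ f.natDegree) {z : ℂ} {n : ℕ} (hz : iter f n z ∈ outer f) :
    HasFDerivAt (fun w => green f (iter f n w))
      (Complex.reCLM ∘L ((deriv (b ∘ iter f n) z / (b ∘ iter f n) z) •
        ContinuousLinearMap.id ℝ ℂ)) z := by
  obtain ⟨u, hu, hu'⟩ := hb.exists_local_log hf hd hz
  have hi := differentiable_iter f n z
  have h1 := hu.hasDerivAt.comp z hi.hasDerivAt
  have h2 : HasFDerivAt (u ∘ iter f n) ((deriv (b ∘ iter f n) z / (b ∘ iter f n) z) •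
        ContinuousLinearMap.id ℝ ℂ) z := by
    have h3 := h1.comp_hasFDerivAt (f := id) z (hasFDerivAt_id (𝕜 := ℝ) z)
    rw [deriv_comp _ (hb.analyticAt hf hd hz).differentiableAt hi, Function.comp, mul_div_right_comm]
    exact h3
  refine (Complex.reCLM.hasFDerivAt.comp z h2).congr_of_eventuallyEq ?_
  filter_upwards [(continuous_iter f n).continuousAt.eventually hu'] with w hw
  exact hw

namespace EscapingConj

lemma deriv_iter_map_ne_zero (h : EscapingConj f g φ) {z : ℂ} {n : ℕ} (hz : z ∈ basin f)
    (h0 : deriv (iter f n) z ≠ 0) : deriv (iter g n) (φ z) ≠ 0 := by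
  intro h1
  have hs := h.symm
  have h2 := deriv_eq_zero_of_conj φ.symm (differentiable_iter g n) (differentiable_iter f n)
    (z := φ z) (by rw [hs.isConjugacy.source_eq]; exact h.isConjugacy.mapsTo hz)
    (fun w hw => hs.isConjugacy.iter_eq hs.monic_left hs.two_le
      (by rwa [← hs.isConjugacy.source_eq]) n) h1
  rw [φ.left_inv (by rwa [h.isConjugacy.source_eq])] at h2
  exact h0 h2

/-- The derivative of a conjugacy in terms of the derivative of the angular function. -/
lemma exists_hasFDerivAt (h : EscapingConj f g φ) {σ : ℂ →L[ℝ] ℂ} {e : ℝ → ℂ} {e' : ℂ}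
    (hσ0 : ∀ z, z ≠ 0 → σ z ≠ 0) (hσm : ∀ z w, σ (z * w) = σ z * σ w)
    (ht : ∀ z ∈ outer f, bottcher g (φ z) = σ (bottcher f z) * Complex.exp (e (green f z)))
    {z : ℂ} {n : ℕ} (hzb : z ∈ basin f) (hz : iter f n z ∈ outer f)
    (h0 : deriv (iter f n) z ≠ 0) (he : HasDerivAt e e' (green f (iter f n z))) :
    ∃ c α : ℂ, c ≠ 0 ∧ α ≠ 0 ∧
      (∃ L : ℂ →L[ℝ] ℂ, HasFDerivAt φ L z ∧
        ∀ v, L v = c * (σ (α * v) + e' * ((α * v).re : ℝ))) ∧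
      ∃ L : ℂ →L[ℝ] ℝ, HasFDerivAt (green f) L z ∧
        ∀ v, L v = (α * v).re / (f.natDegree : ℝ) ^ n := by
  have hf := h.monic_left
  have hd := h.two_le
  have hbf := h.bottcher_left
  have hbg := h.bottcher_right
  have hsrc : φ.source ∈ 𝓝 z := φ.open_source.mem_nhds (by rwa [h.isConjugacy.source_eq])
  set U : ℂ → ℂ := bottcher f ∘ iter f n with hU
  set V : ℂ → ℂ := bottcher g ∘ iter g n with hV
  have hout : iter g n (φ z) ∈ outer g := by
    rw [← h.isConjugacy.iter_eq hf hd hzb]; exact h.map_mem_outer hz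
  have hU0 : U z ≠ 0 := hbf.ne_zero hz
  have hUd : HasDerivAt U (deriv U z) z :=
    ((hbf.analyticAt hf hd hz).differentiableAt.comp z (differentiable_iter f n z)).hasDerivAt
  have hU' : deriv U z ≠ 0 := by
    rw [hU, deriv_comp _ (hbf.analyticAt hf hd hz).differentiableAt (differentiable_iter f n z)]
    exact mul_ne_zero (hbf.deriv_ne_zero hf hd hz) h0
  have hVan := (hbg.analyticAt h.monic_right h.two_le' hout).comp
    ((differentiable_iter g n).analyticAt (φ z))
  have hV' : deriv V (φ z) ≠ 0 := by
    rw [hV, deriv_comp _ (hbg.analyticAt h.monic_right h.two_le' hout).differentiableAt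
      (differentiable_iter g n _)]
    exact mul_ne_zero (hbg.deriv_ne_zero h.monic_right h.two_le' hout)
      (h.deriv_iter_map_ne_zero hzb h0)
  -- Near `z` one has `V ∘ φ = W` with `V` locally invertible, so `φ = l ∘ W`. Differentiability of
  -- `φ` at `z` comes from this formula, with no appeal to general quasiconformal theory.
  obtain ⟨l, -, hl, hl1, -⟩ := exists_local_inverse hVan.hasStrictDerivAt hV'
  set W : ℂ → ℂ := fun w => σ (U w) * Complex.exp (e (green f (iter f n w))) with hW
  have hVW : ∀ᶠ w in 𝓝 z, V (φ w) = W w := by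
    filter_upwards [hsrc, (continuous_iter f n).continuousAt.eventually
      ((isOpen_outer hf hd).mem_nhds hz)] with w hw1 hw2
    rw [h.isConjugacy.source_eq] at hw1
    simp only [hV, hW, hU, Function.comp]
    rw [← h.isConjugacy.iter_eq hf hd hw1]
    exact ht _ hw2
  set α := deriv U z / U z with hα
  have hG := hbf.hasFDerivAt_green_iter hf hd hz
  set X := Complex.exp (e (green f (iter f n z))) with hX
  have hWd : ∃ L : ℂ →L[ℝ] ℂ, HasFDerivAt W L z ∧
      ∀ v, L v = σ (U z) * X * (σ (α * v) + e' * ((α * v).re : ℝ)) := by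
    have h1 : HasFDerivAt (fun w => σ (U w)) (σ ∘L (deriv U z • ContinuousLinearMap.id ℝ ℂ)) z :=
      σ.hasFDerivAt.comp z (hUd.comp_hasFDerivAt (f := id) z (hasFDerivAt_id (𝕜 := ℝ) z))
    have h2 : HasFDerivAt (fun w => e (green f (iter f n w))) _ z := he.hasFDerivAt.comp z hG
    have h3 := (Complex.hasDerivAt_exp _).comp_hasFDerivAt z h2
    refine ⟨_, h1.mul h3, fun v => ?_⟩
    -- Multiplicativity of `σ`, which is the identity or conjugation in the applications, allows `σ
    -- (U z)` to be factored out and leaves the logarithmic derivative `α`.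
    have h4 : σ (deriv U z * v) = σ (U z) * σ (α * v) := by
      rw [← hσm, hα]; congr 1; field_simp
    simp only [add_apply, smul_apply, ContinuousLinearMap.comp_apply, ContinuousLinearMap.id_apply,
      smul_eq_mul, ContinuousLinearMap.toSpanSingleton_apply, h4, Complex.reCLM_apply,
      Complex.real_smul]
    rw [hX, hα]
    ring
  obtain ⟨L, hL, hLv⟩ := hWd
  refine ⟨(deriv V (φ z))⁻¹ * (σ (U z) * X), α,
    mul_ne_zero (inv_ne_zero hV') (mul_ne_zero (hσ0 _ hU0) (Complex.exp_ne_zero _)),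
    div_ne_zero hU' hU0, ⟨(deriv V (φ z))⁻¹ • L, ?_, fun v => ?_⟩,
    ((f.natDegree : ℝ) ^ n)⁻¹ • (Complex.reCLM ∘L (α • ContinuousLinearMap.id ℝ ℂ)), ?_, fun v => ?_⟩
  · have hl' := hl.hasDerivAt
    rw [show (bottcher g ∘ iter g n) (φ z) = W z from hVW.self_of_nhds] at hl'
    refine (hl'.comp_hasFDerivAt z hL).congr_of_eventuallyEq ?_
    filter_upwards [hVW, (φ.continuousAt (mem_of_mem_nhds hsrc)).eventually hl1] with w h1 h2
    rw [Function.comp, ← h1]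
    exact h2.symm
  · rw [smul_apply, hLv, smul_eq_mul]; ring
  · refine (hG.const_smul ((f.natDegree : ℝ) ^ n)⁻¹).congr_of_eventuallyEq
      (Eventually.of_forall fun w => ?_)
    have : (f.natDegree : ℝ) ^ n ≠ 0 := by positivity
    simp [green_iter hf hd, this]
  · simp [div_eq_inv_mul]

end EscapingConj

end PolyBasin

/-! ### Derivatives of the stretching and turning parts, and the Beltrami coefficient. -/

namespace PolyBasin

variable {f g : ℂ[X]} {φ : OpenPartialHomeomorph ℂ ℂ}

/-- The factor `c` from the chain rule cancels the one in the functional equation, so derivatives at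
a high level `dⁿ t` are also derivatives at `t`. -/
lemma hasDerivAt_of_scale {F : ℝ → ℝ} {c k D t : ℝ} (hc : 0 < c) (ht : 0 < t)
    (hF : ∀ u, 0 < u → F (c * u) = c * F u + k) (h : HasDerivAt F D (c * t)) :
    HasDerivAt F D t := by
  have h1 : HasDerivAt (fun u => c⁻¹ * (F (c * u) - k)) (c⁻¹ * (D * (c * 1))) t :=
    (((h.comp t ((hasDerivAt_id t).const_mul c))).sub_const k).const_mul c⁻¹
  rw [show c⁻¹ * (D * (c * 1)) = D by field_simp] at h1
  refine h1.congr_of_eventuallyEq ?_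
  filter_upwards [Ioi_mem_nhds ht] with u hu
  rw [hF u hu, add_sub_cancel_right, inv_mul_cancel_left₀ hc.ne']

lemma IsTurningPart.exists_map_pow_mul {T : ℝ → ℝ} (hT : IsTurningPart f g φ T)
    (hd : 2 ≤ f.natDegree) (n : ℕ) :
    ∃ k : ℝ, ∀ t : ℝ, 0 < t → T ((f.natDegree : ℝ) ^ n * t) = (f.natDegree : ℝ) ^ n * T t + k := by
  obtain ⟨m, hm⟩ := hT.map_mul
  induction n with
  | zero => exact ⟨0, fun t _ => by simp⟩
  | succ n ih =>
    obtain ⟨k, hk⟩ := ih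
    refine ⟨f.natDegree * k + 2 * Real.pi * m, fun t ht => ?_⟩
    rw [pow_succ', mul_assoc, hm _ (by positivity), hk t ht]
    ring

/-- The derivative of `t ↦ S t - t + i T t` determines those of `S` and `T`. -/
lemma hasDerivAt_re_im {S T : ℝ → ℝ} {e' : ℂ} {t : ℝ}
    (he : HasDerivAt (fun t => ((S t - t : ℝ) : ℂ) + T t * Complex.I) e' t) :
    HasDerivAt S (e'.re + 1) t ∧ HasDerivAt T e'.im t := by
  have h1 := Complex.reCLM.hasFDerivAt.comp_hasDerivAt t he
  have h2 := Complex.imCLM.hasFDerivAt.comp_hasDerivAt t he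
  constructor
  · refine (h1.add (hasDerivAt_id t)).congr_of_eventuallyEq (Eventually.of_forall fun u => ?_)
    simp
  · refine h2.congr_of_eventuallyEq (Eventually.of_forall fun u => ?_)
    simp

lemma HasDerivAt.nonneg_of_strictMonoOn_Ioi {S : ℝ → ℝ} {D t : ℝ} (hS : StrictMonoOn S (Ioi 0))
    (ht : 0 < t) (h : HasDerivAt S D t) : 0 ≤ D := by
  have h1 := hS.monotoneOn.derivWithin_nonneg (x := t)
  rwa [derivWithin_of_mem_nhds (Ioi_mem_nhds ht), h.deriv] at h1

namespace EscapingConj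

lemma hasDerivAt_stretch_nonneg (h : EscapingConj f g φ) {S : ℝ → ℝ}
    (hS : IsStretchingPart f g φ S) {D t : ℝ} (ht : 0 < t) (hD : HasDerivAt S D t) : 0 ≤ D :=
  HasDerivAt.nonneg_of_strictMonoOn_Ioi (h.strictMonoOn_stretch hS) ht hD

lemma continuousOn_twist (h : EscapingConj f g φ) {S τ : ℝ → ℝ} (hS : IsStretchingPart f g φ S)
    (hτ : ContinuousOn τ (Ioi (maxCrit f))) :
    ContinuousOn (fun t => ((S t - t : ℝ) : ℂ) + τ t * Complex.I) (Ioi (maxCrit f)) := by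
  have h1 : ContinuousOn S (Ioi (maxCrit f)) :=
    (h.continuousOn_stretch hS).mono (Ioi_subset_Ioi h.pos_left.le)
  exact (Complex.continuous_ofReal.comp_continuousOn (h1.sub continuousOn_id)).add
    ((Complex.continuous_ofReal.comp_continuousOn hτ).mul continuousOn_const)

/-- An orientation-reversing twist is not quasiconformal. -/
lemma not_conj_twist (h : EscapingConj f g φ) (hqc : IsQuasiconformal φ) {S τ : ℝ → ℝ}
    (hS : IsStretchingPart f g φ S) (hτ : ContinuousOn τ (Ioi (maxCrit f)))
    (ht : ∀ z ∈ outer f, bottcher g (φ z) = conj (bottcher f z) *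
      Complex.exp (((S (green f z) - green f z : ℝ) : ℂ) + τ (green f z) * Complex.I)) : False := by
  have hf := h.monic_left
  have hd := h.two_le
  set e : ℝ → ℂ := fun t => ((S t - t : ℝ) : ℂ) + τ t * Complex.I with he
  set σ : ℂ →L[ℝ] ℂ := (Complex.conjCLE : ℂ →L[ℝ] ℂ) with hσ
  have hσc : ∀ z, σ z = conj z := fun z => rfl
  have hσ0 : ∀ z, z ≠ 0 → σ z ≠ 0 := fun z hz => by simpa [hσc] using hz
  replace ht : ∀ z ∈ outer f, bottcher g (φ z) =
    σ (bottcher f z) * Complex.exp (e (green f z)) := ht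
  have hN := h.ae_differentiableAt_twist hqc.1 hσ0 (h.continuousOn_twist hS hτ) ht
  obtain ⟨k, hk0, hk1, hk⟩ := hqc.2
  have hae := (h.bottcher_left.ae_exists_iter hf hd (ae_iff.1 hN)).and hk
  have hne : (outer f).Nonempty := by
    obtain ⟨z, -, hz⟩ := h.exists_green_eq (t := maxCrit f + 1) (by linarith [h.pos_left])
    exact ⟨z, by rw [outer, mem_ofPred_eq, hz]; linarith⟩
  obtain ⟨z, ⟨hz, hzk⟩, hzo⟩ := (Measure.dense_of_ae hae).exists_mem_open (isOpen_outer hf hd) hne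
  have hzb := h.outer_subset hzo
  obtain ⟨n, hn, h0, hdiff⟩ := hz hzb
  have hD := ((not_not.1 hdiff) hn).hasDerivAt
  set e' := deriv e (green f (iter f n z)) with he'
  have hre : 0 ≤ e'.re + 1 :=
    h.hasDerivAt_stretch_nonneg hS (h.pos_left.trans hn) (hasDerivAt_re_im hD).1
  obtain ⟨c, α, hc, hα, ⟨L, hL, hLv⟩, -⟩ := h.exists_hasFDerivAt hσ0
    (fun z w => by simp [hσc]) ht hzb hn h0 hD
  have h1 : dz φ z = c * α * (e' / 2) := by
    rw [dz_eq_of_hasFDerivAt hL, hLv, hLv, hσc, hσc]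
    apply Complex.ext <;> simp <;> ring
  have h2 : dzbar φ z = c * conj α * (1 + e' / 2) := by
    rw [dzbar_eq_of_hasFDerivAt hL, hLv, hLv, hσc, hσc]
    apply Complex.ext <;> simp <;> ring
  have h3 := hzk (by rwa [h.isConjugacy.source_eq])
  rw [h1, h2, norm_mul, norm_mul, norm_mul, norm_mul, RCLike.norm_conj,
    show k * (‖c‖ * ‖α‖ * ‖e' / 2‖) = ‖c‖ * ‖α‖ * (k * ‖e' / 2‖) by ring] at h3
  have h4 := le_of_mul_le_mul_left h3 (by positivity)
  -- This is equivalent to `Re e' ≥ -1`, that is, to `S' ≥ 0`. With `1 + e' / 2 ≠ 0` it contradicts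
  -- `|∂̄φ| ≤ k |∂φ|` for `k < 1`.
  have h5 : ‖e' / 2‖ ≤ ‖1 + e' / 2‖ := by
    refine (sq_le_sq₀ (norm_nonneg _) (norm_nonneg _)).1 ?_
    rw [Complex.sq_norm, Complex.sq_norm, Complex.normSq_apply, Complex.normSq_apply]
    simp
    linarith
  have h6 : 0 < ‖1 + e' / 2‖ := by
    refine norm_pos_iff.2 fun h7 => ?_
    have := congrArg Complex.re h7
    simp at this
    linarith
  nlinarith [norm_nonneg (e' / 2)]

lemma exists_turningPart (h : EscapingConj f g φ) (hqc : IsQuasiconformal φ) :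
    ∃ T, IsTurningPart f g φ T := by
  obtain ⟨S, hS⟩ := h.exists_isStretchingPart
  obtain ⟨τ, m, s, hs, hτ, hm, ha⟩ := h.exists_angular hS
  rcases hs with rfl | rfl
  · exact h.exists_isTurningPart hτ hm fun z hz => by simpa using ha z hz
  · exact (h.not_conj_twist hqc hS hτ fun z hz => h.conj_twist_of_angular hz (ha z hz)).elim

/-- The Beltrami coefficient of a conjugacy between basins of infinity. -/
theorem ae_beltrami (h : EscapingConj f g φ) (hqc : IsQuasiconformal φ) {S T : ℝ → ℝ}
    (hS : IsStretchingPart f g φ S) (hT : IsTurningPart f g φ T) :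
    ∀ᵐ z : ℂ, z ∈ basin f →
      DifferentiableAt ℝ φ z ∧ dz φ z ≠ 0 ∧
      DifferentiableAt ℝ (green f) z ∧ dz (fun w => (green f w : ℂ)) z ≠ 0 ∧
      DifferentiableAt ℝ S (green f z) ∧ DifferentiableAt ℝ T (green f z) ∧
      ((deriv S (green f z) : ℝ) : ℂ) + Complex.I * ((deriv T (green f z) : ℝ) : ℂ) + 1 ≠ 0 ∧
      dzbar φ z / dz φ z =
        (((deriv S (green f z) : ℝ) : ℂ) + Complex.I * ((deriv T (green f z) : ℝ) : ℂ) - 1) /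
          (((deriv S (green f z) : ℝ) : ℂ) + Complex.I * ((deriv T (green f z) : ℝ) : ℂ) + 1) *
        (dzbar (fun w => (green f w : ℂ)) z / dz (fun w => (green f w : ℂ)) z) := by
  have hf := h.monic_left
  have hd := h.two_le
  set e : ℝ → ℂ := fun t => ((S t - t : ℝ) : ℂ) + T t * Complex.I with he
  set σ : ℂ →L[ℝ] ℂ := ContinuousLinearMap.id ℝ ℂ with hσ
  have hσ0 : ∀ z, z ≠ 0 → σ z ≠ 0 := fun z hz => hz
  have ht : ∀ z ∈ outer f, bottcher g (φ z) = σ (bottcher f z) * Complex.exp (e (green f z)) :=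
    fun z hz => h.twist_of_angular hz (h.angular_of_isTurningPart hS hT hz)
  have hN := h.ae_differentiableAt_twist hqc.1 hσ0
    (h.continuousOn_twist hS (hT.continuousOn.mono (Ioi_subset_Ioi h.pos_left.le))) ht
  filter_upwards [h.bottcher_left.ae_exists_iter hf hd (ae_iff.1 hN)] with z hz hzb
  obtain ⟨n, hn, h0, hdiff⟩ := hz hzb
  have hD := ((not_not.1 hdiff) hn).hasDerivAt
  obtain ⟨c, α, hc, hα, ⟨L, hL, hLv⟩, K, hK, hKv⟩ := h.exists_hasFDerivAt hσ0
    (fun z w => rfl) ht hzb hn h0 hD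
  set e' := deriv e (green f (iter f n z)) with he'
  have hz0 : 0 < green f z := (mem_basin_iff hf hd).1 hzb
  have hp : (0 : ℝ) < (f.natDegree : ℝ) ^ n := by positivity
  obtain ⟨hS1, hT1⟩ := hasDerivAt_re_im hD
  rw [green_iter hf hd] at hS1 hT1
  obtain ⟨k, hk⟩ := hT.exists_map_pow_mul hd n
  have hS2 : HasDerivAt S (e'.re + 1) (green f z) :=
    hasDerivAt_of_scale (k := 0) hp hz0
      (fun u hu => by rw [h.stretch_pow_mul hS n hu, add_zero]) hS1
  have hT2 : HasDerivAt T e'.im (green f z) := hasDerivAt_of_scale hp hz0 hk hT1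
  have hre : 0 ≤ e'.re + 1 := h.hasDerivAt_stretch_nonneg hS hz0 hS2
  have hsum : ((deriv S (green f z) : ℝ) : ℂ) + Complex.I * ((deriv T (green f z) : ℝ) : ℂ) =
      e' + 1 := by
    rw [hS2.deriv, hT2.deriv]
    apply Complex.ext <;> simp
  have hne : e' + 1 + 1 ≠ 0 := fun h7 => by
    have := congrArg Complex.re h7
    simp at this
    linarith
  have hG : HasFDerivAt (fun w => (green f w : ℂ)) (Complex.ofRealCLM ∘L K) z :=
    Complex.ofRealCLM.hasFDerivAt.comp z hK
  set p : ℂ := (f.natDegree : ℂ) ^ n with hpp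
  have hp0 : p ≠ 0 := by
    rw [hpp]; exact_mod_cast hp.ne'
  have hGv : ∀ v, (Complex.ofRealCLM ∘L K) v = ((α * v).re : ℂ) / p := fun v => by
    rw [ContinuousLinearMap.comp_apply, hKv, Complex.ofRealCLM_apply, hpp]; push_cast; rfl
  -- Writing `Re(αv) = (αv + ᾱ v̄) / 2`, the Wirtinger derivatives are the coefficients of `v` and
  -- `v̄` in `c(αv + e' Re(αv))`.
  have h1 : dz φ z = c * α * (e' + 1 + 1) / 2 := by
    rw [dz_eq_of_hasFDerivAt hL, hLv, hLv, hσ]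
    apply Complex.ext <;> simp <;> ring
  have h2 : dzbar φ z = c * conj α * e' / 2 := by
    rw [dzbar_eq_of_hasFDerivAt hL, hLv, hLv, hσ]
    apply Complex.ext <;> simp <;> ring
  have h3 : dz (fun w => (green f w : ℂ)) z = α / 2 / p := by
    rw [dz_eq_of_hasFDerivAt hG, hGv, hGv, mul_div_assoc', ← sub_div, div_right_comm]
    congr 1
    apply Complex.ext <;> simp
  have h4 : dzbar (fun w => (green f w : ℂ)) z = conj α / 2 / p := by
    rw [dzbar_eq_of_hasFDerivAt hG, hGv, hGv, mul_div_assoc', ← add_div, div_right_comm]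
    congr 1
    apply Complex.ext <;> simp
  refine ⟨hL.differentiableAt, ?_, hK.differentiableAt, ?_, hS2.differentiableAt,
    hT2.differentiableAt, by rwa [hsum], ?_⟩
  · rw [h1]; exact div_ne_zero (mul_ne_zero (mul_ne_zero hc hα) hne) two_ne_zero
  · rw [h3]; exact div_ne_zero (div_ne_zero hα two_ne_zero) hp0
  · rw [hsum, h1, h2, h3, h4, add_sub_cancel_right]
    field_simp

end EscapingConj

end PolyBasin

theorem mainTheorem4 (d : ℕ) (hd : 2 ≤ d) (f g : ℂ[X])
    (hf : f.Monic) (hfd : f.natDegree = d) (hg : g.Monic) (hgd : g.natDegree = d)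
    (hesc : (critSet f ∩ basin f).Nonempty)
    (φ : OpenPartialHomeomorph ℂ ℂ) (hφ : IsConjugacy f g φ) (hqc : IsQuasiconformal φ) :
    (∃ S : ℝ → ℝ, IsStretchingPart f g φ S) ∧
    (∃ T : ℝ → ℝ, IsTurningPart f g φ T) ∧
    ∀ S T : ℝ → ℝ, IsStretchingPart f g φ S → IsTurningPart f g φ T →
      ∀ᵐ z : ℂ, z ∈ basin f →
        DifferentiableAt ℝ φ z ∧ dz φ z ≠ 0 ∧
        DifferentiableAt ℝ (green f) z ∧ dz (fun w => (green f w : ℂ)) z ≠ 0 ∧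
        DifferentiableAt ℝ S (green f z) ∧ DifferentiableAt ℝ T (green f z) ∧
        ((deriv S (green f z) : ℝ) : ℂ) + Complex.I * ((deriv T (green f z) : ℝ) : ℂ) + 1 ≠ 0 ∧
        dzbar φ z / dz φ z =
          (((deriv S (green f z) : ℝ) : ℂ) + Complex.I * ((deriv T (green f z) : ℝ) : ℂ) - 1) /
            (((deriv S (green f z) : ℝ) : ℂ) + Complex.I * ((deriv T (green f z) : ℝ) : ℂ) + 1) *
          (dzbar (fun w => (green f w : ℂ)) z / dz (fun w => (green f w : ℂ)) z) := by
  subst hfd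
  have h := hφ.escapingConj hf hg hd hgd hesc
  exact ⟨h.exists_isStretchingPart, h.exists_turningPart hqc, fun S T hS hT =>
    h.ae_beltrami hqc hS hT⟩
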